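/- Let $\mathcal D\subseteq\mathbb C^n$ be a domain all of whose points $t=(t_1,\dots,t_n)$ have pairwise distinct coordinates, and let $Q_1,\dots,Q_n$ be holomorphic functions on $\mathcal D$ with values in the complex $k\times k$ matrices such that $\sum_{j=1}^n Q_j(t)=0$ for all $t\in\mathcal D$. For $t\in\mathcal D$ let $Y(\cdot,t)$ be the solution of the Fuchsian system $$\frac{\partial Y}{\partial x}=\Big(\sum_{j=1}^n\frac{Q_j(t)}{x-t_j}\Big)Y,\qquad Y|_{x=\infty}=I,$$ on the universal covering surface of $\mathbb{CP}^1\setminus\{t_1,\dots,t_n\}$ with distinguished point $\infty$. The points of this surface are the pairs $(x,\alpha)$, where $\alpha$ is a homotopy class of paths from $\infty$ to $x$. For a loop $\gamma$ at $\infty$ in $\mathbb{CP}^1\setminus\{t_1,\dots,t_n\}$ let $M_\gamma(t)$ be the monodromy matrix of $Y(\cdot,t)$, that is, the constant matrix with $Y(x,\alpha\gamma,t)=Y(x,\alpha,t)\,M_\gamma(t)$ for all $(x,\alpha)$, where $\alpha\gamma$ runs first along $\gamma$, then along $\alpha$. An open cylindrical neighbourhood of a point $t^0$ is a product $\mathcal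 W=\mathcal W_1\times\dots\times\mathcal W_n$ of simply connected open neighbourhoods $\mathcal W_j\subseteq\mathbb C$ of $t^0_j$ such that $\mathbb C\setminus\overline{\mathcal W_j}$ is connected. The family is called isomonodromic with the distinguished point $\infty$ if every $t^0\in\mathcal D$ has an open cylindrical neighbourhood $\mathcal W$, with $\overline{\mathcal W}$ compact and contained in $\mathcal D$, such that $M_\gamma(t')=M_\gamma(t'')$ for all $t',t''\in\mathcal W$ and every loop $\gamma$ at $\infty$ in $\mathbb{CP}^1\setminus\bigcup_j\overline{\mathcal W_j}$. Then the family is isomonodromic with the distinguished point $\infty$ if and only if $Y$ satisfies a linear system of the form $$\frac{\partial Y}{\partial x}=\Big(\sum_{j=1}^n\frac{Q_j(t)}{x-t_j}\Big)Y,\qquad \frac{\partial Y}{\partial t_j}=T_j(x,t)\,Y,\quad 1\le j\le n,$$ where for each $t\in\mathcal D$ the functions $T_j(\cdot,t)$ are single-valued and holomorphic on $\mathbb{CP}^1\setminus\{t_1,\dots,t_n\}$ (including the point $\infty$). Here $\partial Y/\partial t_j$ is taken at a fixed path from $\infty$ to $x$ that avoids $t_1,\dots,t_n$; such a path also avoids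 the coordinates of all nearby parameter points. -/

import Mathlib

open scoped OnePoint

namespace Fuchsian

/-- The universal covering space of `X` with distinguished point `x₀`, as the set of pairs `(x, α)`
of a point `x` of `X` and a homotopy class `α` (with fixed ends) of paths in `X` from `x₀` to `x`. -/
def Cov (X : Type*) [TopologicalSpace X] (x₀ : X) : Type _ :=
  Σ x : X, Path.Homotopic.Quotient x₀ x

/-- The loop `γ` at `x₀` acts on the universal covering space as the deck transformation
`(x, α) ↦ (x, αγ)`, where `αγ` runs first along `γ` and then along `α`. -/
noncomputable def Cov.deck {X : Type*} [TopologicalSpace X] {x₀ : X} (γ : Path.Homotopic.Quotient x₀ x₀)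
    (p : Cov X x₀) : Cov X x₀ :=
  ⟨p.1, γ.trans p.2⟩

/-- A path in a topological space that stays in `S`, as a path in the subspace `S`. -/
def pathIn {X : Type*} [TopologicalSpace X] {x y : X} (γ : Path x y) {S : Set X}
    (h : ∀ s, γ s ∈ S) (hx : x ∈ S) (hy : y ∈ S) : Path (⟨x, hx⟩ : S) ⟨y, hy⟩ where
  toFun s := ⟨γ s, h s⟩
  continuous_toFun := γ.continuous.subtype_mk h
  source' := Subtype.ext γ.source
  target' := Subtype.ext γ.target

/-- The coordinate `w = 1 / x` at the point `∞` of the Riemann sphere `OnePoint ℂ`: the point of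
the sphere with `w`-coordinate `w`. -/
noncomputable def fromInvCoord (w : ℂ) : OnePoint ℂ :=
  if w = 0 then ∞ else ((w⁻¹ : ℂ) : OnePoint ℂ)

/-- A matrix function is holomorphic in the open subset `U` of the Riemann sphere, in the coordinate
`x` at finite points and in the coordinate `1 / x` at `∞`. -/
def HolomorphicOnSphere {k : ℕ} (F : OnePoint ℂ → Matrix (Fin k) (Fin k) ℂ)
    (U : Set (OnePoint ℂ)) : Prop :=
  (∀ z : ℂ, (z : OnePoint ℂ) ∈ U → DifferentiableAt ℂ (fun x : ℂ => F x) z) ∧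
  (∞ ∈ U → DifferentiableAt ℂ (fun w : ℂ => F (fromInvCoord w)) 0)

/-- The punctured Riemann sphere, without the points `t₁, …, tₙ`. -/
def puncturedSphere {n : ℕ} (t : Fin n → ℂ) : Set (OnePoint ℂ) :=
  {x | ∀ j, x ≠ (t j : OnePoint ℂ)}

lemma infty_mem_puncturedSphere {n : ℕ} (t : Fin n → ℂ) : ∞ ∈ puncturedSphere t :=
  fun j => OnePoint.infty_ne_coe (t j)

/-- The universal covering surface of the punctured sphere with distinguished point `∞`. -/
abbrev PuncturedCov {n : ℕ} (t : Fin n → ℂ) : Type :=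
  Cov (puncturedSphere t) ⟨∞, infty_mem_puncturedSphere t⟩

/-- The point `(x, α)` of the universal covering surface given by a path `α` in the Riemann sphere
from `∞` to `x` that avoids `t₁, …, tₙ`. -/
noncomputable def pointOver {n : ℕ} (t : Fin n → ℂ) {x : OnePoint ℂ} (α : Path ∞ x)
    (h : ∀ s, α s ∈ puncturedSphere t) : PuncturedCov t :=
  ⟨⟨x, α.target ▸ h 1⟩, .mk (pathIn α h _ _)⟩

/-- The class, in the fundamental group of the punctured sphere with distinguished point `∞`,
of a loop in the Riemann sphere that avoids `t₁, …, tₙ`. -/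
noncomputable def loopClass {n : ℕ} (t : Fin n → ℂ) (γ : Path (∞ : OnePoint ℂ) ∞)
    (h : ∀ s, γ s ∈ puncturedSphere t) :
    Path.Homotopic.Quotient (⟨∞, infty_mem_puncturedSphere t⟩ : puncturedSphere t)
      ⟨∞, infty_mem_puncturedSphere t⟩ :=
  .mk (pathIn γ h _ _)

/-- `Y` is a holomorphic solution of the Fuchsian system `dY/dx = (∑ⱼ Aⱼ / (x - tⱼ)) Y` on the
universal covering surface of the punctured sphere: around every point of the surface, `Y` read in
the base point `x` is a holomorphic function `F` of `x` that satisfies the equation. (The points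
reached from `(x, α)` by the paths in a small neighbourhood `U` of `x` are the points of the sheet
of the surface through `(x, α)` over `U`.) -/
def SolvesFuchsian {n k : ℕ} (t : Fin n → ℂ) (A : Fin n → Matrix (Fin k) (Fin k) ℂ)
    (Y : PuncturedCov t → Matrix (Fin k) (Fin k) ℂ) : Prop :=
  ∀ p : PuncturedCov t, ∃ (U : Set (OnePoint ℂ)) (F : OnePoint ℂ → Matrix (Fin k) (Fin k) ℂ),
    IsOpen U ∧ (p.1 : OnePoint ℂ) ∈ U ∧ U ⊆ puncturedSphere t ∧
    HolomorphicOnSphere F U ∧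
    (∀ z : ℂ, (z : OnePoint ℂ) ∈ U →
      HasDerivAt (fun x : ℂ => F x) ((∑ j, (z - t j)⁻¹ • A j) * F z) z) ∧
    ∀ (y : puncturedSphere t) (β : Path p.1 y), (∀ s, (β s : OnePoint ℂ) ∈ U) →
      Y ⟨y, p.2.trans (.mk β)⟩ = F y

/-- `Y` is a solution of the Fuchsian system with `Y = I` at the distinguished point `∞` of the
universal covering surface. -/
def IsNormalizedSolution {n k : ℕ} (t : Fin n → ℂ) (A : Fin n → Matrix (Fin k) (Fin k) ℂ)
    (Y : PuncturedCov t → Matrix (Fin k) (Fin k) ℂ) : Prop :=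
  SolvesFuchsian t A Y ∧ Y ⟨_, .refl _⟩ = 1

/-- The solution of the Fuchsian system normalized by `Y = I` at `∞`. (It exists and is unique if
the `tⱼ` are distinct and `∑ⱼ Aⱼ = 0`.) -/
noncomputable def normalizedSolution {n k : ℕ} (t : Fin n → ℂ)
    (A : Fin n → Matrix (Fin k) (Fin k) ℂ) : PuncturedCov t → Matrix (Fin k) (Fin k) ℂ :=
  Classical.epsilon (IsNormalizedSolution t A)

/-- `M` is the monodromy matrix of the function `Y` for the loop `γ`:
`Y(x, αγ) = Y(x, α) M` for all points `(x, α)` of the universal covering surface. -/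
def IsMonodromyMatrix {n k : ℕ} {t : Fin n → ℂ} (Y : PuncturedCov t → Matrix (Fin k) (Fin k) ℂ)
    (γ : Path.Homotopic.Quotient (⟨∞, infty_mem_puncturedSphere t⟩ : puncturedSphere t)
      ⟨∞, infty_mem_puncturedSphere t⟩)
    (M : Matrix (Fin k) (Fin k) ℂ) : Prop :=
  ∀ p : PuncturedCov t, Y (p.deck γ) = Y p * M

/-- The cylindrical set with the bases `Wⱼ` is an open cylindrical neighbourhood of `t`. -/
structure IsCylindricalNhd {n : ℕ} (W : Fin n → Set ℂ) (t : Fin n → ℂ) : Prop where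
  mem : ∀ j, t j ∈ W j
  isOpen : ∀ j, IsOpen (W j)
  isSimplyConnected : ∀ j, IsSimplyConnected (W j)
  isConnected_compl : ∀ j, IsConnected (closure (W j))ᶜ

/-- The perforated Riemann sphere, without the closures of the sets `Wⱼ`. -/
def perforatedSphere {n : ℕ} (W : Fin n → Set ℂ) : Set (OnePoint ℂ) :=
  {x | ∀ j, x ∉ ((↑) : ℂ → OnePoint ℂ) '' closure (W j)}

lemma perforatedSphere_subset {n : ℕ} {W : Fin n → Set ℂ} {t : Fin n → ℂ}
    (ht : t ∈ Set.univ.pi W) : perforatedSphere W ⊆ puncturedSphere t :=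
  fun _ hx j h => hx j ⟨t j, subset_closure (ht j trivial), h.symm⟩

/-- The family `dY/dx = (∑ⱼ Qⱼ(t) / (x - tⱼ)) Y`, `t ∈ D`, is isomonodromic with the distinguished
point `∞`: every `t⁰ ∈ D` has an open cylindrical neighbourhood `𝓦`, compactly included in `D`,
such that for every loop `γ` at `∞` in the perforated sphere and all `t', t'' ∈ 𝓦` the solutions
normalized at `∞` have the same monodromy matrix for `γ`. -/
def IsIsomonodromic {n k : ℕ} (D : Set (Fin n → ℂ))
    (Q : Fin n → (Fin n → ℂ) → Matrix (Fin k) (Fin k) ℂ) : Prop :=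
  ∀ t₀ ∈ D, ∃ W : Fin n → Set ℂ, IsCylindricalNhd W t₀ ∧
    IsCompact (closure (Set.univ.pi W)) ∧ closure (Set.univ.pi W) ⊆ D ∧
    ∀ (γ : Path (∞ : OnePoint ℂ) ∞) (hγ : ∀ s, γ s ∈ perforatedSphere W)
      (t' t'' : Fin n → ℂ) (ht' : t' ∈ Set.univ.pi W) (ht'' : t'' ∈ Set.univ.pi W),
      ∃ M : Matrix (Fin k) (Fin k) ℂ,
        IsMonodromyMatrix (normalizedSolution t' (fun j => Q j t'))
          (loopClass t' γ fun s => perforatedSphere_subset ht' (hγ s)) M ∧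
        IsMonodromyMatrix (normalizedSolution t'' (fun j => Q j t''))
          (loopClass t'' γ fun s => perforatedSphere_subset ht'' (hγ s)) M

open Classical in
/-- The value `Y(x, α, t)` of the normalized solution for the parameter `t` after continuation along
a path `α` in the Riemann sphere from `∞` to `x`; it is meaningful when `α` avoids `t₁, …, tₙ`. A
path that avoids the coordinates of `t⁰` also avoids those of every `t` close to `t⁰`, so that the
derivatives of this function of `t` at `t⁰` involve meaningful values only. -/
noncomputable def valueAlong {n k : ℕ} (Q : Fin n → (Fin n → ℂ) → Matrix (Fin k) (Fin k) ℂ)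
    {x : OnePoint ℂ} (α : Path ∞ x) (t : Fin n → ℂ) : Matrix (Fin k) (Fin k) ℂ :=
  if h : ∀ s, α s ∈ puncturedSphere t then
    normalizedSolution t (fun j => Q j t) (pointOver t α h)
  else 0

/-- The normalized solution `Y(x, t)`, `t ∈ D`, satisfies a linear system
`∂Y/∂x = (∑ⱼ Qⱼ(t) / (x - tⱼ)) Y`, `∂Y/∂tⱼ = Tⱼ(x, t) Y`, in which the `Tⱼ(·, t)` are (single-valued)
holomorphic functions on the punctured sphere. -/
def SatisfiesAuxiliarySystem {n k : ℕ} (D : Set (Fin n → ℂ))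
    (Q : Fin n → (Fin n → ℂ) → Matrix (Fin k) (Fin k) ℂ) : Prop :=
  ∃ T : Fin n → OnePoint ℂ → (Fin n → ℂ) → Matrix (Fin k) (Fin k) ℂ,
    (∀ t ∈ D, ∀ j, HolomorphicOnSphere (fun x => T j x t) (puncturedSphere t)) ∧
    (∀ t ∈ D, SolvesFuchsian t (fun j => Q j t) (normalizedSolution t fun j => Q j t)) ∧
    ∀ t ∈ D, ∀ (x : OnePoint ℂ) (α : Path ∞ x), (∀ s, α s ∈ puncturedSphere t) → ∀ j,
      HasDerivAt (fun τ : ℂ => valueAlong Q α (Function.update t j τ))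
        (T j x t * valueAlong Q α t) (t j)

end Fuchsian

/-! The candidate is `T_j = (∂Y/∂t_j) Y⁻¹`. Continuation along a loop at `∞` multiplies `Y` on the
right by a monodromy matrix, which cancels in `T_j` if it is locally constant in `t`. Then `T_j` is
single-valued, and it is holomorphic since `Y` is locally a fundamental solution, holomorphic in `x`
and in the parameter, times a factor free of `x`. Conversely, `Y = I` at `∞` forces `T_j = 0` at
`∞`, so continuation along a loop has zero partial derivatives in `t` and the monodromy is constant
on a polydisc.

The difficulty lies in the direct implication. Isomonodromy concerns only loops that avoid the
closures `K_j` of the sets `W_j`, whereas `T_j` involves all loops that avoid the points `t_j`. The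
`K_j` are disjoint compact sets that do not separate the plane, with no regularity of the boundary.
`PathRel.exists_total` provides points `s_j ∈ K_j` close to `t_j` such that a relation between paths
that is compatible with continuation and relates all paths avoiding the `K_j` relates all paths
avoiding the `s_j`. It is applied to the relation "the continuations agree for parameters near `s`,
up to a constant right factor" (`continuationRel`). So the monodromy of every loop is constant near
`s`, and the identity theorem on complex lines through `s` extends this to a ball around `t`
(`IsIsomonodromic.exists_eventually_continuation_eq`).

For `PathRel.exists_total` the `s_j` are vertices of a fine square grid. The complement of the union
of the `K_j` is connected (`isPreconnected_compl_union`), so all faces away from the `K_j` are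
linked by faces that miss them. Every face receives a class of paths to its centre. The edges across
which these classes disagree form finite graphs, one near each `K_j`. A vertex other than `s_j` is
never the end of exactly one bad edge, while the faces remain connected across good edges. A
nonempty graph of this kind contains a cycle modulo 2, and a cycle separates the faces; hence there
are no bad edges (`gridEdge_eq_empty`).

The analytic input is `exists_fundamental_ratCoeff`, where dependence on parameters comes from
inversion in a Banach algebra. Invariance of continuation under homotopy comes from the monodromy of
a covering with discrete fibres (`FlatData`). -/

namespace Fuchsian

open unitInterval Filter Topology Metric

/-! ### Volterra equations in a Banach algebra -/

section Volterra

variable {E : Type*} [NormedRing E] [NormedAlgebra ℂ E] {J : E →L[ℂ] E} {b : E}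

/-- The operators `z ↦ J (b z)` on a Banach algebra. -/
noncomputable def volterraOp (J : E →L[ℂ] E) : E →L[ℂ] (E →L[ℂ] E) :=
  (ContinuousLinearMap.compL ℂ _ _ _ J).comp (ContinuousLinearMap.mul ℂ E)

lemma volterraOp_apply (b z : E) : volterraOp J b z = J (b * z) := rfl

lemma norm_volterraOp_lt_one (hJ : ‖J‖ ≤ 1) (hb : ‖b‖ < 1) : ‖volterraOp J b‖ < 1 := by
  refine lt_of_le_of_lt ?_ hb
  refine (ContinuousLinearMap.opNorm_comp_le _ _).trans ?_
  refine (mul_le_of_le_one_left (norm_nonneg _) hJ).trans ?_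
  exact ContinuousLinearMap.opNorm_mul_apply_le _ _ _

/-- The solution of `z = 1 + J (b z)`. -/
noncomputable def volterraSol (J : E →L[ℂ] E) (b : E) : E :=
  Ring.inverse (1 - volterraOp J b) 1

variable [CompleteSpace E]

lemma isUnit_one_sub_volterraOp (hJ : ‖J‖ ≤ 1) (hb : ‖b‖ < 1) : IsUnit (1 - volterraOp J b) :=
  isUnit_one_sub_of_norm_lt_one (norm_volterraOp_lt_one hJ hb)

lemma volterraSol_eq (hJ : ‖J‖ ≤ 1) (hb : ‖b‖ < 1) :
    volterraSol J b = 1 + J (b * volterraSol J b) := by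
  have h := Ring.mul_inverse_cancel _ (isUnit_one_sub_volterraOp hJ hb)
  have h2 := congrArg (fun T : E →L[ℂ] E => T 1) h
  simp only [mul_apply_eq_comp, sub_apply, one_apply_eq_self] at h2
  exact sub_eq_iff_eq_add.1 h2

lemma eq_volterraSol (hJ : ‖J‖ ≤ 1) (hb : ‖b‖ < 1) {z : E} (hz : z = 1 + J (b * z)) :
    z = volterraSol J b := by
  have h := Ring.inverse_mul_cancel _ (isUnit_one_sub_volterraOp hJ hb)
  have h2 := congrArg (fun T : E →L[ℂ] E => T z) h
  have h3 : (1 - volterraOp J b) z = 1 := by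
    rw [sub_apply, volterraOp_apply]
    exact sub_eq_iff_eq_add.2 hz
  simp only [mul_apply_eq_comp, one_apply_eq_self, h3] at h2
  exact h2.symm

/-- Inversion is analytic at the units of a Banach algebra and `b` enters the operator linearly.
This is the source of all analytic dependence on parameters below. -/
lemma analyticAt_volterraSol (hJ : ‖J‖ ≤ 1) (hb : ‖b‖ < 1) :
    AnalyticAt ℂ (volterraSol J) b := by
  have h1 : AnalyticAt ℂ (fun b : E => (1 : E →L[ℂ] E) - volterraOp J b) b :=
    analyticAt_const.sub ((volterraOp J).analyticAt b)
  have h2 : AnalyticAt ℂ Ring.inverse ((1 : E →L[ℂ] E) - volterraOp J b) := by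
    obtain ⟨u, hu⟩ := isUnit_one_sub_volterraOp hJ hb
    rw [← hu]
    exact analyticAt_inverse u
  exact ((ContinuousLinearMap.apply ℂ E (1 : E)).analyticAt _).comp
    (AnalyticAt.comp (g := Ring.inverse) h2 h1)

lemma volterraSol_zero (hJ : ‖J‖ ≤ 1) : volterraSol J 0 = 1 := by
  have := volterraSol_eq (b := 0) hJ (by simp)
  simpa using this

end Volterra

/-! ### Linear differential equations on the unit interval -/

section LinearODE

variable {𝔸 : Type*} [NormedRing 𝔸]

variable (𝔸) in
/-- The Banach algebra of continuous functions on the unit interval. -/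
def PathAlgebra : Type _ := C(I, 𝔸)

noncomputable instance : NormedRing (PathAlgebra 𝔸) := inferInstanceAs (NormedRing C(I, 𝔸))

instance [CompleteSpace 𝔸] : CompleteSpace (PathAlgebra 𝔸) := inferInstanceAs (CompleteSpace C(I, 𝔸))

instance : FunLike (PathAlgebra 𝔸) I 𝔸 := inferInstanceAs (FunLike C(I, 𝔸) I 𝔸)

namespace PathAlgebra

lemma ext {f g : PathAlgebra 𝔸} (h : ∀ s, f s = g s) : f = g := ContinuousMap.ext h

protected lemma continuous (f : PathAlgebra 𝔸) : Continuous f := ContinuousMap.continuous f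

lemma norm_apply_le (f : PathAlgebra 𝔸) (s : I) : ‖f s‖ ≤ ‖f‖ :=
  ContinuousMap.norm_coe_le_norm (f : C(I, 𝔸)) s

lemma norm_le (f : PathAlgebra 𝔸) {C : ℝ} (hC : 0 ≤ C) (h : ∀ s, ‖f s‖ ≤ C) : ‖f‖ ≤ C :=
  (ContinuousMap.norm_le (f : C(I, 𝔸)) hC).2 h

lemma add_apply (f g : PathAlgebra 𝔸) (s : I) : (f + g) s = f s + g s := rfl

lemma mul_apply (f g : PathAlgebra 𝔸) (s : I) : (f * g) s = f s * g s := rfl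

lemma one_apply (s : I) : (1 : PathAlgebra 𝔸) s = 1 := rfl

/-- The function `u ↦ f (s u)`. -/
def scale (s : I) (f : PathAlgebra 𝔸) : PathAlgebra 𝔸 :=
  (⟨fun u => f (s * u), f.continuous.comp (by fun_prop)⟩ : C(I, 𝔸))

lemma scale_apply (s : I) (f : PathAlgebra 𝔸) (u : I) : scale s f u = f (s * u) := rfl

variable [NormedAlgebra ℂ 𝔸]

noncomputable instance instNormedAlgebra : NormedAlgebra ℂ (PathAlgebra 𝔸) :=
  inferInstanceAs (NormedAlgebra ℂ C(I, 𝔸))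

lemma smul_apply (c : ℂ) (f : PathAlgebra 𝔸) (s : I) : (c • f) s = c • f s := rfl

/-- Evaluation of a continuous function at a point. -/
noncomputable def eval (s : I) : PathAlgebra 𝔸 →L[ℂ] 𝔸 :=
  LinearMap.mkContinuous
    { toFun := fun f => f s
      map_add' := fun _ _ => rfl
      map_smul' := fun _ _ => rfl } 1 fun f => by
    rw [one_mul]
    exact norm_apply_le f s

lemma eval_apply (f : PathAlgebra 𝔸) (s : I) : eval s f = f s := rfl

/-- The function `s ↦ f s • a` in terms of the scalar function `f` and the vector `a`. -/
noncomputable def smulRight : PathAlgebra ℂ →L[ℂ] 𝔸 →L[ℂ] PathAlgebra 𝔸 :=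
  LinearMap.mkContinuous₂
    (LinearMap.mk₂ ℂ (fun (f : PathAlgebra ℂ) (a : 𝔸) =>
        ((⟨fun s => f s • a, f.continuous.smul continuous_const⟩ : C(I, 𝔸)) : PathAlgebra 𝔸))
      (fun f g a => PathAlgebra.ext fun s => add_smul (f s) (g s) a)
      (fun c f a => PathAlgebra.ext fun s => smul_assoc c (f s) a)
      (fun f a a' => PathAlgebra.ext fun s => smul_add (f s) a a')
      (fun c f a => PathAlgebra.ext fun s => smul_comm (f s) c a)) 1 fun f a => by
    rw [one_mul]
    refine norm_le _ (by positivity) fun s => (norm_smul_le (f s) a).trans ?_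
    gcongr
    exact norm_apply_le f s

lemma smulRight_apply (f : PathAlgebra ℂ) (a : 𝔸) (s : I) : smulRight f a s = f s • a := rfl

/-- The inclusion of the unit interval in the complex numbers. -/
noncomputable def coord : PathAlgebra ℂ :=
  (⟨fun s => ((s : ℝ) : ℂ), by fun_prop⟩ : C(I, ℂ))

lemma coord_apply (s : I) : coord s = ((s : ℝ) : ℂ) := rfl

lemma isUnit_of_forall_ne_zero {f : PathAlgebra ℂ} (hf : ∀ s, f s ≠ 0) : IsUnit f :=
  ContinuousMap.isUnit_iff_forall_ne_zero (f : C(I, ℂ)) |>.2 hf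

lemma inverse_apply {f : PathAlgebra ℂ} (hf : ∀ s, f s ≠ 0) (s : I) :
    Ring.inverse f s = (f s)⁻¹ := by
  have h := congrArg (fun g : PathAlgebra ℂ => g s)
    (Ring.mul_inverse_cancel f (isUnit_of_forall_ne_zero hf))
  simp only [mul_apply, one_apply] at h
  exact eq_inv_of_mul_eq_one_right h

end PathAlgebra

variable [NormedAlgebra ℂ 𝔸]

/-- Integration from `0`. -/
noncomputable def integrate : PathAlgebra 𝔸 →L[ℂ] PathAlgebra 𝔸 :=
  LinearMap.mkContinuous
    { toFun := fun f =>
        (⟨fun s => ∫ u in (0 : ℝ)..s, f (Set.projIcc 0 1 zero_le_one u),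
          (intervalIntegral.continuous_primitive (fun a b =>
            (f.continuous.comp continuous_projIcc).intervalIntegrable a b) 0).comp
            continuous_subtype_val⟩ : C(I, 𝔸))
      map_add' := fun f g => PathAlgebra.ext fun s => intervalIntegral.integral_add
          ((f.continuous.comp continuous_projIcc).intervalIntegrable _ _)
          ((g.continuous.comp continuous_projIcc).intervalIntegrable _ _)
      map_smul' := fun c f => PathAlgebra.ext fun s => intervalIntegral.integral_smul c _ } 1
    (fun f => by
    rw [one_mul]
    refine PathAlgebra.norm_le _ (norm_nonneg _) fun s => ?_
    refine (intervalIntegral.norm_integral_le_of_norm_le_const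
      (C := ‖f‖) fun u _ => f.norm_apply_le _).trans ?_
    rw [sub_zero, abs_of_nonneg s.2.1]
    exact mul_le_of_le_one_right (norm_nonneg _) s.2.2)

lemma integrate_apply (f : PathAlgebra 𝔸) (s : I) :
    integrate f s = ∫ u in (0 : ℝ)..s, f (Set.projIcc 0 1 zero_le_one u) := rfl

lemma norm_integrate_le : ‖(integrate : PathAlgebra 𝔸 →L[ℂ] PathAlgebra 𝔸)‖ ≤ 1 :=
  LinearMap.mkContinuous_norm_le _ zero_le_one _

lemma scale_integrate (f : PathAlgebra 𝔸) (s : I) :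
    (integrate f).scale s = integrate (((s : ℝ) : ℂ) • f.scale s) := by
  refine PathAlgebra.ext fun v => ?_
  rw [PathAlgebra.scale_apply, integrate_apply, integrate_apply]
  have h1 : ∀ u ∈ Set.uIcc (0 : ℝ) v,
      (((s : ℝ) : ℂ) • f.scale s) (Set.projIcc 0 1 zero_le_one u) =
      (s : ℝ) • f (Set.projIcc 0 1 zero_le_one ((s : ℝ) * u)) := by
    intro u hu
    rw [Set.uIcc_of_le v.2.1] at hu
    have hu' : u ∈ Set.Icc (0 : ℝ) 1 := ⟨hu.1, hu.2.trans v.2.2⟩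
    have hsu : (s : ℝ) * u ∈ Set.Icc (0 : ℝ) 1 :=
      ⟨mul_nonneg s.2.1 hu.1, mul_le_one₀ s.2.2 hu.1 hu'.2⟩
    rw [PathAlgebra.smul_apply, PathAlgebra.scale_apply, Set.projIcc_of_mem _ hu',
      Set.projIcc_of_mem _ hsu]
    exact Complex.coe_smul _ _
  rw [intervalIntegral.integral_congr h1, intervalIntegral.integral_smul,
    intervalIntegral.smul_integral_comp_mul_left
      (fun w => f (Set.projIcc 0 1 zero_le_one w)), mul_zero]
  rfl

variable [CompleteSpace 𝔸]

/-- The solution of `z' = b z`, `z(0) = 1`, on the unit interval. -/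
noncomputable def odeSol (b : PathAlgebra 𝔸) : PathAlgebra 𝔸 := volterraSol integrate b

lemma odeSol_eq {b : PathAlgebra 𝔸} (hb : ‖b‖ < 1) : odeSol b = 1 + integrate (b * odeSol b) :=
  volterraSol_eq (J := integrate) norm_integrate_le hb

lemma eq_odeSol {b z : PathAlgebra 𝔸} (hb : ‖b‖ < 1) (hz : z = 1 + integrate (b * z)) :
    z = odeSol b :=
  eq_volterraSol (J := integrate) norm_integrate_le hb hz

lemma analyticAt_odeSol {b : PathAlgebra 𝔸} (hb : ‖b‖ < 1) :
    AnalyticAt ℂ (odeSol : PathAlgebra 𝔸 → PathAlgebra 𝔸) b :=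
  analyticAt_volterraSol (J := integrate) norm_integrate_le hb

lemma odeSol_zero : odeSol (0 : PathAlgebra 𝔸) = 1 :=
  volterraSol_zero (J := integrate) norm_integrate_le

/-- The solution restricted to `[0, s]` and rescaled to `[0, 1]` solves the rescaled equation, so
uniqueness applies. Thus solutions along a segment and along its initial pieces fit together. -/
lemma odeSol_scale {b : PathAlgebra 𝔸} (hb : ‖b‖ < 1) (s : I)
    (hbs : ‖((s : ℝ) : ℂ) • b.scale s‖ < 1) :
    odeSol (((s : ℝ) : ℂ) • b.scale s) 1 = odeSol b s := by
  have h : (odeSol b).scale s = odeSol (((s : ℝ) : ℂ) • b.scale s) := by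
    refine eq_odeSol hbs ?_
    have h1 := congrArg (fun g : PathAlgebra 𝔸 => g.scale s) (odeSol_eq hb)
    have h2 : ((1 : PathAlgebra 𝔸) + integrate (b * odeSol b)).scale s =
      1 + (integrate (b * odeSol b)).scale s := rfl
    refine h1.trans (h2.trans ?_)
    rw [scale_integrate]
    congr 2
    refine PathAlgebra.ext fun v => ?_
    simp only [PathAlgebra.smul_apply, PathAlgebra.mul_apply, PathAlgebra.scale_apply,
      smul_mul_assoc]
  rw [← h, PathAlgebra.scale_apply, mul_one]

/-- The extension by `Set.projIcc` is constant beyond `1`, so only the left derivative at `1`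
follows the equation. -/
lemma hasDerivWithinAt_odeSol {b : PathAlgebra 𝔸} (hb : ‖b‖ < 1) :
    HasDerivWithinAt (fun u : ℝ => odeSol b (Set.projIcc 0 1 zero_le_one u))
      (b 1 * odeSol b 1) (Set.Iic 1) 1 := by
  set g : ℝ → 𝔸 := fun u => (b * odeSol b) (Set.projIcc 0 1 zero_le_one u) with hg
  have hgc : Continuous g := (b * odeSol b).continuous.comp continuous_projIcc
  have h1 : HasDerivAt (fun u : ℝ => 1 + ∫ v in (0 : ℝ)..u, g v) (g 1) 1 :=
    (intervalIntegral.integral_hasDerivAt_right (hgc.intervalIntegrable _ _)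
      (hgc.stronglyMeasurableAtFilter _ _) hgc.continuousAt).const_add 1
  have hg1 : g 1 = b 1 * odeSol b 1 := by
    rw [hg, ← PathAlgebra.mul_apply]; simp
  rw [← hg1]
  have key : ∀ u ∈ Set.Icc (0 : ℝ) 1,
      odeSol b (Set.projIcc 0 1 zero_le_one u) = 1 + ∫ v in (0 : ℝ)..u, g v := by
    intro u hu
    have := congrArg (fun f : PathAlgebra 𝔸 => f (Set.projIcc 0 1 zero_le_one u)) (odeSol_eq hb)
    simp only [PathAlgebra.add_apply, integrate_apply] at this
    rw [this, Set.projIcc_of_mem _ hu]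
    rfl
  refine h1.hasDerivWithinAt.congr_of_eventuallyEq ?_ (key 1 (by simp))
  have : Set.Icc (0 : ℝ) 1 ∈ 𝓝[Set.Iic 1] (1 : ℝ) := by
    rw [← Set.Ici_inter_Iic]
    exact Filter.inter_mem (mem_nhdsWithin_of_mem_nhds (Ici_mem_nhds one_pos)) self_mem_nhdsWithin
  filter_upwards [this] with u hu using key u hu

end LinearODE

/-! ### Local fundamental solutions, analytic in a parameter -/

section RationalCoefficient

variable {𝔸 : Type*} [NormedRing 𝔸] [NormedAlgebra ℂ 𝔸]

/-- The rational coefficient `∑ⱼ Rⱼ / (αⱼ + βⱼ z)` of a linear differential equation. -/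
noncomputable def ratCoeff {n : ℕ} (α β : Fin n → ℂ) (R : Fin n → 𝔸) (z : ℂ) : 𝔸 :=
  ∑ j, (α j + β j * z)⁻¹ • R j

/-- The linear function `α + β z` along the segment from `c` to `x`. -/
noncomputable def denomPath (α β c x : ℂ) : PathAlgebra ℂ :=
  (α + β * c) • (1 : PathAlgebra ℂ) + (β * (x - c)) • PathAlgebra.coord

lemma denomPath_apply (α β c x : ℂ) (s : I) :
    denomPath α β c x s = α + β * (c + (s : ℝ) * (x - c)) := by
  simp only [denomPath, PathAlgebra.add_apply, PathAlgebra.smul_apply, PathAlgebra.one_apply,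
    PathAlgebra.coord_apply, smul_eq_mul]
  ring

/-- The coefficient of the equation with the coefficient `ratCoeff`, pulled back to the unit
interval along the segment from `c` to `x`. -/
noncomputable def coeffPath {n : ℕ} (α β : Fin n → ℂ) (R : Fin n → 𝔸) (c x : ℂ) :
    PathAlgebra 𝔸 :=
  (x - c) • ∑ j, PathAlgebra.smulRight (Ring.inverse (denomPath (α j) (β j) c x)) (R j)

lemma coeffPath_apply {n : ℕ} {α β : Fin n → ℂ} (R : Fin n → 𝔸) {c x : ℂ}
    (h : ∀ j, ∀ s : I, α j + β j * (c + (s : ℝ) * (x - c)) ≠ 0) (s : I) :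
    coeffPath α β R c x s = (x - c) • ratCoeff α β R (c + (s : ℝ) * (x - c)) := by
  have key : ∀ f : PathAlgebra 𝔸, f s = PathAlgebra.eval s f := fun _ => rfl
  rw [coeffPath, PathAlgebra.smul_apply, ratCoeff, key, map_sum]
  congr 1
  refine Finset.sum_congr rfl fun j _ => ?_
  rw [PathAlgebra.eval_apply, PathAlgebra.smulRight_apply,
    PathAlgebra.inverse_apply (fun u => by rw [denomPath_apply]; exact h j u), denomPath_apply]

lemma coeffPath_scale {n : ℕ} {α β : Fin n → ℂ} (R : Fin n → 𝔸) {c x : ℂ}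
    (h : ∀ j, ∀ s : I, α j + β j * (c + (s : ℝ) * (x - c)) ≠ 0) (s : I) :
    ((s : ℝ) : ℂ) • (coeffPath α β R c x).scale s =
      coeffPath α β R c (c + (s : ℝ) * (x - c)) := by
  have e : ∀ u : I, c + ((u : ℝ) : ℂ) * (c + (s : ℝ) * (x - c) - c) =
      c + (((s * u : I) : ℝ) : ℂ) * (x - c) := by
    intro u
    push_cast
    ring
  refine PathAlgebra.ext fun u => ?_
  rw [PathAlgebra.smul_apply, PathAlgebra.scale_apply, coeffPath_apply R h,
    coeffPath_apply R (fun j u => by rw [e]; exact h j _), e, add_sub_cancel_left, smul_smul]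

/-- As an element of the algebra of functions on the segment, each denominator is analytic in the
data, and at `x = c` it is a nonzero constant, hence a unit. Inversion is analytic there. -/
lemma analyticAt_coeffPath {n : ℕ} {α β : ℂ → Fin n → ℂ} {R : ℂ → Fin n → 𝔸} {c l : ℂ}
    (hα : ∀ j, AnalyticAt ℂ (fun μ => α μ j) l) (hβ : ∀ j, AnalyticAt ℂ (fun μ => β μ j) l)
    (hR : ∀ j, AnalyticAt ℂ (fun μ => R μ j) l) (h0 : ∀ j, α l j + β l j * c ≠ 0) :
    AnalyticAt ℂ (fun p : ℂ × ℂ => coeffPath (α p.2) (β p.2) (R p.2) c p.1) (c, l) := by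
  have lift : ∀ {f : ℂ → ℂ},
      AnalyticAt ℂ f l → AnalyticAt ℂ (fun p : ℂ × ℂ => f p.2) (c, l) := fun hf =>
    AnalyticAt.fun_comp (g := _) (f := fun p : ℂ × ℂ => p.2) hf analyticAt_snd
  have hx : AnalyticAt ℂ (fun p : ℂ × ℂ => p.1 - c) (c, l) := analyticAt_fst.sub analyticAt_const
  refine hx.smul (Finset.analyticAt_fun_sum _ fun j _ => ?_)
  have hd : AnalyticAt ℂ (fun p : ℂ × ℂ => denomPath (α p.2 j) (β p.2 j) c p.1) (c, l) :=
    (((lift (hα j)).add ((lift (hβ j)).mul analyticAt_const)).smul analyticAt_const).add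
      (((lift (hβ j)).mul hx).smul analyticAt_const)
  have hu : IsUnit (denomPath (α l j) (β l j) c c) :=
    PathAlgebra.isUnit_of_forall_ne_zero fun s => by
      rw [denomPath_apply, sub_self, mul_zero, add_zero]
      exact h0 j
  have hi : AnalyticAt ℂ Ring.inverse (denomPath (α l j) (β l j) c c) := by
    obtain ⟨u, hu⟩ := hu
    rw [← hu]
    exact analyticAt_inverse u
  have hd' := AnalyticAt.fun_comp (g := Ring.inverse)
    (f := fun p : ℂ × ℂ => denomPath (α p.2 j) (β p.2 j) c p.1) hi hd
  exact AnalyticAt.fun_comp (g := fun q : PathAlgebra ℂ × 𝔸 => PathAlgebra.smulRight q.1 q.2)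
    (f := fun p : ℂ × ℂ => (Ring.inverse (denomPath (α p.2 j) (β p.2 j) c p.1), R p.2 j))
    (ContinuousLinearMap.analyticAt_bilinear _ _) (hd'.prod (AnalyticAt.fun_comp (g := fun μ => R μ j)
      (f := fun p : ℂ × ℂ => p.2) (hR j) analyticAt_snd))

variable [CompleteSpace 𝔸]

/-- Near a point at which its coefficient is holomorphic, a linear differential equation depending
holomorphically on a parameter has a fundamental solution depending holomorphically on the
parameter. -/
theorem exists_fundamental_ratCoeff {n : ℕ} {α β : ℂ → Fin n → ℂ} {R : ℂ → Fin n → 𝔸} {c l : ℂ}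
    (hα : ∀ j, AnalyticAt ℂ (fun μ => α μ j) l) (hβ : ∀ j, AnalyticAt ℂ (fun μ => β μ j) l)
    (hR : ∀ j, AnalyticAt ℂ (fun μ => R μ j) l) (h0 : ∀ j, α l j + β l j * c ≠ 0) :
    ∃ r > 0, ∃ Φ : ℂ → ℂ → 𝔸, ∀ x ∈ ball c r, ∀ μ ∈ ball l r,
      (∀ j, α μ j + β μ j * x ≠ 0) ∧ AnalyticAt ℂ (fun p : ℂ × ℂ => Φ p.1 p.2) (x, μ) ∧
      IsUnit (Φ x μ) ∧
      HasDerivAt (fun y => Φ y μ) (ratCoeff (α μ) (β μ) (R μ) x * Φ x μ) x := by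
  -- The equation is pulled back to `[0, 1]` along the segment from `c` to `x`. The pulled back
  -- coefficient vanishes at `x = c`, so its norm is below `1` nearby; `Φ` is the value of the
  -- solution at the end of the segment.
  set b : ℂ × ℂ → PathAlgebra 𝔸 := fun p => coeffPath (α p.2) (β p.2) (R p.2) c p.1 with hb
  have hba : AnalyticAt ℂ b (c, l) := analyticAt_coeffPath hα hβ hR h0
  have hb0 : b (c, l) = 0 := by simp [hb, coeffPath]
  have hb1 : ∀ᶠ p in 𝓝 (c, l), ‖b p‖ < 1 :=
    hba.continuousAt.norm.eventually_lt continuousAt_const (by simp [hb0])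
  have hba' : ∀ᶠ p in 𝓝 (c, l), AnalyticAt ℂ b p := hba.eventually_analyticAt
  have hden : ∀ᶠ p : ℂ × ℂ in 𝓝 (c, l), ∀ j, α p.2 j + β p.2 j * p.1 ≠ 0 := by
    refine eventually_all.2 fun j => ContinuousAt.eventually_ne ?_ (h0 j)
    exact (ContinuousAt.comp' (x := (c, l)) (f := Prod.snd) (hα j).continuousAt
      continuousAt_snd).add ((ContinuousAt.comp' (x := (c, l)) (f := Prod.snd)
        (hβ j).continuousAt continuousAt_snd).mul continuousAt_fst)
  set Φ : ℂ → ℂ → 𝔸 := fun x μ => odeSol (b (x, μ)) 1 with hΦ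
  have hΦa : ∀ p, ‖b p‖ < 1 → AnalyticAt ℂ b p → AnalyticAt ℂ (fun p : ℂ × ℂ => Φ p.1 p.2) p :=
    fun p h1 h2 => AnalyticAt.fun_comp (g := PathAlgebra.eval (1 : I))
      (f := fun p : ℂ × ℂ => odeSol (b (p.1, p.2))) (ContinuousLinearMap.analyticAt _ _)
      (AnalyticAt.fun_comp (analyticAt_odeSol h1) h2)
  have hunit : ∀ᶠ p : ℂ × ℂ in 𝓝 (c, l), IsUnit (Φ p.1 p.2) := by
    refine (hΦa _ hb1.self_of_nhds hba).continuousAt.eventually_mem (Units.isOpen.mem_nhds ?_)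
    simp [hΦ, hb0, odeSol_zero, PathAlgebra.one_apply]
  obtain ⟨r, hr, hball⟩ := Metric.eventually_nhds_iff_ball.1 (hb1.and (hba'.and (hden.and hunit)))
  rw [← ball_prod_same] at hball
  refine ⟨r, hr, Φ, fun x hx μ hμ => ?_⟩
  obtain ⟨-, -, hd, hu⟩ := hball (x, μ) ⟨hx, hμ⟩
  have hA : ∀ y ∈ ball c r, AnalyticAt ℂ (fun p : ℂ × ℂ => Φ p.1 p.2) (y, μ) := fun y hy =>
    hΦa _ (hball (y, μ) ⟨hy, hμ⟩).1 (hball (y, μ) ⟨hy, hμ⟩).2.1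
  have hA1 : ∀ y ∈ ball c r, AnalyticAt ℂ (fun y => Φ y μ) y := fun y hy =>
    AnalyticAt.fun_comp (g := fun p : ℂ × ℂ => Φ p.1 p.2) (f := fun y => (y, μ)) (hA y hy)
      (analyticAt_id.prod analyticAt_const)
  refine ⟨hd, hA x hx, hu, ?_⟩
  have hseg : ∀ y ∈ ball c r, ∀ s : I, c + ((s : ℝ) : ℂ) * (y - c) ∈ ball c r := by
    intro y hy s
    rw [mem_ball, dist_eq_norm] at hy ⊢
    rw [add_sub_cancel_left, norm_mul, Complex.norm_real, Real.norm_of_nonneg s.2.1]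
    exact (mul_le_of_le_one_left (norm_nonneg _) s.2.2).trans_lt hy
  have hden' : ∀ y ∈ ball c r, ∀ j, ∀ s : I,
      α μ j + β μ j * (c + ((s : ℝ) : ℂ) * (y - c)) ≠ 0 := fun y hy j s =>
    (hball (_, μ) ⟨hseg y hy s, hμ⟩).2.2.1 j
  have hray : ∀ y ∈ ball c r, ∀ s : I,
      Φ (c + ((s : ℝ) : ℂ) * (y - c)) μ = odeSol (b (y, μ)) s := by
    intro y hy s
    have e := coeffPath_scale (R μ) (hden' y hy) s
    rw [← odeSol_scale (hball (y, μ) ⟨hy, hμ⟩).1 s]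
    · simp only [hΦ, hb, e]
    · simp only [hb, e]
      exact (hball (_, μ) ⟨hseg y hy s, hμ⟩).1
  -- By `hray` the solution along the segment is the restriction of `Φ` to it. As `Φ` is holomorphic
  -- in `y`, the derivative along the ray determines the complex derivative once the factor `y - c ≠
  -- 0` is cancelled.
  have hne : ∀ y ∈ ball c r, y ≠ c →
      deriv (fun y => Φ y μ) y = ratCoeff (α μ) (β μ) (R μ) y * Φ y μ := by
    intro y hy hyc
    have h1 := hasDerivWithinAt_odeSol (hball (y, μ) ⟨hy, hμ⟩).1
    have h2 : HasDerivAt (fun u : ℝ => Φ (c + (u : ℂ) * (y - c)) μ)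
        ((y - c) • deriv (fun y => Φ y μ) y) 1 := by
      have e1 : HasDerivAt (fun u : ℝ => c + (u : ℂ) * (y - c)) (y - c) 1 := by
        simpa using ((Complex.ofRealCLM.hasDerivAt (x := (1 : ℝ))).mul_const (y - c)).const_add c
      have e2 : HasDerivAt (fun y => Φ y μ) (deriv (fun y => Φ y μ) y)
          (c + ((1 : ℝ) : ℂ) * (y - c)) := by
        simpa using (hA1 y hy).differentiableAt.hasDerivAt
      exact e2.scomp (1 : ℝ) e1
    have h3 : (y - c) • deriv (fun y => Φ y μ) y = b (y, μ) 1 * odeSol (b (y, μ)) 1 := by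
      refine (uniqueDiffWithinAt_Iic (1 : ℝ)).eq_deriv _ (h2.hasDerivWithinAt) (h1.congr_of_eventuallyEq ?_ ?_)
      · have : Set.Icc (0 : ℝ) 1 ∈ 𝓝[Set.Iic 1] (1 : ℝ) := by
          rw [← Set.Ici_inter_Iic]
          exact Filter.inter_mem (mem_nhdsWithin_of_mem_nhds (Ici_mem_nhds one_pos))
            self_mem_nhdsWithin
        filter_upwards [this] with u hu
        rw [Set.projIcc_of_mem _ hu]
        exact hray y hy ⟨u, hu⟩
      · rw [Set.projIcc_of_mem _ (by simp)]
        exact hray y hy 1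
    rw [hb] at h3
    simp only at h3
    rw [coeffPath_apply (R μ) (hden' y hy), smul_mul_assoc] at h3
    have h4 := smul_right_injective 𝔸 (sub_ne_zero.2 hyc) h3
    simpa using h4
  have hcont : ∀ j, ContinuousAt (fun y => (α μ j + β μ j * y)⁻¹) x := fun j =>
    (continuousAt_const.add (continuousAt_const.mul continuousAt_id)).inv₀ (hd j)
  have hcont2 : ContinuousAt (fun y => ratCoeff (α μ) (β μ) (R μ) y * Φ y μ) x := by
    refine ContinuousAt.mul ?_ (hA1 x hx).continuousAt
    exact tendsto_finsetSum _ fun j _ => (hcont j).smul continuousAt_const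
  suffices deriv (fun y => Φ y μ) x = ratCoeff (α μ) (β μ) (R μ) x * Φ x μ by
    rw [← this]
    exact (hA1 x hx).differentiableAt.hasDerivAt
  -- Both sides of the equation are continuous, which settles the remaining case `x = c`.
  have hl : Tendsto (deriv fun y => Φ y μ) (𝓝[≠] x) (𝓝 (deriv (fun y => Φ y μ) x)) :=
    (hA1 x hx).deriv.continuousAt.mono_left nhdsWithin_le_nhds
  refine tendsto_nhds_unique hl ((hcont2.mono_left nhdsWithin_le_nhds).congr' ?_)
  have : {y | y ≠ c} ∈ 𝓝[≠] x := by
    by_cases h : x = c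
    · subst h
      exact self_mem_nhdsWithin
    · exact mem_nhdsWithin_of_mem_nhds (isOpen_ne.mem_nhds h)
  filter_upwards [this, mem_nhdsWithin_of_mem_nhds (isOpen_ball.mem_nhds hx)] with y h1 h2
  exact (hne y h2 h1).symm

end RationalCoefficient

/-! ### The coordinate at infinity -/

section Sphere

/-- The coordinate `w = 1 / x` on the Riemann sphere (with the junk value `0` at `x = 0`). -/
noncomputable def invCoord (x : OnePoint ℂ) : ℂ := x.elim 0 fun z => z⁻¹

@[simp] lemma invCoord_infty : invCoord ∞ = 0 := rfl

@[simp] lemma invCoord_coe (z : ℂ) : invCoord (z : OnePoint ℂ) = z⁻¹ := rfl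

@[simp] lemma fromInvCoord_zero : fromInvCoord 0 = ∞ := if_pos rfl

lemma fromInvCoord_of_ne_zero {w : ℂ} (hw : w ≠ 0) :
    fromInvCoord w = ((w⁻¹ : ℂ) : OnePoint ℂ) := if_neg hw

@[simp] lemma invCoord_fromInvCoord (w : ℂ) : invCoord (fromInvCoord w) = w := by
  by_cases hw : w = 0
  · simp [hw]
  · simp [fromInvCoord_of_ne_zero hw]

lemma fromInvCoord_invCoord {x : OnePoint ℂ} (hx : x ≠ ((0 : ℂ) : OnePoint ℂ)) :
    fromInvCoord (invCoord x) = x := by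
  induction x using OnePoint.rec with
  | infty => simp
  | coe z =>
    have hz : z ≠ 0 := fun h => hx (by rw [h])
    rw [invCoord_coe, fromInvCoord_of_ne_zero (inv_ne_zero hz), inv_inv]

lemma continuous_fromInvCoord : Continuous fromInvCoord := by
  refine continuous_iff_continuousAt.2 fun w => ?_
  by_cases hw : w = 0
  · subst hw
    have h : Tendsto (fun w : ℂ => ((w⁻¹ : ℂ) : OnePoint ℂ)) (𝓝[≠] 0) (𝓝 ∞) := by
      refine OnePoint.tendsto_coe_infty.comp ?_
      rw [coclosedCompact_eq_cocompact, ← cobounded_eq_cocompact]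
      exact tendsto_inv₀_nhdsNE_zero
    rw [continuousAt_iff_punctured_nhds, fromInvCoord_zero]
    refine h.congr' ?_
    filter_upwards [self_mem_nhdsWithin] with w hw
    exact (fromInvCoord_of_ne_zero hw).symm
  · have h : ContinuousAt (fun w : ℂ => ((w⁻¹ : ℂ) : OnePoint ℂ)) w :=
      OnePoint.continuous_coe.continuousAt.comp (continuousAt_inv₀ hw)
    refine h.congr ?_
    filter_upwards [isOpen_ne.mem_nhds hw] with v hv
    exact (fromInvCoord_of_ne_zero hv).symm

lemma tendsto_invCoord_infty : Tendsto invCoord (𝓝 ∞) (𝓝 0) := by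
  rw [OnePoint.tendsto_nhds_infty']
  refine ⟨tendsto_pure_nhds _ _, ?_⟩
  rw [coclosedCompact_eq_cocompact, ← cobounded_eq_cocompact]
  exact tendsto_inv₀_cobounded

lemma eventually_nhds_infty {P : OnePoint ℂ → Prop} (h : ∀ᶠ w in 𝓝 (0 : ℂ), P (fromInvCoord w)) :
    ∀ᶠ x in 𝓝 (∞ : OnePoint ℂ), P x := by
  filter_upwards [tendsto_invCoord_infty.eventually h,
    isOpen_ne.mem_nhds (OnePoint.infty_ne_coe (0 : ℂ))] with x hx hx0
  rwa [fromInvCoord_invCoord hx0] at hx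

/-- This form shows that the discs around `∞` are open, since their complements are compact subsets
of the plane. -/
lemma fromInvCoord_image_ball {r : ℝ} (hr : 0 < r) :
    fromInvCoord '' ball 0 r = ((↑) '' closedBall (0 : ℂ) r⁻¹ : Set (OnePoint ℂ))ᶜ := by
  have key : ∀ z : ℂ, ‖z‖ ≤ r⁻¹ ↔ ¬ (z ≠ 0 ∧ ‖z⁻¹‖ < r) := by
    intro z
    by_cases hz : z = 0
    · simp [hz, hr.le]
    · rw [norm_inv, not_and, not_lt]
      have := inv_le_comm₀ hr (norm_pos_iff.2 hz)
      constructor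
      · intro h _
        rw [le_inv_comm₀ (norm_pos_iff.2 hz) hr] at h
        exact h
      · intro h
        rw [le_inv_comm₀ (norm_pos_iff.2 hz) hr]
        exact h hz
  ext x
  constructor
  · rintro ⟨w, hw, rfl⟩ ⟨z, hz, hzw⟩
    by_cases hw0 : w = 0
    · rw [hw0, fromInvCoord_zero] at hzw
      exact OnePoint.coe_ne_infty _ hzw
    · rw [fromInvCoord_of_ne_zero hw0, OnePoint.coe_eq_coe] at hzw
      rw [mem_closedBall_zero_iff, key] at hz
      subst hzw
      exact hz ⟨inv_ne_zero hw0, by rw [inv_inv]; exact mem_ball_zero_iff.1 hw⟩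
  · intro hx
    have hx0 : x ≠ ((0 : ℂ) : OnePoint ℂ) := fun h =>
      hx ⟨0, mem_closedBall_self (by positivity), h.symm⟩
    refine ⟨invCoord x, ?_, fromInvCoord_invCoord hx0⟩
    induction x using OnePoint.rec with
    | infty => exact mem_ball_self hr
    | coe z =>
      by_contra hz
      refine hx ⟨z, ?_, rfl⟩
      rw [mem_closedBall_zero_iff, key]
      exact fun h => hz (mem_ball_zero_iff.2 h.2)

lemma isOpen_fromInvCoord_image_ball {r : ℝ} (hr : 0 < r) : IsOpen (fromInvCoord '' ball 0 r) := by
  rw [fromInvCoord_image_ball hr]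
  exact OnePoint.isOpen_compl_image_coe.2 ⟨isClosed_closedBall, isCompact_closedBall _ _⟩

lemma mem_of_coe_mem_fromInvCoord_image_ball {r : ℝ} {z : ℂ}
    (hz : (z : OnePoint ℂ) ∈ fromInvCoord '' ball 0 r) : z ≠ 0 ∧ z⁻¹ ∈ ball (0 : ℂ) r := by
  obtain ⟨w, hw, hwz⟩ := hz
  by_cases hw0 : w = 0
  · rw [hw0, fromInvCoord_zero] at hwz
    exact absurd hwz (OnePoint.infty_ne_coe z)
  · rw [fromInvCoord_of_ne_zero hw0, OnePoint.coe_eq_coe] at hwz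
    subst hwz
    exact ⟨inv_ne_zero hw0, by rwa [inv_inv]⟩

lemma isOpen_puncturedSphere {n : ℕ} (t : Fin n → ℂ) : IsOpen (puncturedSphere t) := by
  have : puncturedSphere t = ⋂ j, {x | x ≠ (t j : OnePoint ℂ)} := by
    ext x
    simp [puncturedSphere]
  rw [this]
  exact isOpen_iInter_of_finite fun j => isOpen_ne

end Sphere

-- The statement uses only the topology of the matrices; inversion and Neumann series need a Banach
-- algebra norm, and this one induces that topology.
attribute [local instance] Matrix.linftyOpNormedRing Matrix.linftyOpNormedAlgebra

/-! ### Local solutions on the sphere -/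

section Holomorphic

variable {k : ℕ}

lemma holomorphicOnSphere_image_ball {g : ℂ → Matrix (Fin k) (Fin k) ℂ} {c : ℂ} {r : ℝ}
    (hg : ∀ z ∈ ball c r, DifferentiableAt ℂ g z) :
    HolomorphicOnSphere (fun x => x.elim 0 g) ((↑) '' ball c r) := by
  refine ⟨?_, fun h => absurd h OnePoint.infty_notMem_image_coe⟩
  rintro z ⟨w, hw, hwz⟩
  rw [OnePoint.coe_eq_coe] at hwz
  subst hwz
  exact hg w hw

lemma holomorphicOnSphere_fromInvCoord_image_ball {g : ℂ → Matrix (Fin k) (Fin k) ℂ} {r : ℝ}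
    (hg : ∀ z ∈ ball 0 r, DifferentiableAt ℂ g z) :
    HolomorphicOnSphere (fun x => g (invCoord x)) (fromInvCoord '' ball 0 r) := by
  refine ⟨fun z hz => ?_, fun h => ?_⟩
  · obtain ⟨hz0, hz1⟩ := mem_of_coe_mem_fromInvCoord_image_ball hz
    exact (hg _ hz1).comp z (differentiableAt_inv hz0)
  · obtain ⟨w, hw, h⟩ := h
    have hw0 : (0 : ℂ) ∈ ball (0 : ℂ) r := by
      rw [mem_ball_zero_iff] at hw
      exact mem_ball_self ((norm_nonneg _).trans_lt hw)
    simpa using hg 0 hw0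

/-- A function with values in a neighbourhood of a point of a disc that is holomorphic in the disc
and has vanishing derivative away from the centre is constant. -/
lemma eq_center_of_deriv_eq_zero {f : ℂ → Matrix (Fin k) (Fin k) ℂ} {c : ℂ} {r : ℝ}
    (hf : DifferentiableOn ℂ f (ball c r)) (hf' : ∀ z ∈ ball c r, z ≠ c → deriv f z = 0) :
    ∀ z ∈ ball c r, f z = f c := by
  intro z hz
  have hr : 0 < r := (dist_nonneg).trans_lt (mem_ball.1 hz)
  have ha := hf.analyticOnNhd isOpen_ball
  -- The centre is exempt in the hypothesis because at `∞` only holomorphy is given, not the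
  -- equation; continuity of the derivative fills the gap.
  have hc : deriv f c = 0 := by
    have h1 : Tendsto (deriv f) (𝓝[≠] c) (𝓝 (deriv f c)) :=
      (ha c (mem_ball_self hr)).deriv.continuousAt.mono_left nhdsWithin_le_nhds
    refine tendsto_nhds_unique h1 (tendsto_const_nhds.congr' ?_)
    filter_upwards [self_mem_nhdsWithin, mem_nhdsWithin_of_mem_nhds (ball_mem_nhds c hr)] with y h h'
    exact (hf' y h' h).symm
  refine (convex_ball c r).is_const_of_fderivWithin_eq_zero (𝕜 := ℂ) hf (fun y hy => ?_) hz
    (mem_ball_self hr)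
  rw [fderivWithin_of_isOpen isOpen_ball hy]
  have h0 : deriv f y = 0 := by
    by_cases h : y = c
    · rw [h, hc]
    · exact hf' y hy h
  ext1
  rw [fderiv_apply_one_eq_deriv]
  exact h0

variable {n : ℕ} {t : Fin n → ℂ} {A : Fin n → Matrix (Fin k) (Fin k) ℂ}

/-- `F` is a holomorphic solution of the Fuchsian system in the subset `U` of the sphere. -/
def IsLocalSolution (t : Fin n → ℂ) (A : Fin n → Matrix (Fin k) (Fin k) ℂ)
    (U : Set (OnePoint ℂ)) (F : OnePoint ℂ → Matrix (Fin k) (Fin k) ℂ) : Prop :=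
  HolomorphicOnSphere F U ∧ ∀ z : ℂ, (z : OnePoint ℂ) ∈ U →
    HasDerivAt (fun x : ℂ => F x) ((∑ j, (z - t j)⁻¹ • A j) * F z) z

lemma IsLocalSolution.mono {U V : Set (OnePoint ℂ)} {F : OnePoint ℂ → Matrix (Fin k) (Fin k) ℂ}
    (h : IsLocalSolution t A U F) (hVU : V ⊆ U) : IsLocalSolution t A V F :=
  ⟨⟨fun z hz => h.1.1 z (hVU hz), fun hz => h.1.2 (hVU hz)⟩, fun z hz => h.2 z (hVU hz)⟩

lemma IsLocalSolution.mul_const {U : Set (OnePoint ℂ)}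
    {F : OnePoint ℂ → Matrix (Fin k) (Fin k) ℂ} (h : IsLocalSolution t A U F)
    (C : Matrix (Fin k) (Fin k) ℂ) : IsLocalSolution t A U (fun x => F x * C) := by
  refine ⟨⟨fun z hz => (h.1.1 z hz).mul_const C, fun hz => (h.1.2 hz).mul_const C⟩, fun z hz => ?_⟩
  rw [← mul_assoc]
  exact (h.2 z hz).mul_const C

/-- The two terms of the derivative, `-G⁻¹ (B G) G⁻¹ F` and `G⁻¹ (B F)`, cancel. -/
lemma hasDerivAt_inverse_mul {F G : ℂ → Matrix (Fin k) (Fin k) ℂ} {B : Matrix (Fin k) (Fin k) ℂ}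
    {z : ℂ} (hF : HasDerivAt F (B * F z) z) (hG : HasDerivAt G (B * G z) z) (hu : IsUnit (G z)) :
    HasDerivAt (fun y => Ring.inverse (G y) * F y) 0 z := by
  obtain ⟨u, hu⟩ := hu
  have h1 : HasFDerivAt Ring.inverse _ (G z) := hu ▸ hasFDerivAt_ringInverse (𝕜 := ℂ) u
  have h2 := (h1.comp_hasDerivAt z hG).mul hF
  have h3 : (-((ContinuousLinearMap.mulLeftRight ℂ (Matrix (Fin k) (Fin k) ℂ)) ↑u⁻¹) ↑u⁻¹)
      (B * G z) * F z + (Ring.inverse ∘ G) z * (B * F z) = 0 := by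
    rw [Function.comp_apply, ← hu, Ring.inverse_unit, neg_apply,
      ContinuousLinearMap.mulLeftRight_apply]
    simp [mul_assoc]
  rw [h3] at h2
  exact h2

lemma differentiableAt_inverse_comp {G : ℂ → Matrix (Fin k) (Fin k) ℂ} {z : ℂ}
    (hG : DifferentiableAt ℂ G z) (hu : IsUnit (G z)) :
    DifferentiableAt ℂ (fun y => Ring.inverse (G y)) z := by
  obtain ⟨u, hu⟩ := hu
  have h1 : DifferentiableAt ℂ Ring.inverse (G z) :=
    hu ▸ (hasFDerivAt_ringInverse (𝕜 := ℂ) u).differentiableAt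
  exact h1.comp z hG

/-- A local solution is locally the product of a fundamental solution and a constant. -/
lemma IsLocalSolution.eventually_eq_mul {U : Set (OnePoint ℂ)}
    {F G : OnePoint ℂ → Matrix (Fin k) (Fin k) ℂ} (hU : IsOpen U) (hF : IsLocalSolution t A U F)
    (hG : IsLocalSolution t A U G) (hu : ∀ x ∈ U, IsUnit (G x)) {x : OnePoint ℂ} (hx : x ∈ U) :
    ∀ᶠ y in 𝓝 x, F y = G y * (Ring.inverse (G x) * F x) := by
  -- The quotient `G⁻¹ F` has zero derivative at finite points. At `∞` it is studied in the
  -- coordinate `w = 1 / x`, where this is known for `w ≠ 0` and holomorphy covers `w = 0`.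
  suffices h : ∀ᶠ y in 𝓝 x, Ring.inverse (G y) * F y = Ring.inverse (G x) * F x by
    filter_upwards [h, hU.mem_nhds hx] with y hy hyU
    rw [← hy, Ring.mul_inverse_cancel_left _ _ (hu y hyU)]
  have hd : ∀ z : ℂ, (z : OnePoint ℂ) ∈ U →
      HasDerivAt (fun z : ℂ => Ring.inverse (G z) * F z) 0 z := fun z hz =>
    hasDerivAt_inverse_mul (hF.2 z hz) (hG.2 z hz) (hu _ hz)
  induction x using OnePoint.rec with
  | coe c =>
    obtain ⟨r, hr, hb⟩ := Metric.isOpen_iff.1 (hU.preimage OnePoint.continuous_coe) c hx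
    rw [OnePoint.nhds_coe_eq, eventually_map]
    filter_upwards [ball_mem_nhds c hr] with y hy
    exact eq_center_of_deriv_eq_zero (f := fun z : ℂ => Ring.inverse (G z) * F z)
      (fun z hz => (hd z (hb hz)).differentiableAt.differentiableWithinAt)
      (fun z hz _ => (hd z (hb hz)).deriv) y hy
  | infty =>
    obtain ⟨r, hr, hb⟩ := Metric.isOpen_iff.1 (hU.preimage continuous_fromInvCoord) 0
      (by simpa using hx)
    apply eventually_nhds_infty
    filter_upwards [ball_mem_nhds 0 hr] with y hy
    have hne : ∀ z ∈ ball (0 : ℂ) r, z ≠ 0 → HasDerivAt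
        (fun w : ℂ => Ring.inverse (G (fromInvCoord w)) * F (fromInvCoord w)) 0 z := by
      intro z hz hz0
      have h1 := hb hz
      rw [Set.mem_preimage, fromInvCoord_of_ne_zero hz0] at h1
      have h2 := (hd _ h1).scomp z (hasDerivAt_inv hz0)
      rw [smul_zero] at h2
      refine h2.congr_of_eventuallyEq ?_
      filter_upwards [isOpen_ne.mem_nhds hz0] with w hw
      simp only [fromInvCoord_of_ne_zero hw, Function.comp_apply]
    have := eq_center_of_deriv_eq_zero (c := 0) (r := r)
      (f := fun w : ℂ => Ring.inverse (G (fromInvCoord w)) * F (fromInvCoord w))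
      (fun z hz => ?_) (fun z hz hz0 => (hne z hz hz0).deriv) y hy
    · simpa using this
    · by_cases hz0 : z = 0
      · subst hz0
        refine DifferentiableAt.differentiableWithinAt ?_
        refine (differentiableAt_inverse_comp (hG.1.2 hx) ?_).mul (hF.1.2 hx)
        simpa using hu _ hx
      · exact (hne z hz hz0).differentiableAt.differentiableWithinAt

end Holomorphic

/-- The partial derivative is the total derivative, again analytic, applied to the vector `(0, 1)`.
-/
lemma differentiableAt_partial_deriv {E : Type*} [NormedAddCommGroup E] [NormedSpace ℂ E]
    [CompleteSpace E] {Φ : ℂ → ℂ → E} {z l : ℂ}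
    (h : AnalyticAt ℂ (fun p : ℂ × ℂ => Φ p.1 p.2) (z, l)) :
    DifferentiableAt ℂ (fun z => deriv (Φ z) l) z := by
  have h1 : ∀ᶠ y in 𝓝 z, deriv (Φ y) l = fderiv ℂ (fun p : ℂ × ℂ => Φ p.1 p.2) (y, l) (0, 1) := by
    have h2 : ∀ᶠ y in 𝓝 z, AnalyticAt ℂ (fun p : ℂ × ℂ => Φ p.1 p.2) (y, l) :=
      (Continuous.prodMk_left l).continuousAt.eventually h.eventually_analyticAt
    filter_upwards [h2] with y hy
    have h3 : HasDerivAt (fun μ : ℂ => (y, μ)) ((0, 1) : ℂ × ℂ) l :=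
      (hasDerivAt_const l y).prodMk (hasDerivAt_id l)
    exact (hy.differentiableAt.hasFDerivAt.comp_hasDerivAt l h3).deriv
  have h4 : DifferentiableAt ℂ (fun y => fderiv ℂ (fun p : ℂ × ℂ => Φ p.1 p.2) (y, l)) z :=
    DifferentiableAt.comp (f := fun y : ℂ => (y, l)) (g := fderiv ℂ fun p : ℂ × ℂ => Φ p.1 p.2) z
      h.fderiv.differentiableAt (by fun_prop)
  exact (h4.clm_apply (differentiableAt_const _)).congr_of_eventuallyEq h1

/-! ### Fundamental solutions of the Fuchsian system near a point of the sphere -/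

section LocalSystem

variable {k n : ℕ}

/-- A fundamental solution in a neighbourhood `U` of a point of the sphere of a Fuchsian system
that depends on a parameter near `l`. -/
structure IsParametricSolution (t : ℂ → Fin n → ℂ) (A : ℂ → Fin n → Matrix (Fin k) (Fin k) ℂ)
    (l : ℂ) (U : Set (OnePoint ℂ)) (N : Set ℂ)
    (Φ : OnePoint ℂ → ℂ → Matrix (Fin k) (Fin k) ℂ) : Prop where
  isOpen : IsOpen U
  isPathConnected : IsPathConnected U
  mem_nhds : N ∈ 𝓝 l
  subset : ∀ μ ∈ N, U ⊆ puncturedSphere (t μ)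
  isLocalSolution : ∀ μ ∈ N, IsLocalSolution (t μ) (A μ) U fun x => Φ x μ
  isUnit : ∀ μ ∈ N, ∀ x ∈ U, IsUnit (Φ x μ)
  analyticAt : ∀ μ ∈ N, ∀ x ∈ U, AnalyticAt ℂ (Φ x) μ
  holomorphic_deriv : HolomorphicOnSphere (fun x => deriv (Φ x) l) U

variable {t : ℂ → Fin n → ℂ} {A : ℂ → Fin n → Matrix (Fin k) (Fin k) ℂ} {l : ℂ}

lemma exists_isParametricSolution_coe (ht : ∀ j, AnalyticAt ℂ (fun μ => t μ j) l)
    (hA : ∀ j, AnalyticAt ℂ (fun μ => A μ j) l) {c : ℂ} (hc : ∀ j, c ≠ t l j) :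
    ∃ U N Φ, (c : OnePoint ℂ) ∈ U ∧ IsParametricSolution t A l U N Φ := by
  obtain ⟨r, hr, Φ, h⟩ := exists_fundamental_ratCoeff (α := fun μ j => - t μ j)
    (β := fun _ _ => 1) (R := A) (c := c) (l := l) (fun j => (ht j).neg)
    (fun j => analyticAt_const) hA (fun j => by
      rw [one_mul, neg_add_eq_sub]
      exact sub_ne_zero.2 (hc j))
  have hl : l ∈ ball l r := mem_ball_self hr
  refine ⟨(↑) '' ball c r, ball l r, fun x μ => x.elim 0 fun z => Φ z μ,
    ⟨c, mem_ball_self hr, rfl⟩, ⟨OnePoint.isOpen_image_coe.2 isOpen_ball,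
      ((convex_ball c r).isPathConnected ⟨c, mem_ball_self hr⟩).image OnePoint.continuous_coe,
      ball_mem_nhds l hr, ?_, ?_, ?_, ?_, ?_⟩⟩
  · rintro μ hμ x ⟨z, hz, rfl⟩ j h'
    rw [OnePoint.coe_eq_coe] at h'
    refine (h z hz μ hμ).1 j ?_
    rw [h']
    ring
  · intro μ hμ
    refine ⟨holomorphicOnSphere_image_ball fun z hz => (h z hz μ hμ).2.2.2.differentiableAt, ?_⟩
    rintro z ⟨w, hw, hwz⟩
    rw [OnePoint.coe_eq_coe] at hwz
    subst hwz
    have := (h w hw μ hμ).2.2.2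
    simp only [ratCoeff, one_mul, neg_add_eq_sub] at this
    exact this
  · rintro μ hμ x ⟨z, hz, rfl⟩
    exact (h z hz μ hμ).2.2.1
  · rintro μ hμ x ⟨z, hz, rfl⟩
    exact AnalyticAt.fun_comp (g := fun p : ℂ × ℂ => Φ p.1 p.2) (f := fun ν => (z, ν))
      (h z hz μ hμ).2.1 (analyticAt_const.prod analyticAt_id)
  · have h1 := holomorphicOnSphere_image_ball (g := fun z => deriv (Φ z) l) (c := c) (r := r)
      fun z hz => differentiableAt_partial_deriv (h z hz l hl).2.1
    convert h1 using 2 with x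
    induction x using OnePoint.rec with
    | infty => exact deriv_const l 0
    | coe z => rfl

/-- In the coordinate `w = 1 / x` the coefficient is `-w⁻¹ ∑ A_j / (1 - t_j w)`. Since `∑ A_j = 0`,
it equals `-∑ t_j A_j / (1 - t_j w)`, which is holomorphic at `w = 0`. -/
lemma exists_isParametricSolution_infty (ht : ∀ j, AnalyticAt ℂ (fun μ => t μ j) l)
    (hA : ∀ j, AnalyticAt ℂ (fun μ => A μ j) l) (hsum : ∀ᶠ μ in 𝓝 l, ∑ j, A μ j = 0) :
    ∃ U N Φ, (∞ : OnePoint ℂ) ∈ U ∧ IsParametricSolution t A l U N Φ := by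
  obtain ⟨r, hr, Φ, h⟩ := exists_fundamental_ratCoeff (α := fun _ _ => 1)
    (β := fun μ j => - t μ j) (R := fun μ j => - (t μ j • A μ j)) (c := 0) (l := l)
    (fun j => analyticAt_const) (fun j => (ht j).neg) (fun j => ((ht j).smul (hA j)).neg)
    (fun j => by simp)
  have hl : l ∈ ball l r := mem_ball_self hr
  have h0 : (0 : ℂ) ∈ ball (0 : ℂ) r := mem_ball_self hr
  -- The two forms of the coefficient agree only where the residues sum to zero, so `N` is cut down
  -- to those parameters.
  refine ⟨fromInvCoord '' ball 0 r, ball l r ∩ {μ | ∑ j, A μ j = 0}, fun x μ => Φ (invCoord x) μ,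
    ⟨0, h0, fromInvCoord_zero⟩, ⟨isOpen_fromInvCoord_image_ball hr,
      ((convex_ball 0 r).isPathConnected ⟨0, h0⟩).image continuous_fromInvCoord,
      Filter.inter_mem (ball_mem_nhds l hr) hsum, ?_, ?_, ?_, ?_, ?_⟩⟩
  · rintro μ ⟨hμ, -⟩ x ⟨w, hw, rfl⟩ j h'
    by_cases hw0 : w = 0
    · rw [hw0, fromInvCoord_zero] at h'
      exact OnePoint.infty_ne_coe _ h'
    · rw [fromInvCoord_of_ne_zero hw0, OnePoint.coe_eq_coe] at h'
      refine (h w hw μ hμ).1 j ?_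
      rw [← h', neg_mul, inv_mul_cancel₀ hw0, add_neg_cancel]
  · rintro μ ⟨hμ, hμ0⟩
    refine ⟨holomorphicOnSphere_fromInvCoord_image_ball fun z hz =>
      (h z hz μ hμ).2.2.2.differentiableAt, ?_⟩
    intro z hz
    obtain ⟨hz0, hz1⟩ := mem_of_coe_mem_fromInvCoord_image_ball hz
    have h1 := (h _ hz1 μ hμ).2.2.2.scomp z (hasDerivAt_inv hz0)
    have h2 : (∑ j, (z - t μ j)⁻¹ • A μ j) =
        -(z ^ 2)⁻¹ • ratCoeff (fun _ => 1) (fun j => - t μ j) (fun j => - (t μ j • A μ j)) z⁻¹ := by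
      have h3 : ∑ j, (z - t μ j)⁻¹ • A μ j = ∑ j, ((z - t μ j)⁻¹ - z⁻¹) • A μ j := by
        simp_rw [sub_smul]
        rw [Finset.sum_sub_distrib, ← Finset.smul_sum, show ∑ j, A μ j = 0 from hμ0, smul_zero,
          sub_zero]
      rw [h3, ratCoeff, Finset.smul_sum]
      refine Finset.sum_congr rfl fun j _ => ?_
      rw [← neg_smul, smul_smul, smul_smul]
      congr 1
      have h4 := (h _ hz1 μ hμ).1 j
      have h5 : z - t μ j ≠ 0 := by
        intro h6
        apply h4
        rw [← sub_eq_zero.1 h6, neg_mul, mul_inv_cancel₀ hz0, add_neg_cancel]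
      have h6 : 1 + - t μ j * z⁻¹ = (z - t μ j) * z⁻¹ := by
        rw [sub_mul, mul_inv_cancel₀ hz0]
        ring
      rw [h6, mul_inv, inv_inv]
      field_simp
      ring
    rw [h2, smul_mul_assoc]
    exact h1
  · rintro μ ⟨hμ, -⟩ x ⟨w, hw, rfl⟩
    rw [invCoord_fromInvCoord]
    exact (h w hw μ hμ).2.2.1
  · rintro μ ⟨hμ, -⟩ x ⟨w, hw, rfl⟩
    rw [invCoord_fromInvCoord]
    exact AnalyticAt.fun_comp (g := fun p : ℂ × ℂ => Φ p.1 p.2) (f := fun ν => (w, ν))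
      (h w hw μ hμ).2.1 (analyticAt_const.prod analyticAt_id)
  · exact holomorphicOnSphere_fromInvCoord_image_ball (g := fun z => deriv (Φ z) l)
      fun z hz => differentiableAt_partial_deriv (h z hz l hl).2.1

theorem exists_isParametricSolution (ht : ∀ j, AnalyticAt ℂ (fun μ => t μ j) l)
    (hA : ∀ j, AnalyticAt ℂ (fun μ => A μ j) l) (hsum : ∀ᶠ μ in 𝓝 l, ∑ j, A μ j = 0)
    {x : OnePoint ℂ} (hx : x ∈ puncturedSphere (t l)) :
    ∃ U N Φ, x ∈ U ∧ IsParametricSolution t A l U N Φ := by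
  induction x using OnePoint.rec with
  | infty => exact exists_isParametricSolution_infty ht hA hsum
  | coe c =>
    exact exists_isParametricSolution_coe ht hA fun j h => hx j (by rw [h])

end LocalSystem

/-! ### Flat bundles and parallel transport -/

section Transport

/-- A transitive relation between the points of the unit interval that holds locally for `a ≤ b`
holds for `0` and `1`. -/
lemma unitInterval_induction {Q : I → I → Prop}
    (loc : ∀ s, ∃ V ∈ 𝓝 s, ∀ a b, a ≤ b → Set.Icc a b ⊆ V → Q a b)
    (trans : ∀ a b c, Q a b → Q b c → Q a c) : Q 0 1 := by
  choose V hV hQ using loc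
  obtain ⟨t, ht0, htm, ⟨N, hN⟩, ht⟩ := exists_monotone_Icc_subset_open_cover_unitInterval
    (c := fun s => interior (V s)) (fun s => isOpen_interior)
    (fun s _ => Set.mem_iUnion.2 ⟨s, mem_interior_iff_mem_nhds.2 (hV s)⟩)
  -- The case `m = n` starts the induction, as the relation is not assumed reflexive.
  have step : ∀ n m, n ≤ m → m ≤ n + 1 → Q (t n) (t m) := fun n m h1 h2 => by
    obtain ⟨s, hs⟩ := ht n
    exact hQ s _ _ (htm h1) ((Set.Icc_subset_Icc_right (htm h2)).trans
      (hs.trans interior_subset))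
  have key : ∀ n, Q (t 0) (t n) := by
    intro n
    induction n with
    | zero => exact step 0 0 le_rfl (by simp)
    | succ n ih => exact trans _ _ _ ih (step n (n + 1) n.le_succ le_rfl)
  have := key N
  rwa [ht0, hN N le_rfl] at this

variable {X R : Type*} [TopologicalSpace X] [Ring R]

lemma _root_.Path.subpath_mem_image {x y : X} (γ : Path x y) {a b : I} (hab : a ≤ b) (u : I) :
    γ.subpath a b u ∈ γ '' Set.Icc a b := by
  rw [← γ.range_subpath_of_le a b hab]
  exact Set.mem_range_self u

/-- A transitive relation between the parameters of a path that holds for all subpaths in the sets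
of an open cover holds for `0` and `1`. -/
lemma _root_.Path.subpath_induction {x y : X} (γ : Path x y) {U : X → Set X}
    (hU : ∀ i, IsOpen (U i)) (hmem : ∀ i, i ∈ U i) {Q : I → I → Prop}
    (small : ∀ i a b, (∀ u, γ.subpath a b u ∈ U i) → Q a b)
    (trans : ∀ a b c, Q a b → Q b c → Q a c) : Q 0 1 := by
  refine unitInterval_induction (fun s => ?_) trans
  refine ⟨γ ⁻¹' U (γ s), ((hU _).preimage γ.continuous).mem_nhds (hmem _), fun a b hab h => ?_⟩
  refine small (γ s) a b fun u => ?_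
  obtain ⟨v, hv, e⟩ := γ.subpath_mem_image hab u
  rw [← e]
  exact h hv

/-- The fibre of the flat bundle of solutions. -/
def FlatFiber (R : Type*) : Type _ := R

/-- The discrete topology turns the bundle of solutions into a covering space, whose sheets are the
local solutions. -/
instance : TopologicalSpace (FlatFiber R) := ⊥

instance : DiscreteTopology (FlatFiber R) := ⟨rfl⟩

/-- Local data of a flat bundle over `X`: a fundamental solution around each point of `X`, such that
any two of them differ by a locally constant factor. -/
structure FlatData (X R : Type*) [TopologicalSpace X] [Ring R] where
  /-- The domain of the fundamental solution. -/
  U : X → Set X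
  /-- The fundamental solution. -/
  Φ : X → X → R
  isOpen : ∀ i, IsOpen (U i)
  mem : ∀ i, i ∈ U i
  isUnit : ∀ i, ∀ x ∈ U i, IsUnit (Φ i x)
  map_self : ∀ i, Φ i i = 1
  eventually_eq : ∀ i j, ∀ x ∈ U i ∩ U j,
    ∀ᶠ y in 𝓝 x, Φ i y = Φ j y * (Ring.inverse (Φ j x) * Φ i x)

namespace FlatData

variable (S : FlatData X R)

/-- The change of coordinates between two local trivializations of the flat bundle. -/
noncomputable def change (i j x : X) (v : R) : R := Ring.inverse (S.Φ j x) * (S.Φ i x * v)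

lemma change_change {i j l x : X} (hx : x ∈ S.U j) (v : R) :
    S.change j l x (S.change i j x v) = S.change i l x v := by
  rw [change, change, change, Ring.mul_inverse_cancel_left _ _ (S.isUnit j x hx)]

/-- The flat bundle given by local fundamental solutions. -/
noncomputable def core : FiberBundleCore X X (FlatFiber R) where
  baseSet := S.U
  isOpen_baseSet := S.isOpen
  indexAt := id
  mem_baseSet_at := S.mem
  coordChange := S.change
  coordChange_self i x hx v := Ring.inverse_mul_cancel_left (M₀ := R) _ v (S.isUnit i x hx)
  continuousOn_coordChange i j := by
    rintro ⟨x, v⟩ ⟨hx, -⟩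
    refine ContinuousAt.continuousWithinAt ?_
    refine (continuousAt_const (Y := FlatFiber R) (y := S.change i j x v)).congr ?_
    -- The transition factor `Φ_j⁻¹ Φ_i` is locally constant, which is what continuity means for
    -- discrete fibres.
    have h1 : ∀ᶠ p : X × FlatFiber R in 𝓝 (x, v), p.2 = v :=
      continuousAt_snd.eventually (p := fun w => w = v)
        ((isOpen_discrete ({v} : Set (FlatFiber R))).mem_nhds rfl)
    have h2 : ∀ᶠ p : X × FlatFiber R in 𝓝 (x, v),
        S.Φ i p.1 = S.Φ j p.1 * (Ring.inverse (S.Φ j x) * S.Φ i x) :=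
      Filter.Tendsto.eventually (f := Prod.fst) (l₁ := 𝓝 (x, v)) (l₂ := 𝓝 x) continuousAt_fst
        (S.eventually_eq i j x hx)
    have h3 : ∀ᶠ p : X × FlatFiber R in 𝓝 (x, v), p.1 ∈ S.U j :=
      continuousAt_fst.eventually ((S.isOpen j).mem_nhds hx.2)
    filter_upwards [h1, h2, h3] with p hp1 hp2 hp3
    have h4 : ∀ w : R, S.change i j x w = S.change i j p.1 w := fun w => by
      rw [FlatData.change, FlatData.change, hp2, mul_assoc (S.Φ j p.1),
        Ring.inverse_mul_cancel_left _ _ (S.isUnit j _ hp3), mul_assoc]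
    rw [hp1]
    exact h4 v
  coordChange_comp i j l x hx v := by
    exact S.change_change hx.1.2 v

/-- Path lifting in this covering is analytic continuation, and the monodromy theorem makes it
depend on the homotopy class only. -/
lemma isCoveringMap : IsCoveringMap (Bundle.TotalSpace.proj (F := FlatFiber R) (E := S.core.Fiber)) :=
  FiberBundle.isCoveringMap

/-- Parallel transport in the flat bundle, as a map between the fibres. -/
noncomputable def transportFun {x y : X} (γ : Path.Homotopic.Quotient x y) (v : R) : R :=
  (S.isCoveringMap.monodromy γ ⟨⟨x, v⟩, rfl⟩ : Bundle.TotalSpace (FlatFiber R) S.core.Fiber).2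

lemma transportFun_refl (x : X) (v : R) :
    S.transportFun (Path.Homotopic.Quotient.refl x) v = v := by
  rw [transportFun, S.isCoveringMap.monodromy_refl]
  rfl

lemma monodromy_eq {x y : X} (γ : Path.Homotopic.Quotient x y) (v : R) :
    S.isCoveringMap.monodromy γ ⟨⟨x, v⟩, rfl⟩ = ⟨⟨y, S.transportFun γ v⟩, rfl⟩ := by
  generalize h : S.isCoveringMap.monodromy γ ⟨⟨x, v⟩, rfl⟩ = e
  obtain ⟨⟨y', w⟩, hy⟩ := e
  cases hy
  rw [transportFun, h]

lemma transportFun_trans {x y z : X} (γ : Path.Homotopic.Quotient x y)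
    (γ' : Path.Homotopic.Quotient y z) (v : R) :
    S.transportFun (γ.trans γ') v = S.transportFun γ' (S.transportFun γ v) := by
  rw [transportFun, S.isCoveringMap.monodromy_trans_apply, monodromy_eq]
  rfl

/-- A constant section in the trivialization `i` lifts `β`. The fibre over `x` is read in the
trivialization with index `x`, where `Φ x x = 1`, so its coordinate is the value of the solution at
`x`. -/
lemma transportFun_mk (i : X) {x y : X} (β : Path x y) (hβ : ∀ s, β s ∈ S.U i) (v : R) :
    S.transportFun (.mk β) v = S.Φ i y * (Ring.inverse (S.Φ i x) * v) := by
  set w : R := S.change x i x v with hw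
  have hwv : w = Ring.inverse (S.Φ i x) * v := by
    rw [hw, change, S.map_self, one_mul]
  have hx : x ∈ S.U i := by simpa using hβ 0
  let Γ : I → Bundle.TotalSpace (FlatFiber R) S.core.Fiber := fun s =>
    (S.core.localTriv i).toOpenPartialHomeomorph.symm (β s, w)
  have hΓ : Continuous Γ := by
    refine (S.core.localTriv i).toOpenPartialHomeomorph.symm.continuousOn.comp_continuous
      (β.continuous.prodMk continuous_const) fun s => ?_
    exact ((S.core.localTriv i).mem_target).2 (hβ s)
  have h0 : Γ 0 = ⟨x, v⟩ := by
    have e : S.change i x x w = v := by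
      exact (S.core.coordChange_comp x i x x ⟨⟨S.mem x, hx⟩, S.mem x⟩ v).trans
        (S.core.coordChange_self x x (S.mem x) v)
    have e2 : Γ 0 = ⟨β 0, S.change i (β 0) (β 0) w⟩ := rfl
    rw [e2, β.source, e]
  have hlift := (S.isCoveringMap.eq_liftPath_iff (γ := (β : C(I, X))) (e := ⟨x, v⟩)
    (γ_0 := β.source) (Γ := Γ)).2 ⟨hΓ, rfl, h0⟩
  have h1 : Γ 1 = ⟨y, S.Φ i y * w⟩ := by
    have e2 : Γ 1 = ⟨β 1, Ring.inverse (S.Φ (β 1) (β 1)) * (S.Φ i (β 1) * w)⟩ := rfl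
    rw [e2, β.target, S.map_self, Ring.inverse_one, one_mul]
  have h2 : (S.isCoveringMap.monodromy (.mk β) ⟨⟨x, v⟩, rfl⟩ :
      Bundle.TotalSpace (FlatFiber R) S.core.Fiber) = Γ 1 := congrFun hlift.symm 1
  rw [transportFun, h2, h1, hwv]

lemma transportFun_subpath {x y : X} (γ : Path x y) (a b c : I) (v : R) :
    S.transportFun (.mk (γ.subpath a c)) v =
      S.transportFun (.mk (γ.subpath b c)) (S.transportFun (.mk (γ.subpath a b)) v) := by
  rw [← transportFun_trans, ← Path.Homotopic.Quotient.mk_trans,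
    Path.Homotopic.Quotient.eq.2 ⟨Path.Homotopy.subpathTransSubpath γ a b c⟩]

/-- Along a short path transport is a left multiplication, which commutes with right multiplication;
compositions inherit this. Hence transport is the left multiplication by its value at `1`. -/
lemma transportFun_mul {x y : X} (γ : Path.Homotopic.Quotient x y) (v c : R) :
    S.transportFun γ (v * c) = S.transportFun γ v * c := by
  induction γ using Path.Homotopic.Quotient.ind with | mk γ =>
  have key : ∀ v, S.transportFun (.mk (γ.subpath 0 1)) (v * c) =
      S.transportFun (.mk (γ.subpath 0 1)) v * c := by
    refine γ.subpath_induction S.isOpen S.mem (Q := fun a b => ∀ v, S.transportFun (.mk (γ.subpath a b)) (v * c) =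
      S.transportFun (.mk (γ.subpath a b)) v * c) (fun i a b h v => ?_) fun a b d h1 h2 v => ?_
    · rw [S.transportFun_mk _ _ h, S.transportFun_mk _ _ h]
      simp only [mul_assoc]
    · rw [S.transportFun_subpath γ a b d, h1, h2, ← S.transportFun_subpath γ a b d]
  have gen : ∀ {x' y' : X} (hx : x' = x) (hy : y' = y) (v : R),
      S.transportFun (.mk (γ.cast hx hy)) v = S.transportFun (.mk γ) v := by
    rintro _ _ rfl rfl v
    rfl
  simpa only [Path.subpath_zero_one, gen] using key v

/-- Parallel transport in the flat bundle, as the factor by which it multiplies the fundamental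
solution. -/
noncomputable def transport {x y : X} (γ : Path.Homotopic.Quotient x y) : R := S.transportFun γ 1

lemma transport_refl (x : X) : S.transport (Path.Homotopic.Quotient.refl x) = 1 :=
  S.transportFun_refl x 1

lemma transport_trans {x y z : X} (γ : Path.Homotopic.Quotient x y)
    (γ' : Path.Homotopic.Quotient y z) :
    S.transport (γ.trans γ') = S.transport γ' * S.transport γ := by
  rw [transport, transportFun_trans, transport, transport, ← transportFun_mul, one_mul]

lemma transport_mk (i : X) {x y : X} (β : Path x y) (hβ : ∀ s, β s ∈ S.U i) :
    S.transport (.mk β) = S.Φ i y * Ring.inverse (S.Φ i x) := by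
  rw [transport, S.transportFun_mk i β hβ, mul_one]

lemma transport_subpath {x y : X} (γ : Path x y) (a b c : I) :
    S.transport (.mk (γ.subpath a c)) =
      S.transport (.mk (γ.subpath b c)) * S.transport (.mk (γ.subpath a b)) := by
  rw [← transport_trans, ← Path.Homotopic.Quotient.mk_trans,
    Path.Homotopic.Quotient.eq.2 ⟨Path.Homotopy.subpathTransSubpath γ a b c⟩]

lemma transport_symm_mul {x y : X} (γ : Path.Homotopic.Quotient x y) :
    S.transport γ.symm * S.transport γ = 1 := by
  rw [← transport_trans, Path.Homotopic.Quotient.trans_symm, transport_refl]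

lemma transport_mul_symm {x y : X} (γ : Path.Homotopic.Quotient x y) :
    S.transport γ * S.transport γ.symm = 1 := by
  rw [← transport_trans, Path.Homotopic.Quotient.symm_trans, transport_refl]

lemma transport_cast {x y x' y' : X} (γ : Path x y) (hx : x' = x) (hy : y' = y) :
    S.transport (.mk (γ.cast hx hy)) = S.transport (.mk γ) := by
  subst hx hy
  rfl

end FlatData

end Transport

/-! ### Continuation of solutions and the normalized solution -/

section Continuation

variable {k n : ℕ} {t : Fin n → ℂ} {A : Fin n → Matrix (Fin k) (Fin k) ℂ}

lemma ringInverse_mul {M₀ : Type*} [MonoidWithZero M₀] {a b : M₀} (ha : IsUnit a) (hb : IsUnit b) :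
    Ring.inverse (a * b) = Ring.inverse b * Ring.inverse a := by
  obtain ⟨u, rfl⟩ := ha
  obtain ⟨v, rfl⟩ := hb
  rw [← Units.val_mul, Ring.inverse_unit, Ring.inverse_unit, Ring.inverse_unit, mul_inv_rev,
    Units.val_mul]

lemma Cov.mk_cast {X : Type*} [TopologicalSpace X] {x₀ x y : X} (γ : Path x₀ x) (h : y = x) :
    (⟨y, .mk (γ.cast rfl h)⟩ : Cov X x₀) = ⟨x, .mk γ⟩ := by
  subst h
  rfl

lemma exists_localSolution (hA : ∑ j, A j = 0) (i : puncturedSphere t) :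
    ∃ (U : Set (OnePoint ℂ)) (G : OnePoint ℂ → Matrix (Fin k) (Fin k) ℂ),
      IsOpen U ∧ (i : OnePoint ℂ) ∈ U ∧ U ⊆ puncturedSphere t ∧ IsLocalSolution t A U G ∧
      (∀ x ∈ U, IsUnit (G x)) ∧ G i = 1 := by
  obtain ⟨U, N, Φ, hi, h⟩ := exists_isParametricSolution (t := fun _ => t) (A := fun _ => A)
    (l := 0) (fun j => analyticAt_const) (fun j => analyticAt_const)
    (Eventually.of_forall fun _ => hA) i.2
  have h0 : (0 : ℂ) ∈ N := mem_of_mem_nhds h.mem_nhds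
  have hu := h.isUnit 0 h0
  have hu' : IsUnit (Ring.inverse (Φ i 0)) := (hu i hi).ringInverse
  exact ⟨U, fun x => Φ x 0 * Ring.inverse (Φ i 0), h.isOpen, hi, h.subset 0 h0,
    (h.isLocalSolution 0 h0).mul_const _, fun x hx => (hu x hx).mul hu',
    Ring.mul_inverse_cancel _ (hu i hi)⟩

/-- The flat bundle of solutions of a Fuchsian system. -/
noncomputable def flatData (hA : ∑ j, A j = 0) :
    FlatData (puncturedSphere t) (Matrix (Fin k) (Fin k) ℂ) where
  U i := Subtype.val ⁻¹' (exists_localSolution hA i).choose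
  Φ i x := (exists_localSolution hA i).choose_spec.choose x
  isOpen i := (exists_localSolution hA i).choose_spec.choose_spec.1.preimage continuous_subtype_val
  mem i := (exists_localSolution hA i).choose_spec.choose_spec.2.1
  isUnit i x hx := (exists_localSolution hA i).choose_spec.choose_spec.2.2.2.2.1 x hx
  map_self i := (exists_localSolution hA i).choose_spec.choose_spec.2.2.2.2.2
  eventually_eq i j x hx := by
    obtain ⟨h1, h2, h3, h4, h5, h6⟩ := (exists_localSolution hA i).choose_spec.choose_spec
    obtain ⟨h1', h2', h3', h4', h5', h6'⟩ := (exists_localSolution hA j).choose_spec.choose_spec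
    exact continuous_subtype_val.continuousAt.eventually
      (IsLocalSolution.eventually_eq_mul (h1.inter h1') (h4.mono Set.inter_subset_left)
        (h4'.mono Set.inter_subset_right) (fun x hx => h5' x hx.2) hx)

/-- Parallel transport of the solutions of a Fuchsian system along a path. -/
noncomputable def transport (hA : ∑ j, A j = 0) {x y : puncturedSphere t}
    (γ : Path.Homotopic.Quotient x y) : Matrix (Fin k) (Fin k) ℂ :=
  (flatData hA).transport γ

variable (hA : ∑ j, A j = 0)

lemma transport_refl (x : puncturedSphere t) :
    transport hA (Path.Homotopic.Quotient.refl x) = 1 :=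
  (flatData hA).transport_refl x

lemma transport_trans {x y z : puncturedSphere t} (γ : Path.Homotopic.Quotient x y)
    (γ' : Path.Homotopic.Quotient y z) :
    transport hA (γ.trans γ') = transport hA γ' * transport hA γ :=
  (flatData hA).transport_trans γ γ'

lemma transport_subpath {x y : puncturedSphere t} (γ : Path x y) (a b c : I) :
    transport hA (.mk (γ.subpath a c)) =
      transport hA (.mk (γ.subpath b c)) * transport hA (.mk (γ.subpath a b)) :=
  (flatData hA).transport_subpath γ a b c

lemma transport_cast {x y x' y' : puncturedSphere t} (γ : Path x y) (hx : x' = x) (hy : y' = y) :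
    transport hA (.mk (γ.cast hx hy)) = transport hA (.mk γ) :=
  (flatData hA).transport_cast γ hx hy

lemma isUnit_transport {x y : puncturedSphere t} (γ : Path.Homotopic.Quotient x y) :
    IsUnit (transport hA γ) :=
  ⟨⟨_, _, (flatData hA).transport_mul_symm γ, (flatData hA).transport_symm_mul γ⟩, rfl⟩

/-- Around each point the transport is given by a local fundamental solution. -/
lemma exists_transport_mk (i : puncturedSphere t) :
    ∃ (U : Set (OnePoint ℂ)) (G : OnePoint ℂ → Matrix (Fin k) (Fin k) ℂ),
      IsOpen U ∧ (i : OnePoint ℂ) ∈ U ∧ U ⊆ puncturedSphere t ∧ IsLocalSolution t A U G ∧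
      (∀ x ∈ U, IsUnit (G x)) ∧ G i = 1 ∧
      ∀ {x y : puncturedSphere t} (β : Path x y), (∀ s, (β s : OnePoint ℂ) ∈ U) →
        transport hA (.mk β) = G y * Ring.inverse (G x) := by
  obtain ⟨h1, h2, h3, h4, h5, h6⟩ := (exists_localSolution hA i).choose_spec.choose_spec
  exact ⟨_, _, h1, h2, h3, h4, h5, h6, fun β hβ => (flatData hA).transport_mk i β hβ⟩

/-- The transport is given by any fundamental solution in a neighbourhood of the path. -/
lemma transport_eq_of_isLocalSolution {V : Set (OnePoint ℂ)}
    {G : OnePoint ℂ → Matrix (Fin k) (Fin k) ℂ} (hV : IsOpen V) (hG : IsLocalSolution t A V G)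
    (hu : ∀ x ∈ V, IsUnit (G x)) {x y : puncturedSphere t} (β : Path x y)
    (hβ : ∀ s, (β s : OnePoint ℂ) ∈ V) :
    transport hA (.mk β) = G y * Ring.inverse (G x) := by
  -- Near each point `G` is the chosen fundamental solution times a constant unit, which cancels in
  -- `G y * (G x)⁻¹`. Subdividing the path multiplies such quotients together.
  have loc : ∀ i : puncturedSphere t, ∃ U : Set (puncturedSphere t), IsOpen U ∧ i ∈ U ∧
      ((i : OnePoint ℂ) ∈ V → ∀ {x y : puncturedSphere t} (β : Path x y), (∀ s, β s ∈ U) →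
        transport hA (.mk β) = G y * Ring.inverse (G x)) := by
    intro i
    obtain ⟨U, F, hU, hi, hUt, hF, hFu, -, hT⟩ := exists_transport_mk hA i
    by_cases hiV : (i : OnePoint ℂ) ∈ V
    · have hUV : ∀ᶠ z in 𝓝 (i : OnePoint ℂ), z ∈ U ∩ V := (hU.inter hV).mem_nhds ⟨hi, hiV⟩
      have he := IsLocalSolution.eventually_eq_mul (hU.inter hV) (hG.mono Set.inter_subset_right)
        (hF.mono Set.inter_subset_left) (fun x hx => hFu x hx.1) ⟨hi, hiV⟩
      obtain ⟨W, hW, hWo, hiW⟩ := eventually_nhds_iff.1 (he.and hUV)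
      refine ⟨Subtype.val ⁻¹' W, hWo.preimage continuous_subtype_val, hiW, fun _ x y β hβ => ?_⟩
      have hx := hβ 0
      have hy := hβ 1
      rw [β.source] at hx
      rw [β.target] at hy
      have hC : IsUnit (Ring.inverse (F i) * G i) :=
        (hFu i hi).ringInverse.mul (hu i hiV)
      rw [hT β fun s => (hW _ (hβ s)).2.1, (hW _ hx).1, (hW _ hy).1,
        ringInverse_mul (hFu _ (hW _ hx).2.1) hC, mul_assoc,
        Ring.mul_inverse_cancel_left _ _ hC]
    · exact ⟨Set.univ, isOpen_univ, trivial, fun h => absurd h hiV⟩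
  choose U hUo hU hT using loc
  have key : transport hA (.mk (β.subpath 0 1)) = G (β 1) * Ring.inverse (G (β 0)) := by
    refine unitInterval_induction (Q := fun a b => transport hA (.mk (β.subpath a b)) =
      G (β b) * Ring.inverse (G (β a))) (fun s => ?_) fun a b c h1 h2 => ?_
    · refine ⟨β ⁻¹' U (β s), ((hUo _).preimage β.continuous).mem_nhds (hU _), fun a b hab h => ?_⟩
      refine hT (β s) (hβ s) _ fun u => ?_
      obtain ⟨v, hv, e⟩ := β.subpath_mem_image hab u
      rw [← e]
      exact h hv
    · rw [transport_subpath hA β a b c, h1, h2, ← mul_assoc, mul_assoc (G (β c)),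
        Ring.inverse_mul_cancel _ (hu _ (hβ b)), mul_one]
  rw [Path.subpath_zero_one, transport_cast] at key
  rw [key, β.source, β.target]

lemma isNormalizedSolution_transport :
    IsNormalizedSolution t A fun p => transport hA p.2 := by
  refine ⟨fun p => ?_, transport_refl hA _⟩
  obtain ⟨U, G, hU, hi, hUt, hG, hGu, hG1, hT⟩ := exists_transport_mk hA p.1
  have h := hG.mul_const (transport hA p.2)
  refine ⟨U, fun y => G y * transport hA p.2, hU, hi, hUt, h.1, h.2, fun y β hβ => ?_⟩
  simp only
  rw [transport_trans, hT β hβ, hG1, Ring.inverse_one, mul_one]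

/-- Uniqueness of solutions: on short pieces of a path `Y` is a local fundamental solution times a
constant, so `Y` is multiplied by the transport along the piece. -/
lemma SolvesFuchsian.eq_transport_mul {Y : PuncturedCov t → Matrix (Fin k) (Fin k) ℂ}
    (hY : SolvesFuchsian t A Y) (p : PuncturedCov t) :
    Y p = transport hA p.2 * Y ⟨_, .refl _⟩ := by
  obtain ⟨x, γ⟩ := p
  induction γ using Path.Homotopic.Quotient.ind with | mk γ =>
  -- The point of the covering surface reached at time `s`; the cast is needed because the subpath
  -- starts at `γ 0` instead of `∞`.
  set q : I → PuncturedCov t := fun s => ⟨γ s, .mk ((γ.subpath 0 s).cast γ.source.symm rfl)⟩ with hq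
  have hstep : ∀ a b, (⟨γ b, (q a).2.trans (.mk (γ.subpath a b))⟩ : PuncturedCov t) = q b := by
    intro a b
    have gen : ∀ {x' : puncturedSphere t} (hx : x' = γ 0),
        (Path.Homotopic.Quotient.mk ((γ.subpath 0 a).cast hx rfl)).trans (.mk (γ.subpath a b)) =
        .mk ((γ.subpath 0 b).cast hx rfl) := by
      rintro _ rfl
      exact Path.Homotopic.Quotient.eq.2 ⟨Path.Homotopy.subpathTransSubpath γ 0 a b⟩
    exact congrArg _ (gen γ.source.symm)
  have key : Y (q 1) = transport hA (.mk (γ.subpath 0 1)) * Y (q 0) := by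
    refine unitInterval_induction (Q := fun a b => Y (q b) =
      transport hA (.mk (γ.subpath a b)) * Y (q a)) (fun s => ?_) fun a b c h1 h2 => ?_
    · obtain ⟨U, F, hU, hs, hUt, hF1, hF2, hYF⟩ := hY (q s)
      obtain ⟨V, G, hV, hsV, hVt, hG, hGu, -, hT⟩ := exists_transport_mk hA (γ s)
      have he := IsLocalSolution.eventually_eq_mul (hU.inter hV)
        (IsLocalSolution.mono ⟨hF1, hF2⟩ Set.inter_subset_left)
        (hG.mono Set.inter_subset_right) (fun x hx => hGu x hx.2) ⟨hs, hsV⟩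
      have he' : ∀ᶠ u in 𝓝 s, ((γ u : OnePoint ℂ) ∈ U ∩ V ∧ F (γ u) = G (γ u) * _) :=
        (continuous_subtype_val.comp γ.continuous).continuousAt.eventually
          (Eventually.and ((hU.inter hV).mem_nhds ⟨hs, hsV⟩) he)
      -- The description of `Y` on the sheet through `q s` requires the whole subpath from `s` to
      -- `u` to stay in `U`, hence the order-connected component of `s`.
      refine ⟨_, Set.ordConnectedComponent_mem_nhds.2 he', fun a b hab h => ?_⟩
      have hab1 := h (Set.left_mem_Icc.2 hab)
      have hab2 := h (Set.right_mem_Icc.2 hab)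
      have hY1 : ∀ u, u ∈ Set.ordConnectedComponent {u : I | ((γ u : OnePoint ℂ) ∈ U ∩ V ∧
          F (γ u) = G (γ u) * (Ring.inverse (G (γ s)) * F (γ s)))} s → Y (q u) = F (γ u) := by
        intro u hu
        rw [← hstep s u]
        refine hYF _ _ fun v => ?_
        have hv : γ.subpath s u v ∈ γ '' Set.uIcc s u := by
          rw [← γ.range_subpath s u]
          exact Set.mem_range_self v
        obtain ⟨w, hw, e⟩ := hv
        rw [← e]
        exact (hu hw).1.1
      rw [hY1 a hab1, hY1 b hab2, hT]
      · rw [(Set.ordConnectedComponent_subset hab1).2, (Set.ordConnectedComponent_subset hab2).2,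
          mul_assoc, Ring.inverse_mul_cancel_left _ _
            (hGu _ (Set.ordConnectedComponent_subset hab1).1.2)]
      · intro v
        obtain ⟨w, hw, e⟩ := γ.subpath_mem_image hab v
        rw [← e]
        exact (Set.ordConnectedComponent_subset (h hw)).1.2
    · rw [transport_subpath hA γ a b c, h2, h1, mul_assoc]
  have h0 : q 0 = ⟨_, .refl _⟩ := by
    have gen : ∀ {x' : puncturedSphere t} (hx : x' = γ 0),
        (⟨γ 0, .mk ((γ.subpath 0 0).cast hx rfl)⟩ : Cov (puncturedSphere t) x') =
        ⟨x', .refl x'⟩ := by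
      rintro _ rfl
      rw [Path.subpath_self]
      rfl
    exact gen γ.source.symm
  have h1 : q 1 = ⟨x, .mk γ⟩ := by
    rw [← Cov.mk_cast γ γ.target]
    simp only [hq, Path.subpath_zero_one]
    rfl
  rw [Path.subpath_zero_one, transport_cast, h0, h1] at key
  exact key

/-- Existence validates the choice, and uniqueness identifies the chosen solution with the
transport. -/
lemma normalizedSolution_eq (p : PuncturedCov t) : normalizedSolution t A p = transport hA p.2 := by
  have h : IsNormalizedSolution t A (normalizedSolution t A) :=
    Classical.epsilon_spec (p := IsNormalizedSolution t A) ⟨_, isNormalizedSolution_transport hA⟩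
  rw [h.1.eq_transport_mul hA, h.2, mul_one]

lemma solvesFuchsian_normalizedSolution (hA : ∑ j, A j = 0) : SolvesFuchsian t A (normalizedSolution t A) :=
  (Classical.epsilon_spec (p := IsNormalizedSolution t A)
    ⟨_, isNormalizedSolution_transport hA⟩).1

lemma isMonodromyMatrix_iff {γ : Path.Homotopic.Quotient
      (⟨∞, infty_mem_puncturedSphere t⟩ : puncturedSphere t) ⟨∞, infty_mem_puncturedSphere t⟩}
    {M : Matrix (Fin k) (Fin k) ℂ} :
    IsMonodromyMatrix (normalizedSolution t A) γ M ↔ M = transport hA γ := by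
  constructor
  · intro h
    have h1 : ∀ p : PuncturedCov t, transport hA (γ.trans p.2) = transport hA p.2 * M := fun p => by
      have h2 := h p
      rwa [normalizedSolution_eq hA, normalizedSolution_eq hA] at h2
    have h2 : transport hA (γ.trans (.refl _)) = transport hA (.refl _) * M := h1 ⟨_, .refl _⟩
    rw [transport_trans, transport_refl, one_mul, one_mul] at h2
    exact h2.symm
  · rintro rfl p
    rw [normalizedSolution_eq hA, normalizedSolution_eq hA, Cov.deck, transport_trans]

end Continuation

/-! ### Cycles modulo 2 in the square grid -/

section Chains

/-- A nonempty finite graph in which at most one vertex is the end of exactly one edge contains a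
nonzero cycle modulo 2. -/
lemma exists_cycle_mod_two {E V : Type*} [DecidableEq E] [DecidableEq V] (p q : E → V)
    (hpq : ∀ e, p e ≠ q e) (B : Finset E) (hB : B.Nonempty) (v₀ : V)
    (hdeg : ∀ v ≠ v₀, (B.filter fun e => p e = v ∨ q e = v).card ≠ 1) :
    ∃ c : E → ZMod 2, (∃ e, c e ≠ 0) ∧ (∀ e ∉ B, c e = 0) ∧
      ∀ v, ∑ e ∈ B, c e * ((if p e = v then 1 else 0) + if q e = v then 1 else 0) = 0 := by
  classical
  set W : Finset V := B.image p ∪ B.image q with hW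
  have hpW : ∀ e ∈ B, p e ∈ W := fun e he =>
    Finset.mem_union_left _ (Finset.mem_image_of_mem p he)
  have hqW : ∀ e ∈ B, q e ∈ W := fun e he =>
    Finset.mem_union_right _ (Finset.mem_image_of_mem q he)
  obtain ⟨e₀, he₀⟩ := hB
  set u := p e₀
  have hu : u ∈ W := hpW e₀ he₀
  have hsum : ∑ v ∈ W, (B.filter fun e => p e = v ∨ q e = v).card = 2 * B.card := by
    have : ∀ e ∈ B, (W.filter fun v => p e = v ∨ q e = v) = {p e, q e} := by
      intro e he
      ext v
      simp only [Finset.mem_filter, Finset.mem_insert, Finset.mem_singleton]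
      constructor
      · rintro ⟨-, h | h⟩
        · exact Or.inl h.symm
        · exact Or.inr h.symm
      · rintro (rfl | rfl)
        · exact ⟨hpW e he, Or.inl rfl⟩
        · exact ⟨hqW e he, Or.inr rfl⟩
    simp only [Finset.card_filter]
    rw [Finset.sum_comm]
    simp only [← Finset.card_filter]
    rw [Finset.sum_congr rfl fun e he => by rw [this e he, Finset.card_pair (hpq e)],
      Finset.sum_const, smul_eq_mul, mul_comm]
  have hpos : ∀ v ∈ W, 0 < (B.filter fun e => p e = v ∨ q e = v).card := by
    intro v hv
    rw [Finset.card_pos]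
    rcases Finset.mem_union.1 hv with h | h
    · obtain ⟨e, he, rfl⟩ := Finset.mem_image.1 h
      exact ⟨e, Finset.mem_filter.2 ⟨he, Or.inl rfl⟩⟩
    · obtain ⟨e, he, rfl⟩ := Finset.mem_image.1 h
      exact ⟨e, Finset.mem_filter.2 ⟨he, Or.inr rfl⟩⟩
  -- All degrees are at least `2` except possibly one that is `1`, and they sum to `2 |B|`. So `2
  -- |W| - 1 ≤ 2 |B|`, that is `|W| ≤ |B|`.
  have hcard : (W.erase u).card < B.card := by
    have h1 : ∑ v ∈ W, 2 ≤ ∑ v ∈ W, ((B.filter fun e => p e = v ∨ q e = v).card +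
        if v = v₀ then 1 else 0) := by
      refine Finset.sum_le_sum fun v hv => ?_
      have := hpos v hv
      split_ifs with h
      · omega
      · have := hdeg v h
        omega
    rw [Finset.sum_add_distrib, hsum, Finset.sum_const, smul_eq_mul, Finset.sum_ite_eq'] at h1
    rw [Finset.card_erase_of_mem hu]
    have : 0 < W.card := Finset.card_pos.2 ⟨u, hu⟩
    split_ifs at h1 <;> omega
  -- The boundary map modulo 2 with the vertex `u` dropped from the target; by the dimension count
  -- it has a nonzero kernel.
  let L : (B → ZMod 2) →ₗ[ZMod 2] ({v // v ∈ W.erase u} → ZMod 2) :=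
    LinearMap.pi fun v => ∑ e : B, ((if p e = (v : V) then (1 : ZMod 2) else 0) +
      if q e = (v : V) then 1 else 0) • LinearMap.proj e
  have hker : LinearMap.ker L ≠ ⊥ := by
    apply LinearMap.ker_ne_bot_of_finrank_lt
    rw [Module.finrank_fintype_fun_eq_card, Module.finrank_fintype_fun_eq_card,
      Fintype.card_coe, Fintype.card_coe]
    exact hcard
  obtain ⟨c, hc, hc0⟩ := (Submodule.ne_bot_iff _).1 hker
  set c' : E → ZMod 2 := fun e => if h : e ∈ B then c ⟨e, h⟩ else 0 with hc'
  have hsum' : ∀ v, ∑ e ∈ B, c' e * ((if p e = v then 1 else 0) + if q e = v then 1 else 0) =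
      ∑ e : B, ((if p e = v then (1 : ZMod 2) else 0) + if q e = v then 1 else 0) * c e := by
    intro v
    rw [← Finset.sum_attach]
    refine Finset.sum_congr rfl fun e _ => ?_
    simp only [hc', e.2, dite_true, Subtype.coe_eta]
    rw [mul_comm]
  have hz : ∀ v ∈ W.erase u,
      ∑ e ∈ B, c' e * ((if p e = v then 1 else 0) + if q e = v then 1 else 0) = 0 := by
    intro v hv
    rw [hsum']
    have := congrFun (LinearMap.mem_ker.1 hc) ⟨v, hv⟩
    simpa [L] using this
  refine ⟨c', ?_, fun e he => dif_neg he, fun v => ?_⟩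
  · by_contra! h
    refine hc0 (funext fun e => ?_)
    have := h e
    simpa only [hc', e.2, dite_true, Subtype.coe_eta, Pi.zero_apply] using this
  · by_cases hv : v ∈ W.erase u
    · exact hz v hv
    by_cases hvu : v = u
    -- Every edge has two ends, so the boundary values sum to zero over all vertices. The equation
    -- at `u` follows from the others.
    · have htot : ∑ v ∈ W, ∑ e ∈ B,
          c' e * ((if p e = v then 1 else 0) + if q e = v then 1 else 0) = 0 := by
        rw [Finset.sum_comm]
        refine Finset.sum_eq_zero fun e he => ?_
        rw [← Finset.mul_sum, Finset.sum_add_distrib, Finset.sum_ite_eq, Finset.sum_ite_eq,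
          if_pos (hpW e he), if_pos (hqW e he), CharTwo.add_self_eq_zero, mul_zero]
      rw [← Finset.add_sum_erase _ _ hu, Finset.sum_eq_zero hz, add_zero] at htot
      rw [hvu]
      exact htot
    · have hvW : v ∉ W := fun h => hv (Finset.mem_erase.2 ⟨hvu, h⟩)
      refine Finset.sum_eq_zero fun e he => ?_
      rw [if_neg fun h : p e = v => hvW (h ▸ hpW e he),
        if_neg fun h : q e = v => hvW (h ▸ hqW e he), add_zero, mul_zero]

/-- The edges of the square grid: `(v, false)` is the vertical edge from `v` to `v + (0, 1)`,
between the faces `v - (1, 0)` and `v`, and `(v, true)` is the horizontal edge from `v` to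
`v + (1, 0)`, between the faces `v - (0, 1)` and `v`. -/
abbrev GridEdge : Type := (ℤ × ℤ) × Bool

/-- The second end of an edge of the grid. -/
def GridEdge.tip (e : GridEdge) : ℤ × ℤ :=
  if e.2 then (e.1.1 + 1, e.1.2) else (e.1.1, e.1.2 + 1)

/-- A cycle modulo 2 in the square grid separates the faces into two classes. -/
lemma exists_potential (c : GridEdge → ZMod 2) (hc : {e | c e ≠ 0}.Finite)
    (hcyc : ∀ a b, c ((a, b), false) + c ((a, b - 1), false) + c ((a, b), true) +
      c ((a - 1, b), true) = 0) :
    ∃ w : ℤ × ℤ → ZMod 2, (∀ a b, w (a, b) - w (a - 1, b) = c ((a, b), false)) ∧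
      ∀ a b, w (a, b) - w (a, b - 1) = c ((a, b), true) := by
  obtain ⟨N, hN⟩ : ∃ N : ℤ, ∀ a ≤ N, ∀ b i, c ((a, b), i) = 0 := by
    obtain ⟨N, hN⟩ := (hc.image fun e => e.1.1).bddBelow
    refine ⟨N - 1, fun a ha b i => ?_⟩
    by_contra h
    have := hN (Set.mem_image_of_mem (fun e : GridEdge => e.1.1)
      (show ((a, b), i) ∈ {e | c e ≠ 0} from h))
    dsimp at this
    omega
  -- The number modulo 2 of edges of the cycle crossed on the way to the face along its row, coming
  -- from the left of the support.
  let w : ℤ × ℤ → ZMod 2 := fun f => ∑ i ∈ Finset.Ioc N f.1, c ((i, f.2), false)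
  have hw1 : ∀ a b, w (a, b) - w (a - 1, b) = c ((a, b), false) := by
    intro a b
    rcases le_or_gt a N with h | h
    · simp only [w]
      rw [Finset.Ioc_eq_empty (by simpa using h), Finset.Ioc_eq_empty (by simp; omega), hN a h]
      simp
    · have : Finset.Ioc N a = insert a (Finset.Ioc N (a - 1)) := by
        ext i
        simp only [Finset.mem_Ioc, Finset.mem_insert]
        omega
      simp only [w]
      rw [this, Finset.sum_insert (by simp), add_sub_cancel_right]
  refine ⟨w, hw1, fun a b => ?_⟩
  -- By the cycle condition at the vertex `(a, b)` the defect across horizontal edges is the same in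
  -- columns `a` and `a - 1`. Far to the left it is zero.
  have hstep : ∀ a, w (a, b) - w (a, b - 1) - c ((a, b), true) =
      w (a - 1, b) - w (a - 1, b - 1) - c ((a - 1, b), true) := by
    intro a
    have h1 := hw1 a b
    have h2 := hw1 a (b - 1)
    have h3 := hcyc a b
    have h4 : (2 : ZMod 2) = 0 := rfl
    linear_combination h1 - h2 - h3 + (c ((a - 1, b), true)) * h4 + c ((a, b), false) * h4
  have hall : ∀ k : ℕ, w (a, b) - w (a, b - 1) - c ((a, b), true) =
      w (a - k, b) - w (a - k, b - 1) - c ((a - k, b), true) := by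
    intro k
    induction k with
    | zero => simp
    | succ k ih =>
      rw [ih, hstep]
      push_cast
      simp only [sub_sub]
  have h := hall (a - N).toNat
  have hk : a - ((a - N).toNat : ℤ) ≤ N := by omega
  have h0 : ∀ b', w (a - ((a - N).toNat : ℤ), b') = 0 := fun b' => by
    simp only [w]
    rw [Finset.Ioc_eq_empty (by simp only [not_lt]; exact hk), Finset.sum_empty]
  rw [h0, h0, hN _ hk, sub_zero, sub_zero] at h
  exact sub_eq_zero.1 h

/-- A finite set of edges of the square grid that does not separate the faces, and in which at most
one vertex is the end of exactly one edge, is empty. -/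
lemma gridEdge_eq_empty (B : Finset GridEdge) (v₀ : ℤ × ℤ)
    (hdeg : ∀ v ≠ v₀, (B.filter fun e => e.1 = v ∨ e.tip = v).card ≠ 1)
    (hconn : ∀ w : ℤ × ℤ → ZMod 2, (∀ a b, ((a, b), false) ∉ B → w (a, b) = w (a - 1, b)) →
      (∀ a b, ((a, b), true) ∉ B → w (a, b) = w (a, b - 1)) → ∀ f f', w f = w f') :
    B = ∅ := by
  by_contra hB
  have hpq : ∀ e : GridEdge, e.1 ≠ e.tip := by
    rintro ⟨⟨a, b⟩, i⟩ h
    cases i <;> simp [GridEdge.tip] at h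
  obtain ⟨c, ⟨e, he⟩, hcB, hc⟩ := exists_cycle_mod_two (fun e : GridEdge => e.1) GridEdge.tip hpq B
    (Finset.nonempty_iff_ne_empty.2 hB) v₀ hdeg
  -- The potential of a cycle supported in `B` does not change across edges outside `B`. So it is
  -- constant by `hconn`, and the cycle vanishes.
  obtain ⟨w, hw1, hw2⟩ := exists_potential c
    (B.finite_toSet.subset fun e he => by_contra fun h => he (hcB e h)) fun a b => by
      rw [← hc (a, b)]
      have h1 : ∀ e : GridEdge, c e = ∑ e' ∈ B, c e' * if e' = e then 1 else 0 := by
        intro e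
        simp only [mul_ite, mul_one, mul_zero, Finset.sum_ite_eq']
        split_ifs with h
        · rfl
        · exact hcB e h
      rw [h1 ((a, b), false), h1 ((a, b - 1), false), h1 ((a, b), true), h1 ((a - 1, b), true),
        ← Finset.sum_add_distrib, ← Finset.sum_add_distrib, ← Finset.sum_add_distrib]
      refine Finset.sum_congr rfl fun e _ => ?_
      rw [← mul_add, ← mul_add, ← mul_add]
      congr 1
      obtain ⟨⟨x, y⟩, i⟩ := e
      cases i
      · simp only [GridEdge.tip, Prod.mk.injEq, and_true, and_false, if_false, add_zero,
          Bool.false_eq_true]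
        congr 1
        exact if_congr (by constructor <;> rintro ⟨h1, h2⟩ <;> constructor <;> omega) rfl rfl
      · simp only [GridEdge.tip, Prod.mk.injEq, and_true, and_false, if_false, if_true, zero_add,
          Bool.true_eq_false]
        congr 1
        exact if_congr (by constructor <;> rintro ⟨h1, h2⟩ <;> constructor <;> omega) rfl rfl
  have hw := hconn w
    (fun a b h => sub_eq_zero.1 ((hw1 a b).trans (hcB _ h)))
    fun a b h => sub_eq_zero.1 ((hw2 a b).trans (hcB _ h))
  obtain ⟨⟨a, b⟩, i⟩ := e
  cases i
  · exact he (by rw [← hw1, hw (a, b) (a - 1, b), sub_self])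
  · exact he (by rw [← hw2, hw (a, b) (a, b - 1), sub_self])

end Chains

/-! ### Segments, and relations between classes of paths -/

section Segments

variable {S : Set (OnePoint ℂ)}

/-- Paths with common ends in a convex subset of the plane are homotopic. -/
lemma mk_eq_of_convex {C : Set ℂ} (hC : Convex ℝ C) (hCS : ∀ z ∈ C, (z : OnePoint ℂ) ∈ S) {x y : S}
    (α β : Path x y) (hα : ∀ s, (α s : OnePoint ℂ) ∈ ((↑) : ℂ → OnePoint ℂ) '' C)
    (hβ : ∀ s, (β s : OnePoint ℂ) ∈ ((↑) : ℂ → OnePoint ℂ) '' C) :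
    Path.Homotopic.Quotient.mk α = .mk β := by
  obtain ⟨x', hx', ex⟩ := hα 0
  obtain ⟨y', hy', ey⟩ := hα 1
  rw [α.source] at ex
  rw [α.target] at ey
  have := hC.contractibleSpace ⟨x', hx'⟩
  let f : C(C, S) := ⟨fun z => ⟨((z : ℂ) : OnePoint ℂ), hCS z z.2⟩,
    (OnePoint.continuous_coe.comp continuous_subtype_val).subtype_mk _⟩
  have hf : IsEmbedding f := by
    refine IsEmbedding.of_comp f.continuous continuous_subtype_val ?_
    exact OnePoint.isOpenEmbedding_coe.isEmbedding.comp IsEmbedding.subtypeVal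
  obtain rfl : f ⟨x', hx'⟩ = x := Subtype.ext ex
  obtain rfl : f ⟨y', hy'⟩ = y := Subtype.ext ey
  -- Both paths lift through the embedding of the contractible set `C`, where all paths with common
  -- ends are homotopic.
  have key : ∀ γ : Path (f ⟨x', hx'⟩) (f ⟨y', hy'⟩),
      (∀ s, (γ s : OnePoint ℂ) ∈ ((↑) : ℂ → OnePoint ℂ) '' C) →
      ∃ γ' : Path (⟨x', hx'⟩ : C) ⟨y', hy'⟩, γ = γ'.map f.continuous := by
    intro γ hγ
    choose g hg e using hγ
    have e' : ∀ s, f ⟨g s, hg s⟩ = γ s := fun s => Subtype.ext (e s)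
    refine ⟨⟨⟨fun s => ⟨g s, hg s⟩, ?_⟩, ?_, ?_⟩, ?_⟩
    · rw [hf.continuous_iff]
      convert! γ.continuous using 1
      exact funext e'
    · exact hf.injective ((e' 0).trans γ.source)
    · exact hf.injective ((e' 1).trans γ.target)
    · ext s
      rw [← e' s]
      rfl
  obtain ⟨α', rfl⟩ := key α hα
  obtain ⟨β', rfl⟩ := key β hβ
  exact Path.Homotopic.Quotient.eq.2 ((SimplyConnectedSpace.paths_homotopic α' β').map f)

/-- The homotopy class of a segment. -/
noncomputable def seg {a b : ℂ} (h : ∀ w ∈ segment ℝ a b, (w : OnePoint ℂ) ∈ S) :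
    Path.Homotopic.Quotient (⟨a, h a (left_mem_segment ℝ a b)⟩ : S)
      ⟨b, h b (right_mem_segment ℝ a b)⟩ :=
  .mk (pathIn ((Path.segment a b).map OnePoint.continuous_coe)
    (fun s => h _ (by rw [← Path.range_segment]; exact Set.mem_range_self s)) _ _)

lemma mem_of_convex {C : Set ℂ} (hC : Convex ℝ C) (hCS : ∀ z ∈ C, (z : OnePoint ℂ) ∈ S) {a b : ℂ}
    (ha : a ∈ C) (hb : b ∈ C) : ∀ w ∈ segment ℝ a b, (w : OnePoint ℂ) ∈ S :=
  fun w hw => hCS w (hC.segment_subset ha hb hw)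

lemma segment_apply_mem {C : Set ℂ} (hC : Convex ℝ C) {a b : ℂ} (ha : a ∈ C) (hb : b ∈ C) (s : I) :
    (((Path.segment a b).map OnePoint.continuous_coe) s : OnePoint ℂ) ∈
      ((↑) : ℂ → OnePoint ℂ) '' C :=
  ⟨Path.segment a b s, hC.segment_subset ha hb
    (by rw [← Path.range_segment]; exact Set.mem_range_self s), rfl⟩

lemma mk_eq_seg {C : Set ℂ} (hC : Convex ℝ C) (hCS : ∀ z ∈ C, (z : OnePoint ℂ) ∈ S) {a b : ℂ}
    (ha : a ∈ C) (hb : b ∈ C) (α : Path (⟨a, hCS a ha⟩ : S) ⟨b, hCS b hb⟩)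
    (hα : ∀ s, (α s : OnePoint ℂ) ∈ ((↑) : ℂ → OnePoint ℂ) '' C) :
    .mk α = seg (mem_of_convex hC hCS ha hb) :=
  mk_eq_of_convex hC hCS _ _ hα fun s => segment_apply_mem hC ha hb s

lemma path_trans_mem {X : Type*} [TopologicalSpace X] {x y z : X} {T : Set X} {α : Path x y}
    {β : Path y z} (hα : ∀ s, α s ∈ T) (hβ : ∀ s, β s ∈ T) (s : I) : α.trans β s ∈ T := by
  have h : α.trans β s ∈ Set.range (α.trans β) := Set.mem_range_self s
  rw [Path.trans_range] at h
  rcases h with ⟨u, hu⟩ | ⟨u, hu⟩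
  · rw [← hu]; exact hα u
  · rw [← hu]; exact hβ u

lemma seg_trans {C : Set ℂ} (hC : Convex ℝ C) (hCS : ∀ z ∈ C, (z : OnePoint ℂ) ∈ S) {a b c : ℂ}
    (ha : a ∈ C) (hb : b ∈ C) (hc : c ∈ C) :
    (seg (mem_of_convex hC hCS ha hb)).trans (seg (mem_of_convex hC hCS hb hc)) =
      seg (mem_of_convex hC hCS ha hc) := by
  rw [seg, seg, ← Path.Homotopic.Quotient.mk_trans]
  refine mk_eq_seg hC hCS ha hc _ ?_
  exact path_trans_mem (T := Subtype.val ⁻¹' (((↑) : ℂ → OnePoint ℂ) '' C))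
    (fun s => segment_apply_mem hC ha hb s) fun s => segment_apply_mem hC hb hc s

end Segments

/-- An equivalence relation between homotopy classes of paths with the initial point `x₀` and equal
final points that is compatible with continuation of the paths. -/
structure PathRel {X : Type*} [TopologicalSpace X] (x₀ : X) where
  /-- The relation. -/
  r : ∀ ⦃x : X⦄, Path.Homotopic.Quotient x₀ x → Path.Homotopic.Quotient x₀ x → Prop
  equiv : ∀ x, Equivalence (@r x)
  comp : ∀ ⦃x y : X⦄ {a b : Path.Homotopic.Quotient x₀ x}, r a b →
    ∀ c : Path.Homotopic.Quotient x y, r (a.trans c) (b.trans c)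

/-- If there is a section of the classes modulo `R` that is locally constant, then `R` is total. -/
lemma PathRel.total {X : Type*} [TopologicalSpace X] {x₀ : X} (R : PathRel x₀)
    (f : ∀ x, Path.Homotopic.Quotient x₀ x) (h0 : R.r (f x₀) (.refl x₀))
    (loc : ∀ x, ∃ V ∈ 𝓝 x, ∀ y z (β : Path y z), (∀ s, β s ∈ V) →
      R.r ((f y).trans (.mk β)) (f z)) ⦃x : X⦄ (a b : Path.Homotopic.Quotient x₀ x) : R.r a b := by
  -- Every class is related to the section: continued along a path, the section stays related to
  -- itself by `loc`, and at `x₀` it is related to the trivial class.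
  have key : ∀ a : Path.Homotopic.Quotient x₀ x, R.r a (f x) := by
    intro a
    induction a using Path.Homotopic.Quotient.ind with | mk α =>
    have h : R.r ((f (α 0)).trans (.mk (α.subpath 0 1))) (f (α 1)) := by
      refine unitInterval_induction (Q := fun u v => R.r ((f (α u)).trans (.mk (α.subpath u v)))
        (f (α v))) (fun s => ?_) fun u v w h1 h2 => ?_
      · obtain ⟨V, hV, h⟩ := loc (α s)
        refine ⟨α ⁻¹' V, α.continuous.continuousAt.preimage_mem_nhds hV, fun u v huv hs => ?_⟩
        refine h _ _ _ fun r => ?_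
        obtain ⟨w, hw, e⟩ := α.subpath_mem_image huv r
        rw [← e]
        exact hs hw
      · rw [← Path.Homotopic.Quotient.eq.2 ⟨Path.Homotopy.subpathTransSubpath α u v w⟩,
          Path.Homotopic.Quotient.mk_trans, ← Path.Homotopic.Quotient.trans_assoc]
        exact (R.equiv _).trans (R.comp h1 _) h2
    have gen : ∀ {x' y' : X} (hx : x₀ = x') (hy : x = y'),
        R.r ((f x').trans (.mk (α.cast hx.symm hy.symm))) (f y') →
        R.r ((f x₀).trans (.mk α)) (f x) := by
      rintro _ _ rfl rfl h
      exact h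
    rw [Path.subpath_zero_one] at h
    have h1 := gen α.source.symm α.target.symm h
    refine (R.equiv _).trans ((R.equiv _).symm ?_) h1
    have h2 := R.comp h0 (.mk α)
    rwa [Path.Homotopic.Quotient.refl_trans] at h2
  exact (R.equiv _).trans (key a) ((R.equiv _).symm (key b))

/-! ### The square grid -/

section Grid

/-- The vertices of the square grid with mesh `δ`. -/
noncomputable def gridVertex (δ : ℝ) (v : ℤ × ℤ) : ℂ := ⟨v.1 * δ, v.2 * δ⟩

/-- The faces of the square grid with mesh `δ`. -/
def gridFace (δ : ℝ) (f : ℤ × ℤ) : Set ℂ :=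
  {z | (f.1 * δ ≤ z.re ∧ z.re ≤ (f.1 + 1) * δ) ∧ f.2 * δ ≤ z.im ∧ z.im ≤ (f.2 + 1) * δ}

/-- The centres of the faces. -/
noncomputable def gridCenter (δ : ℝ) (f : ℤ × ℤ) : ℂ := ⟨(f.1 + 1 / 2) * δ, (f.2 + 1 / 2) * δ⟩

/-- The face that contains a given point. -/
noncomputable def faceOf (δ : ℝ) (z : ℂ) : ℤ × ℤ := (⌊z.re / δ⌋, ⌊z.im / δ⌋)

/-- A face of the grid without certain vertices. -/
def puncturedFace {n : ℕ} (δ : ℝ) (v : Fin n → ℤ × ℤ) (f : ℤ × ℤ) : Set ℂ :=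
  {z | z ∈ gridFace δ f ∧ ∀ j, z ≠ gridVertex δ (v j)}

variable {n : ℕ} {δ : ℝ} {v : Fin n → ℤ × ℤ}

lemma mem_gridFace_faceOf (hδ : 0 < δ) (z : ℂ) : z ∈ gridFace δ (faceOf δ z) :=
  ⟨⟨(le_div_iff₀ hδ).1 (Int.floor_le _), ((div_lt_iff₀ hδ).1 (Int.lt_floor_add_one _)).le⟩,
    (le_div_iff₀ hδ).1 (Int.floor_le _), ((div_lt_iff₀ hδ).1 (Int.lt_floor_add_one _)).le⟩

/-- `faceOf` breaks ties by rounding down and jumps at the edges. Nevertheless the closed faces of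
the points near `x` all contain `x`, so neighbouring faces can be compared at `x`. -/
lemma eventually_mem_gridFace_faceOf (hδ : 0 < δ) (x : ℂ) :
    ∀ᶠ y in 𝓝 x, x ∈ gridFace δ (faceOf δ y) := by
  have key : ∀ u : ℝ, ∀ᶠ y in 𝓝 u, (⌊y / δ⌋ : ℝ) * δ ≤ u ∧ u ≤ (⌊y / δ⌋ + 1) * δ := by
    intro u
    have h1 : ∀ᶠ y in 𝓝 u, y / δ < ⌊u / δ⌋ + 1 :=
      (continuous_id.div_const δ).continuousAt.eventually_lt_const (Int.lt_floor_add_one _)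
    have h2 : ∀ᶠ y in 𝓝 u, (⌈u / δ⌉ : ℝ) - 1 < y / δ :=
      (continuous_id.div_const δ).continuousAt.eventually_const_lt
        (by have := Int.ceil_lt_add_one (u / δ); simp only [id]; linarith)
    filter_upwards [h1, h2] with y hy1 hy2
    constructor
    · rw [← le_div_iff₀ hδ]
      have : ⌊y / δ⌋ < ⌊u / δ⌋ + 1 := Int.floor_lt.2 (by exact_mod_cast hy1)
      exact (Int.cast_le.2 (Int.lt_add_one_iff.1 this)).trans (Int.floor_le _)
    · rw [← div_le_iff₀ hδ]
      have : ⌈u / δ⌉ - 1 ≤ ⌊y / δ⌋ := Int.le_floor.2 (by push_cast; exact hy2.le)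
      exact (Int.le_ceil _).trans (by exact_mod_cast (by omega : ⌈u / δ⌉ ≤ ⌊y / δ⌋ + 1))
  filter_upwards [Complex.continuous_re.continuousAt.eventually (key x.re),
    Complex.continuous_im.continuousAt.eventually (key x.im)] with y h1 h2
  exact ⟨h1, h2⟩

lemma gridVertex_mem_gridFace (hδ : 0 < δ) {p f : ℤ × ℤ} :
    gridVertex δ p ∈ gridFace δ f ↔ (f.1 ≤ p.1 ∧ p.1 ≤ f.1 + 1) ∧ f.2 ≤ p.2 ∧ p.2 ≤ f.2 + 1 := by
  simp only [gridVertex, gridFace, Set.mem_ofPred_eq, mul_le_mul_iff_left₀ hδ]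
  norm_cast

lemma gridVertex_injective (hδ : 0 < δ) : Function.Injective (gridVertex δ) := by
  intro p q h
  have h1 := congrArg Complex.re h
  have h2 := congrArg Complex.im h
  simp only [gridVertex, mul_left_inj' hδ.ne'] at h1 h2
  exact Prod.ext (by exact_mod_cast h1) (by exact_mod_cast h2)

/-- A multiple of `δ` is not an inner point of `[f δ, (f + 1) δ]`, so a proper convex combination
reaches it only from that end. -/
lemma eq_of_convex_comb_eq_int_mul (hδ : 0 < δ) {f m : ℤ} {x y a b : ℝ} (hx1 : f * δ ≤ x)
    (hx2 : x ≤ (f + 1) * δ) (hy1 : f * δ ≤ y) (hy2 : y ≤ (f + 1) * δ) (ha : 0 < a) (hb : 0 < b)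
    (hab : a + b = 1) (h : a * x + b * y = m * δ) : x = m * δ := by
  obtain rfl : b = 1 - a := by linarith
  rcases le_or_gt m f with hm | hm
  · have hm' : (m : ℝ) * δ ≤ f * δ := by gcongr
    nlinarith
  · have hm' : ((f : ℝ) + 1) * δ ≤ m * δ := by
      gcongr
      exact_mod_cast hm
    nlinarith

/-- The vertices in a face are its corners, which are extreme points, and removing extreme points
preserves convexity. -/
lemma convex_puncturedFace (hδ : 0 < δ) (f : ℤ × ℤ) : Convex ℝ (puncturedFace δ v f) := by
  rintro x ⟨⟨⟨hx1, hx2⟩, hx3, hx4⟩, hx⟩ y ⟨⟨⟨hy1, hy2⟩, hy3, hy4⟩, hy⟩ a b ha hb hab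
  have hb' : b = 1 - a := by linarith
  have hre : (a • x + b • y).re = a * x.re + b * y.re := by simp
  have him : (a • x + b • y).im = a * x.im + b * y.im := by simp
  refine ⟨⟨⟨?_, ?_⟩, ?_, ?_⟩, fun j h => ?_⟩
  · rw [hre]; subst hb'; nlinarith
  · rw [hre]; subst hb'; nlinarith
  · rw [him]; subst hb'; nlinarith
  · rw [him]; subst hb'; nlinarith
  · rcases ha.eq_or_lt with rfl | ha0
    · obtain rfl : b = 1 := by linarith
      exact hy j (by simpa using h)
    rcases hb.eq_or_lt with rfl | hb0
    · obtain rfl : a = 1 := by linarith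
      exact hx j (by simpa using h)
    have h1 := congrArg Complex.re h
    have h2 := congrArg Complex.im h
    rw [hre] at h1
    rw [him] at h2
    exact hx j (Complex.ext
      (eq_of_convex_comb_eq_int_mul hδ hx1 hx2 hy1 hy2 ha0 hb0 hab h1)
      (eq_of_convex_comb_eq_int_mul hδ hx3 hx4 hy3 hy4 ha0 hb0 hab h2))

lemma mem_puncturedSphere_of_mem_puncturedFace {f : ℤ × ℤ} (z : ℂ) (hz : z ∈ puncturedFace δ v f) :
    (z : OnePoint ℂ) ∈ puncturedSphere fun j => gridVertex δ (v j) :=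
  fun j h => hz.2 j (OnePoint.coe_injective h)

lemma gridCenter_mem_puncturedFace (hδ : 0 < δ) (f : ℤ × ℤ) :
    gridCenter δ f ∈ puncturedFace δ v f := by
  refine ⟨⟨⟨?_, ?_⟩, ?_, ?_⟩, fun j h => ?_⟩
  · simp only [gridCenter]; nlinarith
  · simp only [gridCenter]; nlinarith
  · simp only [gridCenter]; nlinarith
  · simp only [gridCenter]; nlinarith
  · have h1 := congrArg Complex.re h
    simp only [gridCenter, gridVertex, mul_left_inj' hδ.ne'] at h1
    have h2 : (2 * f.1 + 1 : ℝ) = 2 * (v j).1 := by linarith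
    have h3 : 2 * f.1 + 1 = 2 * (v j).1 := by exact_mod_cast h2
    omega

/-- A horizontal strip of the grid without its boundary. -/
lemma convex_strip (δ : ℝ) (b : ℤ) : Convex ℝ {z : ℂ | b * δ < z.im ∧ z.im < (b + 1) * δ} := by
  have h := (convex_Ioo (b * δ) ((b + 1) * δ)).is_linear_preimage (f := Complex.im)
    Complex.imLm.isLinear
  exact h

lemma mem_puncturedSphere_of_mem_strip (hδ : 0 < δ) {b : ℤ} (z : ℂ)
    (hz : z ∈ {z : ℂ | b * δ < z.im ∧ z.im < (b + 1) * δ}) :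
    (z : OnePoint ℂ) ∈ puncturedSphere fun j => gridVertex δ (v j) := by
  intro j h
  obtain rfl := OnePoint.coe_injective h
  obtain ⟨h1, h2⟩ := hz
  simp only [gridVertex, mul_lt_mul_iff_left₀ hδ] at h1 h2
  norm_cast at h1 h2
  omega

lemma gridCenter_mem_strip (hδ : 0 < δ) (a b : ℤ) :
    gridCenter δ (a, b) ∈ {z : ℂ | b * δ < z.im ∧ z.im < (b + 1) * δ} := by
  constructor <;> simp only [gridCenter] <;> nlinarith

end Grid

/-! ### Sections built from classes of paths to the faces -/

section GridContinuation

variable {n : ℕ} {δ : ℝ} {v : Fin n → ℤ × ℤ}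

lemma isCompact_gridFace (δ : ℝ) (f : ℤ × ℤ) : IsCompact (gridFace δ f) :=
  isCompact_Icc.reProdIm isCompact_Icc

/-- The class of a path from the centre of a face, continued to a point of the face. -/
noncomputable def faceClass (hδ : 0 < δ) {x₀ : puncturedSphere fun j => gridVertex δ (v j)}
    {f : ℤ × ℤ} (a : Path.Homotopic.Quotient x₀
      ⟨gridCenter δ f, mem_puncturedSphere_of_mem_puncturedFace _ (gridCenter_mem_puncturedFace hδ f)⟩)
    {x : ℂ} (hx : x ∈ puncturedFace δ v f) :
    Path.Homotopic.Quotient x₀ ⟨x, mem_puncturedSphere_of_mem_puncturedFace x hx⟩ :=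
  a.trans (seg (mem_of_convex (convex_puncturedFace hδ f) mem_puncturedSphere_of_mem_puncturedFace
    (gridCenter_mem_puncturedFace hδ f) hx))

lemma faceClass_trans_seg (hδ : 0 < δ) {x₀ : puncturedSphere fun j => gridVertex δ (v j)}
    {f : ℤ × ℤ} (a : Path.Homotopic.Quotient x₀
      ⟨gridCenter δ f, mem_puncturedSphere_of_mem_puncturedFace _ (gridCenter_mem_puncturedFace hδ f)⟩)
    {x y : ℂ} (hx : x ∈ puncturedFace δ v f) (hy : y ∈ puncturedFace δ v f) :
    (faceClass hδ a hx).trans (seg (mem_of_convex (convex_puncturedFace hδ f)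
      mem_puncturedSphere_of_mem_puncturedFace hx hy)) = faceClass hδ a hy := by
  rw [faceClass, faceClass, Path.Homotopic.Quotient.trans_assoc]
  congr 1
  exact seg_trans (convex_puncturedFace hδ f) mem_puncturedSphere_of_mem_puncturedFace
    (gridCenter_mem_puncturedFace hδ f) hx hy

/-- The face on the left of a vertical edge and the face below a horizontal edge. -/
def GridEdge.side (e : GridEdge) : ℤ × ℤ :=
  if e.2 then (e.1.1, e.1.2 - 1) else (e.1.1 - 1, e.1.2)

lemma GridEdge.eq_of_mem {a b : ℤ} {e : GridEdge} (h : e.1 = (a, b) ∨ e.tip = (a, b)) :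
    e = ((a, b), false) ∨ e = ((a, b - 1), false) ∨ e = ((a, b), true) ∨ e = ((a - 1, b), true) := by
  obtain ⟨⟨x, y⟩, i⟩ := e
  cases i <;> simp only [GridEdge.tip, Prod.mk.injEq, if_true, if_false, Bool.false_eq_true,
    and_true, and_false, or_false, false_or, reduceCtorEq] at h ⊢ <;> omega

/-- Only finitely many faces are outside `C`, so the row of `f` meets `C` on the left. The nearest
such face is the anchor from which `f` is reached; it is `f` itself if `f ∈ C`. -/
lemma exists_anchor {C : Set (ℤ × ℤ)} (hC : Cᶜ.Finite) (f : ℤ × ℤ) :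
    ∃ g, g ≤ f.1 ∧ (g, f.2) ∈ C ∧ ∀ i, g < i → i ≤ f.1 → (i, f.2) ∉ C := by
  obtain ⟨i, hi1, hi2⟩ : ∃ i, i ≤ f.1 ∧ (i, f.2) ∈ C := by
    by_contra! h
    refine (Set.Iic_infinite f.1) ((hC.preimage (f := fun i : ℤ => (i, f.2)) ?_).subset h)
    intro i _ j _ hij
    exact (Prod.mk.inj hij).1
  obtain ⟨g, ⟨hg1, hg2⟩, hg⟩ := Int.exists_greatest_of_bdd
    (P := fun i => i ≤ f.1 ∧ (i, f.2) ∈ C) ⟨f.1, fun z hz => hz.1⟩ ⟨i, hi1, hi2⟩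
  exact ⟨g, hg1, hg2, fun i h1 h2 h3 => absurd (hg i ⟨h2, h3⟩) (not_le.2 h1)⟩

lemma seg_self {S : Set (OnePoint ℂ)} {a : ℂ} (h : ∀ w ∈ segment ℝ a a, (w : OnePoint ℂ) ∈ S) :
    seg h = .refl _ := by
  rw [seg, ← Path.Homotopic.Quotient.mk_refl]
  congr 1
  ext s
  simp [pathIn]

/-- The faces of the grid with classes of paths to their centres such that neighbouring faces agree
give a locally constant section. -/
theorem PathRel.total_of_faceClass (hδ : 0 < δ)
    (R : PathRel (⟨∞, infty_mem_puncturedSphere _⟩ : puncturedSphere fun j => gridVertex δ (v j)))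
    {C : Set (ℤ × ℤ)} (hC : Cᶜ.Finite) {P : Set (OnePoint ℂ)} (hPi : ∞ ∈ P)
    (hCP : ∀ f ∈ C, ∀ z ∈ gridFace δ f, (z : OnePoint ℂ) ∈ P)
    (hRP : ∀ x (α β : Path (⟨∞, infty_mem_puncturedSphere _⟩ :
        puncturedSphere fun j => gridVertex δ (v j)) x), (∀ s, (α s : OnePoint ℂ) ∈ P) →
      (∀ s, (β s : OnePoint ℂ) ∈ P) → R.r (.mk α) (.mk β))
    (a : ∀ f, Path.Homotopic.Quotient (⟨∞, infty_mem_puncturedSphere _⟩ :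
        puncturedSphere fun j => gridVertex δ (v j))
      ⟨gridCenter δ f, mem_puncturedSphere_of_mem_puncturedFace _ (gridCenter_mem_puncturedFace hδ f)⟩)
    (haC : ∀ f ∈ C, ∀ x (hx : x ∈ puncturedFace δ v f), ∃ α, (∀ s, (α s : OnePoint ℂ) ∈ P) ∧
      faceClass hδ (a f) hx = .mk α)
    (hgood : ∀ f f' x (hx : x ∈ puncturedFace δ v f) (hx' : x ∈ puncturedFace δ v f'),
      R.r (faceClass hδ (a f) hx) (faceClass hδ (a f') hx'))
    ⦃x : puncturedSphere fun j => gridVertex δ (v j)⦄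
    (b c : Path.Homotopic.Quotient ⟨∞, infty_mem_puncturedSphere _⟩ x) : R.r b c := by
  have hfin : ∀ z : ℂ, (z : OnePoint ℂ) ∈ puncturedSphere (fun j => gridVertex δ (v j)) →
      z ∈ puncturedFace δ v (faceOf δ z) := fun z hz =>
    ⟨mem_gridFace_faceOf hδ z, fun j h => hz j (congrArg _ h)⟩
  -- The section is the trivial class at `∞` and the class given by the face `faceOf δ z` at a
  -- finite point `z`.
  have hsec : ∀ x : puncturedSphere fun j => gridVertex δ (v j),
      ∃ c : Path.Homotopic.Quotient ⟨∞, infty_mem_puncturedSphere _⟩ x,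
        (∀ (z : ℂ) (hz : z ∈ puncturedFace δ v (faceOf δ z))
          (e : x = ⟨z, mem_puncturedSphere_of_mem_puncturedFace z hz⟩),
          c = (faceClass hδ (a (faceOf δ z)) hz).cast rfl e) ∧
        ∀ e : x = ⟨∞, infty_mem_puncturedSphere _⟩,
          c = (Path.Homotopic.Quotient.refl _).cast rfl e := by
    rintro ⟨x, hx⟩
    induction x using OnePoint.rec with
    | infty =>
      refine ⟨.refl _, fun z hz e => ?_, fun e => rfl⟩
      exact absurd (congrArg Subtype.val e) (OnePoint.infty_ne_coe z)
    | coe z =>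
      refine ⟨faceClass hδ (a (faceOf δ z)) (hfin z hx), fun w hw e => ?_, fun e => ?_⟩
      · obtain rfl := OnePoint.coe_injective (congrArg Subtype.val e)
        exact (Path.Homotopic.Quotient.cast_rfl_rfl _).symm
      · exact absurd (congrArg Subtype.val e) (OnePoint.coe_ne_infty z)
  choose sec hsec1 hsec2 using hsec
  refine R.total sec (by rw [hsec2 _ rfl]; exact (R.equiv _).refl _) ?_ b c
  rintro ⟨x, hx⟩
  induction x using OnePoint.rec with
  | infty =>
    -- Near `∞` only faces in `C` occur. There the section is represented by paths in `P`, which are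
    -- all related by `hRP`.
    have hK : IsCompact (((↑) : ℂ → OnePoint ℂ) '' ⋃ f ∈ Cᶜ, gridFace δ f) :=
      (hC.isCompact_biUnion fun f _ => isCompact_gridFace δ f).image OnePoint.continuous_coe
    have hPath : ∀ y : puncturedSphere fun j => gridVertex δ (v j),
        (y : OnePoint ℂ) ∉ ((↑) : ℂ → OnePoint ℂ) '' ⋃ f ∈ Cᶜ, gridFace δ f →
        (y : OnePoint ℂ) ∈ P ∧ ∃ α, (∀ s, (α s : OnePoint ℂ) ∈ P) ∧ sec y = .mk α := by
      rintro ⟨y, hy⟩ hyK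
      induction y using OnePoint.rec with
      | infty => exact ⟨hPi, .refl _, fun s => hPi, hsec2 _ rfl⟩
      | coe z =>
        have hz : faceOf δ z ∈ C := by
          by_contra h
          exact hyK ⟨z, Set.mem_biUnion h (mem_gridFace_faceOf hδ z), rfl⟩
        refine ⟨hCP _ hz z (mem_gridFace_faceOf hδ z), ?_⟩
        rw [hsec1 _ z (hfin z hy) rfl, Path.Homotopic.Quotient.cast_rfl_rfl]
        exact haC _ hz _ _
    refine ⟨Subtype.val ⁻¹' (((↑) : ℂ → OnePoint ℂ) '' ⋃ f ∈ Cᶜ, gridFace δ f)ᶜ,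
      (hK.isClosed.isOpen_compl.preimage continuous_subtype_val).mem_nhds ?_, fun y z β hβ => ?_⟩
    · rintro ⟨z, -, h⟩
      exact OnePoint.coe_ne_infty z h
    · obtain ⟨-, α, hα, e⟩ := hPath y (by simpa using hβ 0)
      obtain ⟨-, α', hα', e'⟩ := hPath z (by simpa using hβ 1)
      rw [e, e', ← Path.Homotopic.Quotient.mk_trans]
      refine hRP _ _ _ ?_ hα'
      exact path_trans_mem (T := Subtype.val ⁻¹' P) hα fun s => (hPath _ (hβ s)).1
  | coe z =>
    have h1 : ∀ᶠ y : ℂ in 𝓝 z, (y : OnePoint ℂ) ∈ puncturedSphere fun j => gridVertex δ (v j) :=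
      OnePoint.continuous_coe.continuousAt.eventually ((isOpen_puncturedSphere _).mem_nhds hx)
    obtain ⟨r, hr, hball⟩ := Metric.eventually_nhds_iff_ball.1
      (h1.and (eventually_mem_gridFace_faceOf hδ z))
    have hbS : ∀ y ∈ ball z r, (y : OnePoint ℂ) ∈ puncturedSphere fun j => gridVertex δ (v j) :=
      fun y hy => (hball y hy).1
    refine ⟨Subtype.val ⁻¹' (((↑) : ℂ → OnePoint ℂ) '' ball z r),
      ((OnePoint.isOpenEmbedding_coe.isOpenMap _ isOpen_ball).preimage
        continuous_subtype_val).mem_nhds ⟨z, mem_ball_self hr, rfl⟩, ?_⟩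
    rintro y y' β hβ
    obtain ⟨u, hu, e⟩ : (y : OnePoint ℂ) ∈ ((↑) : ℂ → OnePoint ℂ) '' ball z r := by
      simpa using hβ 0
    obtain ⟨u', hu', e'⟩ : (y' : OnePoint ℂ) ∈ ((↑) : ℂ → OnePoint ℂ) '' ball z r := by
      simpa using hβ 1
    obtain rfl : (⟨u, hbS u hu⟩ : puncturedSphere fun j => gridVertex δ (v j)) = y := Subtype.ext e
    obtain rfl : (⟨u', hbS u' hu'⟩ : puncturedSphere fun j => gridVertex δ (v j)) = y' :=
      Subtype.ext e'
    -- The faces of `u` and `u'` both contain `z`. A path from `u` to `u'` in the disc is therefore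
    -- replaced by the segments through `z`, and the classes are compared at `z`.
    have hzf : ∀ y ∈ ball z r, z ∈ puncturedFace δ v (faceOf δ y) := fun y hy =>
      ⟨(hball y hy).2, fun j h => hx j (congrArg _ h)⟩
    have e1 : sec ⟨u, hbS u hu⟩ = faceClass hδ (a (faceOf δ u)) (hfin u (hbS u hu)) :=
      (hsec1 _ u (hfin u (hbS u hu)) rfl).trans (Path.Homotopic.Quotient.cast_rfl_rfl _)
    have e2 : sec ⟨u', hbS u' hu'⟩ = faceClass hδ (a (faceOf δ u')) (hfin u' (hbS u' hu')) :=
      (hsec1 _ u' (hfin u' (hbS u' hu')) rfl).trans (Path.Homotopic.Quotient.cast_rfl_rfl _)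
    rw [e1, e2, mk_eq_seg (convex_ball z r) hbS hu hu' β hβ,
      ← seg_trans (convex_ball z r) hbS hu (mem_ball_self hr) hu',
      ← Path.Homotopic.Quotient.trans_assoc]
    have h3 := faceClass_trans_seg hδ (a (faceOf δ u)) (hfin u (hbS u hu)) (hzf u hu)
    have h4 := faceClass_trans_seg hδ (a (faceOf δ u')) (hzf u' hu') (hfin u' (hbS u' hu'))
    rw [h3, ← h4]
    exact R.comp (hgood _ _ z (hzf u hu) (hzf u' hu')) _

end GridContinuation

/-! ### Bad edges, and why there are none -/

section GridContinuation

variable {n : ℕ} {δ : ℝ} {v : Fin n → ℤ × ℤ}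

lemma GridEdge.finite_of_side_or {C : Set (ℤ × ℤ)} (hC : C.Finite) :
    {e : GridEdge | e.side ∈ C ∨ e.1 ∈ C}.Finite := by
  have h : (C ×ˢ (Set.univ : Set Bool)).Finite := hC.prod Set.finite_univ
  refine ((h.image fun e => (if e.2 then ((e.1.1, e.1.2 + 1), e.2)
    else ((e.1.1 + 1, e.1.2), e.2) : GridEdge)).union h).subset ?_
  rintro ⟨⟨a, b⟩, i⟩ (he | he)
  · refine Or.inl ⟨(GridEdge.side ((a, b), i), i), ⟨he, trivial⟩, ?_⟩
    cases i <;> simp [GridEdge.side]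
  · exact Or.inr ⟨he, trivial⟩

lemma GridEdge.mem_gridFace (hδ : 0 < δ) (e : GridEdge) :
    (gridVertex δ e.1 ∈ gridFace δ e.1 ∧ gridVertex δ e.tip ∈ gridFace δ e.1) ∧
      gridVertex δ e.1 ∈ gridFace δ e.side ∧ gridVertex δ e.tip ∈ gridFace δ e.side := by
  obtain ⟨⟨a, b⟩, i⟩ := e
  cases i <;> simp [gridVertex_mem_gridFace hδ, GridEdge.tip, GridEdge.side]

/-- A relation between paths in the plane without some vertices of a grid, that holds for paths in
a set `P`, is total if `P` contains sufficiently many faces of the grid. -/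
theorem PathRel.total_of_grid (hδ : 0 < δ)
    (R : PathRel (⟨∞, infty_mem_puncturedSphere _⟩ : puncturedSphere fun j => gridVertex δ (v j)))
    {C : Set (ℤ × ℤ)} (hC : Cᶜ.Finite)
    (hCconn : ∀ w : ℤ × ℤ → ZMod 2,
      (∀ e : GridEdge, e.side ∈ C → e.1 ∈ C → w e.1 = w e.side) → ∀ f ∈ C, ∀ f' ∈ C, w f = w f')
    {P : Set (OnePoint ℂ)} (hPi : ∞ ∈ P)
    (hCP : ∀ f ∈ C, ∀ z ∈ gridFace δ f, (z : OnePoint ℂ) ∈ P)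
    (hpath : ∀ f ∈ C, ∃ α : Path (⟨∞, infty_mem_puncturedSphere _⟩ :
        puncturedSphere fun j => gridVertex δ (v j)) ⟨gridCenter δ f,
          mem_puncturedSphere_of_mem_puncturedFace _ (gridCenter_mem_puncturedFace hδ f)⟩,
      ∀ s, (α s : OnePoint ℂ) ∈ P)
    (hRP : ∀ x (α β : Path (⟨∞, infty_mem_puncturedSphere _⟩ :
        puncturedSphere fun j => gridVertex δ (v j)) x), (∀ s, (α s : OnePoint ℂ) ∈ P) →
      (∀ s, (β s : OnePoint ℂ) ∈ P) → R.r (.mk α) (.mk β))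
    {κ : Type*} (ι : ℤ × ℤ → κ)
    (hι : ∀ f ∉ C, ∀ p q, gridVertex δ p ∈ gridFace δ f → gridVertex δ q ∈ gridFace δ f → ι p = ι q)
    (hιv : ∀ j j', ι (v j) = ι (v j') → v j = v j')
    ⦃x : puncturedSphere fun j => gridVertex δ (v j)⦄
    (b c : Path.Homotopic.Quotient ⟨∞, infty_mem_puncturedSphere _⟩ x) : R.r b c := by
  classical
  choose g hg1 hg2 hg3 using exists_anchor hC
  choose p hp using hpath
  -- A path in `P` leads to the centre of the anchor, and a horizontal segment leads on to `f`; the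
  -- open strip along the row contains no vertex.
  let a : ∀ f, Path.Homotopic.Quotient (⟨∞, infty_mem_puncturedSphere _⟩ :
      puncturedSphere fun j => gridVertex δ (v j)) ⟨gridCenter δ f,
        mem_puncturedSphere_of_mem_puncturedFace _ (gridCenter_mem_puncturedFace hδ f)⟩ :=
    fun f => (Path.Homotopic.Quotient.mk (p (g f, f.2) (hg2 f))).trans
      (seg (mem_of_convex (convex_strip δ f.2) (mem_puncturedSphere_of_mem_strip hδ)
        (gridCenter_mem_strip hδ (g f) f.2) (gridCenter_mem_strip hδ f.1 f.2)))
  have ha : ∀ f i (hi : (i, f.2) ∈ C), g f = i →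
      a f = (Path.Homotopic.Quotient.mk (p (i, f.2) hi)).trans
      (seg (mem_of_convex (convex_strip δ f.2) (mem_puncturedSphere_of_mem_strip hδ)
        (gridCenter_mem_strip hδ i f.2) (gridCenter_mem_strip hδ f.1 f.2))) := by
    rintro f i hi rfl
    rfl
  have hgC : ∀ f ∈ C, g f = f.1 := by
    intro f hf
    by_contra h
    exact hg3 f f.1 (lt_of_le_of_ne (hg1 f) h) le_rfl hf
  have haC : ∀ f ∈ C, ∀ x (hx : x ∈ puncturedFace δ v f), ∃ α, (∀ s, (α s : OnePoint ℂ) ∈ P) ∧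
      faceClass hδ (a f) hx = .mk α := by
    intro f hf x hx
    rw [faceClass, ha f f.1 hf (hgC f hf), seg_self, Path.Homotopic.Quotient.trans_refl, seg,
      ← Path.Homotopic.Quotient.mk_trans]
    refine ⟨_, path_trans_mem (T := Subtype.val ⁻¹' P) (hp f hf) fun s => ?_, rfl⟩
    obtain ⟨z, hz, e⟩ := segment_apply_mem (convex_puncturedFace hδ f)
      (gridCenter_mem_puncturedFace (v := v) hδ f) hx s
    change (((Path.segment _ _).map OnePoint.continuous_coe) s : OnePoint ℂ) ∈ P
    rw [← e]
    exact hCP f hf z hz.1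
  set G : ℤ × ℤ → ℤ × ℤ → Prop := fun f f' => ∀ x (hx : x ∈ puncturedFace δ v f)
    (hx' : x ∈ puncturedFace δ v f'), R.r (faceClass hδ (a f) hx) (faceClass hδ (a f') hx') with hG
  -- Agreement at one common point passes to all others along a segment that lies in both faces.
  have Gof : ∀ {f f'} {x} (hx : x ∈ puncturedFace δ v f) (hx' : x ∈ puncturedFace δ v f'),
      R.r (faceClass hδ (a f) hx) (faceClass hδ (a f') hx') → G f f' := by
    intro f f' x hx hx' h y hy hy'
    rw [← faceClass_trans_seg hδ (a f) hx hy, ← faceClass_trans_seg hδ (a f') hx' hy']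
    exact R.comp h _
  have GC : ∀ f ∈ C, ∀ f' ∈ C, G f f' := by
    intro f hf f' hf' x hx hx'
    obtain ⟨α, hα, e⟩ := haC f hf x hx
    obtain ⟨β, hβ, e'⟩ := haC f' hf' x hx'
    rw [e, e']
    exact hRP _ _ _ hα hβ
  -- A face outside `C` has the same anchor as its left neighbour. The two classes are compared at
  -- the midpoint of the common edge, within the strip.
  have Gleft : ∀ f ∉ C, G (f.1 - 1, f.2) f := by
    intro f hf
    have e : g (f.1 - 1, f.2) = g f := by
      have h1 : g f ≤ f.1 - 1 := by
        have : g f ≠ f.1 := fun h => hf (by have := hg2 f; rwa [h] at this)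
        have := hg1 f
        omega
      rcases lt_trichotomy (g (f.1 - 1, f.2)) (g f) with h | h | h
      · exact absurd (hg2 f) (hg3 (f.1 - 1, f.2) _ h h1)
      · exact h
      · have h3 : g (f.1 - 1, f.2) ≤ f.1 - 1 := hg1 (f.1 - 1, f.2)
        exact absurd (hg2 (f.1 - 1, f.2)) (hg3 f _ h (by omega))
    have hx : gridCenter δ f ∈ puncturedFace δ v f := gridCenter_mem_puncturedFace hδ f
    have hmid : (⟨f.1 * δ, (f.2 + 1 / 2) * δ⟩ : ℂ) ∈
        {z : ℂ | f.2 * δ < z.im ∧ z.im < (f.2 + 1) * δ} := by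
      constructor <;> simp only <;> nlinarith
    have hmS := mem_puncturedSphere_of_mem_strip (v := v) hδ _ hmid
    have hm1 : (⟨f.1 * δ, (f.2 + 1 / 2) * δ⟩ : ℂ) ∈ puncturedFace δ v f := by
      refine ⟨⟨⟨le_rfl, ?_⟩, ?_, ?_⟩, fun j h => hmS j (congrArg _ h)⟩ <;> simp only <;> nlinarith
    have hm2 : (⟨f.1 * δ, (f.2 + 1 / 2) * δ⟩ : ℂ) ∈ puncturedFace δ v (f.1 - 1, f.2) := by
      refine ⟨⟨⟨?_, ?_⟩, ?_, ?_⟩, fun j h => hmS j (congrArg _ h)⟩ <;> simp only <;> push_cast <;>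
        nlinarith
    refine Gof hm2 hm1 ?_
    rw [faceClass, faceClass, ha (f.1 - 1, f.2) (g f) (hg2 f) e, ha f (g f) (hg2 f) rfl,
      Path.Homotopic.Quotient.trans_assoc, Path.Homotopic.Quotient.trans_assoc]
    have e1 := seg_trans (convex_strip δ f.2) (mem_puncturedSphere_of_mem_strip (v := v) hδ)
      (gridCenter_mem_strip hδ (g f) f.2) (gridCenter_mem_strip hδ (f.1 - 1) f.2) hmid
    have e2 := seg_trans (convex_strip δ f.2) (mem_puncturedSphere_of_mem_strip (v := v) hδ)
      (gridCenter_mem_strip hδ (g f) f.2) (gridCenter_mem_strip hδ f.1 f.2) hmid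
    have e3 := e1.trans e2.symm
    exact (congrArg (fun c => R.r _ ((Path.Homotopic.Quotient.mk _).trans c)) e3).mp
      ((R.equiv _).refl _)
  have hbad : ∀ e : GridEdge, ¬ G e.side e.1 → e.side ∉ C ∨ e.1 ∉ C := by
    intro e he
    by_contra! h
    exact he (GC _ h.1 _ h.2)
  -- A bad edge borders a face outside `C`, on whose corners the label `ι` is constant. Hence the
  -- bad edges split into disjoint graphs according to the label.
  have hbadι : ∀ e : GridEdge, ¬ G e.side e.1 → ι e.1 = ι e.tip := by
    intro e he
    have hm := e.mem_gridFace hδ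
    rcases hbad e he with h | h
    · exact hι _ h _ _ hm.2.1 hm.2.2
    · exact hι _ h _ _ hm.1.1 hm.1.2
  have hfin : ∀ o, {e : GridEdge | ¬ G e.side e.1 ∧ ι e.1 = o}.Finite := fun o =>
    (GridEdge.finite_of_side_or hC).subset fun e he => hbad e he.1
  have hB : ∀ o, (hfin o).toFinset = ∅ := by
    intro o
    set B := (hfin o).toFinset with hBdef
    have memB : ∀ {e : GridEdge}, e ∈ B ↔ ¬ G e.side e.1 ∧ ι e.1 = o := by
      intro e
      simp [hBdef]
    have hdeg1 : ∀ w, ι w ≠ o → (B.filter fun e => e.1 = w ∨ e.tip = w).card ≠ 1 := by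
      intro w hw
      rw [Finset.filter_false_of_mem, Finset.card_empty]
      · exact zero_ne_one
      · intro e he h
        have he' := memB.1 he
        rcases h with h | h
        · exact hw (by rw [← h]; exact he'.2)
        · exact hw (by rw [← h, ← hbadι e he'.1]; exact he'.2)
    -- Four faces meet at a vertex. Unless it is a puncture they have this point in common, so
    -- agreement across three of the edges implies agreement across the fourth.
    have hdeg2 : ∀ w, (∀ j, w ≠ v j) → (B.filter fun e => e.1 = w ∨ e.tip = w).card ≠ 1 := by
      rintro ⟨i, j⟩ hw hcard
      obtain ⟨e₀, he₀⟩ := Finset.card_eq_one.1 hcard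
      have hmem : ∀ {e : GridEdge}, (e ∈ B ∧ (e.1 = (i, j) ∨ e.tip = (i, j))) ↔ e = e₀ := by
        intro e
        simpa only [Finset.mem_filter, Finset.mem_singleton] using Finset.ext_iff.1 he₀ e
      obtain ⟨h0B, h0⟩ := hmem.2 rfl
      have hιw : ι (i, j) = o := by
        have he' := memB.1 h0B
        rcases h0 with h | h
        · rw [← h]; exact he'.2
        · rw [← h, ← hbadι e₀ he'.1]; exact he'.2
      have hgood : ∀ e : GridEdge, (e.1 = (i, j) ∨ e.tip = (i, j)) → e ≠ e₀ → G e.side e.1 := by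
        intro e he hne
        by_contra hbe
        refine hne (hmem.1 ⟨memB.2 ⟨hbe, ?_⟩, he⟩)
        rcases he with h | h
        · rw [h, hιw]
        · rw [hbadι e hbe, h, hιw]
      have hx : ∀ f : ℤ × ℤ, (f.1 ≤ i ∧ i ≤ f.1 + 1) ∧ f.2 ≤ j ∧ j ≤ f.2 + 1 →
          gridVertex δ (i, j) ∈ puncturedFace δ v f := fun f hf =>
        ⟨(gridVertex_mem_gridFace hδ).2 hf, fun l h => hw l (gridVertex_injective hδ h)⟩
      have hx1 := hx (i - 1, j - 1) (by simp)
      have hx2 := hx (i, j - 1) (by simp)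
      have hx3 := hx (i, j) (by simp)
      have hx4 := hx (i - 1, j) (by simp)
      have g43 : ((i, j), false) ≠ e₀ → G (i - 1, j) (i, j) :=
        hgood ((i, j), false) (Or.inl rfl)
      have g12 : ((i, j - 1), false) ≠ e₀ → G (i - 1, j - 1) (i, j - 1) :=
        hgood ((i, j - 1), false) (Or.inr (by simp [GridEdge.tip]))
      have g23 : ((i, j), true) ≠ e₀ → G (i, j - 1) (i, j) :=
        hgood ((i, j), true) (Or.inl rfl)
      have g14 : ((i - 1, j), true) ≠ e₀ → G (i - 1, j - 1) (i - 1, j) :=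
        hgood ((i - 1, j), true) (Or.inr (by simp [GridEdge.tip]))
      refine (memB.1 h0B).1 ?_
      have E := R.equiv ⟨gridVertex δ (i, j), mem_puncturedSphere_of_mem_puncturedFace _ hx3⟩
      rcases GridEdge.eq_of_mem h0 with h | h | h | h
      · subst h
        refine Gof hx4 hx3 (E.trans (E.symm (g14 (by simp) _ hx1 hx4))
          (E.trans (g12 (by simp) _ hx1 hx2) (g23 (by simp) _ hx2 hx3)))
      · subst h
        refine Gof hx1 hx2 (E.trans (g14 (by simp) _ hx1 hx4)
          (E.trans (g43 (by simp; omega) _ hx4 hx3) (E.symm (g23 (by simp) _ hx2 hx3))))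
      · subst h
        refine Gof hx2 hx3 (E.trans (E.symm (g12 (by simp) _ hx1 hx2))
          (E.trans (g14 (by simp) _ hx1 hx4) (g43 (by simp) _ hx4 hx3)))
      · subst h
        refine Gof hx1 hx4 (E.trans (g12 (by simp) _ hx1 hx2)
          (E.trans (g23 (by simp; omega) _ hx2 hx3) (E.symm (g43 (by simp) _ hx4 hx3))))
    -- The exceptional vertex is the puncture with label `o`, unique by `hιv`; if there is none, any
    -- vertex serves.
    obtain ⟨v₀, hv₀⟩ : ∃ v₀, ∀ w ≠ v₀, (B.filter fun e => e.1 = w ∨ e.tip = w).card ≠ 1 := by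
      by_cases h : ∃ j, ι (v j) = o
      · obtain ⟨j, hj⟩ := h
        refine ⟨v j, fun w hw => ?_⟩
        by_cases h' : ∀ j', w ≠ v j'
        · exact hdeg2 w h'
        · push Not at h'
          obtain ⟨j', rfl⟩ := h'
          exact hdeg1 _ fun h => hw (hιv _ _ (h.trans hj.symm))
      · refine ⟨0, fun w _ => ?_⟩
        by_cases hw : ι w = o
        · exact hdeg2 w fun j hj => h ⟨j, hj ▸ hw⟩
        · exact hdeg1 w hw
    refine gridEdge_eq_empty B v₀ hv₀ fun w hw1 hw2 => ?_
    have hw : ∀ e : GridEdge, G e.side e.1 → w e.1 = w e.side := by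
      rintro ⟨⟨i, j⟩, k⟩ he
      cases k
      · exact hw1 i j fun h => (memB.1 h).1 he
      · exact hw2 i j fun h => (memB.1 h).1 he
    have hC' := hCconn w fun e h1 h2 => hw e (GC _ h1 _ h2)
    -- The vertical edges between a face and its anchor are good by `Gleft`, and the anchors are
    -- connected inside `C`. So the bad edges do not separate the faces.
    have hanchor : ∀ f, w f = w (g f, f.2) := by
      intro f
      have : ∀ k : ℕ, (k : ℤ) ≤ f.1 - g f → w f = w (f.1 - k, f.2) := by
        intro k
        induction k with
        | zero => simp
        | succ k ih =>
          intro hk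
          push_cast at hk
          rw [ih (by omega)]
          have h := hw ((f.1 - k, f.2), false)
            (Gleft (f.1 - k, f.2) (hg3 f _ (by omega) (by omega)))
          push_cast
          rw [← sub_sub]
          exact h
      have h := this (f.1 - g f).toNat (by have := hg1 f; omega)
      rwa [show f.1 - ((f.1 - g f).toNat : ℤ) = g f by have := hg1 f; omega] at h
    intro f f'
    rw [hanchor f, hanchor f']
    exact hC' _ (hg2 f) _ (hg2 f')
  have hall : ∀ e : GridEdge, G e.side e.1 := by
    intro e
    by_contra h
    have : e ∈ (hfin (ι e.1)).toFinset := (hfin _).mem_toFinset.2 ⟨h, rfl⟩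
    rw [hB] at this
    exact absurd this (Finset.notMem_empty e)
  have Gsymm : ∀ {f f'}, G f f' → G f' f := fun h x hx hx' => (R.equiv _).symm (h x hx' hx)
  have hallV : ∀ i i' j, i' ≤ i + 1 → i ≤ i' + 1 → G (i, j) (i', j) := by
    intro i i' j h1 h2
    obtain rfl | rfl | rfl : i' = i ∨ i' = i - 1 ∨ i' = i + 1 := by omega
    · exact fun x _ _ => (R.equiv _).refl _
    · exact Gsymm (hall ((i, j), false))
    · have := hall ((i + 1, j), false)
      simpa [GridEdge.side] using this
  have hallH : ∀ i j j', j' ≤ j + 1 → j ≤ j' + 1 → G (i, j) (i, j') := by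
    intro i j j' h1 h2
    obtain rfl | rfl | rfl : j' = j ∨ j' = j - 1 ∨ j' = j + 1 := by omega
    · exact fun x _ _ => (R.equiv _).refl _
    · exact Gsymm (hall ((i, j), true))
    · have := hall ((i, j + 1), true)
      simpa [GridEdge.side] using this
  refine R.total_of_faceClass hδ hC hPi hCP hRP a haC ?_ b c
  rintro ⟨i, j⟩ ⟨i', j'⟩ x hx hx'
  -- Faces that share only a corner are compared through a third face containing the same point.
  have hmid : x ∈ puncturedFace δ v (i', j) := ⟨⟨hx'.1.1, hx.1.2⟩, hx.2⟩
  have cmp : ∀ {i i' : ℤ} {u : ℝ}, i * δ ≤ u → u ≤ (i' + 1) * δ → i ≤ i' + 1 := by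
    intro i i' u h1 h2
    have h3 := le_of_mul_le_mul_right (h1.trans h2) hδ
    exact_mod_cast h3
  exact (R.equiv _).trans
    (hallV i i' j (cmp hx'.1.1.1 hx.1.1.2) (cmp hx.1.1.1 hx'.1.1.2) x hx hmid)
    (hallH i' j j' (cmp hx'.1.2.1 hx.1.2.2) (cmp hx.1.2.1 hx'.1.2.2) x hmid hx')

end GridContinuation

/-! ### Compact sets that do not separate the plane -/

section PlaneTopology

/-- The complement of the union of two disjoint closed subsets of the plane that do not separate
the plane is connected. -/
theorem isPreconnected_compl_union {A B : Set ℂ} (hA : IsClosed A) (hB : IsClosed B)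
    (hAB : Disjoint A B) (hA' : IsPreconnected Aᶜ) (hB' : IsPreconnected Bᶜ) :
    IsPreconnected (A ∪ B)ᶜ := by
  classical
  intro u v hu hv huv ⟨x, hxs, hxu⟩ ⟨y, hys, hyv⟩
  by_contra hne
  have hs : IsOpen (A ∪ B)ᶜ := (hA.union hB).isOpen_compl
  set G₁ := (A ∪ B)ᶜ ∩ u with hG₁
  set G₂ := (A ∪ B)ᶜ ∩ v with hG₂
  have hG₁o : IsOpen G₁ := hs.inter hu
  have hG₂o : IsOpen G₂ := hs.inter hv
  have hdisj : ∀ z ∈ G₂, z ∉ G₁ := fun z h2 h1 => hne ⟨z, h1.1, h1.2, h2.2⟩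
  -- Cut off to `G₁`, the function `ρ` is continuous away from `B` and `ρ - 1` is continuous away
  -- from `A`. They differ by integers, so `exp (2πi ·)` of either is one continuous map from the
  -- plane to the circle.
  obtain ⟨ρ, hρA, hρB, -⟩ := exists_continuous_zero_one_of_isClosed hA hB hAB
  have cont : ∀ (T : Set ℂ) (c : ℝ), (∀ z ∉ A ∪ B, z ∈ G₁ ∪ G₂) →
      (∀ z ∈ A ∪ B, z ∉ T → ρ z - c = 0) →
      ContinuousOn (fun z => if z ∈ G₁ then ρ z - c else 0) Tᶜ := by
    intro T c hcov hz z hzT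
    refine ContinuousAt.continuousWithinAt ?_
    by_cases hzAB : z ∈ A ∪ B
    · have h0 := hz z hzAB hzT
      have hzG : z ∉ G₁ := fun h => h.1 hzAB
      rw [ContinuousAt, if_neg hzG]
      have h1 : Tendsto (fun w => |ρ w - c|) (𝓝 z) (𝓝 0) := by
        have : ContinuousAt (fun w => |ρ w - c|) z := by fun_prop
        rwa [ContinuousAt, h0, abs_zero] at this
      refine squeeze_zero_norm (fun w => ?_) h1
      split_ifs with h
      · exact le_rfl
      · simp
    · rcases hcov z hzAB with h | h
      · refine ContinuousAt.congr (f := fun w => ρ w - c) (by fun_prop) ?_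
        filter_upwards [hG₁o.mem_nhds h] with w hw
        rw [if_pos hw]
      · refine ContinuousAt.congr (f := fun w => (0 : ℝ)) (by fun_prop) ?_
        filter_upwards [hG₂o.mem_nhds h] with w hw
        rw [if_neg (hdisj w hw)]
  have hcov : ∀ z ∉ A ∪ B, z ∈ G₁ ∪ G₂ := by
    intro z hz
    rcases huv hz with h | h
    · exact Or.inl ⟨hz, h⟩
    · exact Or.inr ⟨hz, h⟩
  have cB := cont B 0 hcov (by
    rintro z (h | h) hz
    · rw [hρA h]; simp
    · exact absurd h hz)
  have cA := cont A 1 hcov (by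
    rintro z (h | h) hz
    · exact absurd h hz
    · rw [hρB h]; simp)
  set gB : ℂ → ℝ := fun z => if z ∈ G₁ then ρ z - 0 else 0
  set gA : ℂ → ℝ := fun z => if z ∈ G₁ then ρ z - 1 else 0
  have hexp : ∀ z, Circle.exp (2 * Real.pi * gB z) = Circle.exp (2 * Real.pi * gA z) := by
    intro z
    simp only [gA, gB]
    split_ifs with h
    · rw [sub_zero, mul_sub, mul_one, Circle.exp_sub, Circle.exp_two_pi, div_one]
    · rfl
  have hF : Continuous fun z => Circle.exp (2 * Real.pi * gB z) := by
    rw [continuous_iff_continuousAt]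
    intro z
    by_cases hz : z ∈ B
    · have hzA : z ∈ Aᶜ := fun h => Set.disjoint_left.1 hAB h hz
      have h1 := (cA z hzA).continuousAt (hA.isOpen_compl.mem_nhds hzA)
      simp only [hexp]
      exact Circle.exp.continuous.continuousAt.comp (continuousAt_const.mul h1)
    · have h1 := (cB z hz).continuousAt (hB.isOpen_compl.mem_nhds hz)
      exact Circle.exp.continuous.continuousAt.comp (continuousAt_const.mul h1)
  -- The plane being simply connected, the map has a logarithm `h`. Then `h - 2π gB` and `h - 2π gA`
  -- have values in one fibre of `exp` and are constant on the connected sets `Bᶜ` and `Aᶜ`.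
  -- Comparing `x ∈ G₁` with `y ∈ G₂` gives `ρ x = ρ x - 1`.
  obtain ⟨e₀, he₀⟩ := Circle.exp_surjective (Circle.exp (2 * Real.pi * gB 0))
  obtain ⟨h, ⟨-, hh⟩, -⟩ := Circle.isCoveringMap_exp.existsUnique_continuousMap_lifts
    (⟨_, hF⟩ : C(ℂ, Circle)) 0 e₀ he₀
  have hh' : ∀ z, Circle.exp (h z) = Circle.exp (2 * Real.pi * gB z) := congrFun hh
  have e1 := Circle.isCoveringMap_exp.constOn_of_comp hB' (g := fun z => h z - 2 * Real.pi * gB z)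
    (h.continuous.continuousOn.sub (continuousOn_const.mul cB)) (by
      intro a _ a' _
      simp only [Circle.exp_sub, hh', div_self'])
    (a := x) (a' := y) (fun h => hxs (Or.inr h)) (fun h => hys (Or.inr h))
  have e2 := Circle.isCoveringMap_exp.constOn_of_comp hA' (g := fun z => h z - 2 * Real.pi * gA z)
    (h.continuous.continuousOn.sub (continuousOn_const.mul cA)) (by
      intro a _ a' _
      simp only [Circle.exp_sub, hh', hexp, div_self'])
    (a := x) (a' := y) (fun h => hxs (Or.inl h)) (fun h => hys (Or.inl h))
  have hxG : x ∈ G₁ := ⟨hxs, hxu⟩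
  have hyG : y ∉ G₁ := hdisj y ⟨hys, hyv⟩
  simp only [gA, gB, if_pos hxG, if_neg hyG] at e1 e2
  have := Real.pi_pos
  linarith

lemma isPreconnected_compl_iUnion {n : ℕ} {K : Fin n → Set ℂ} (hK : ∀ j, IsClosed (K j))
    (hdisj : ∀ i j, i ≠ j → Disjoint (K i) (K j)) (hc : ∀ j, IsPreconnected (K j)ᶜ) :
    IsPreconnected (⋃ j, K j)ᶜ := by
  classical
  have key : ∀ s : Finset (Fin n), IsPreconnected (⋃ j ∈ s, K j)ᶜ := by
    intro s
    induction s using Finset.induction_on with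
    | empty => simpa using isPreconnected_univ
    | insert j s hj ih =>
      rw [Finset.set_biUnion_insert]
      refine isPreconnected_compl_union (hK j) (s.finite_toSet.isClosed_biUnion fun i _ => hK i)
        ?_ (hc j) ih
      exact Set.disjoint_iUnion₂_right.2 fun i hi => hdisj j i fun h => hj (h ▸ hi)
  simpa using key Finset.univ

/-- Polar coordinates map a connected product onto this set; the case `r < 0`, where the ball is
empty, is included. -/
lemma isConnected_compl_closedBall (c : ℂ) (r : ℝ) : IsConnected (closedBall c r)ᶜ := by
  have h1 : IsConnected (Set.Ioi r ×ˢ (Set.univ : Set ℝ)) := isConnected_Ioi.prod isConnected_univ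
  have h2 := h1.image (fun p : ℝ × ℝ => c + p.1 * Complex.exp (p.2 * Complex.I)) (by fun_prop)
  convert! h2 using 1
  ext z
  simp only [Set.mem_compl_iff, mem_closedBall, not_le, Set.mem_image, Set.mem_prod, Set.mem_Ioi,
    Set.mem_univ, and_true, Prod.exists]
  constructor
  · intro h
    refine ⟨‖z - c‖, Complex.arg (z - c), by rwa [← dist_eq_norm], ?_⟩
    rw [Complex.norm_mul_exp_arg_mul_I]
    ring
  · rintro ⟨s, θ, hs, rfl⟩
    rw [dist_eq_norm, add_sub_cancel_left, norm_mul, Complex.norm_exp_ofReal_mul_I, mul_one,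
      Complex.norm_real, Real.norm_eq_abs]
    exact hs.trans_le (le_abs_self s)

/-- The points at some distance from a compact set that does not separate the plane can be connected
by paths at some distance from the set. -/
lemma exists_joinedIn_compl_cthickening {K : Set ℂ} (hK : IsCompact K) (hc : IsPreconnected Kᶜ)
    {ρ : ℝ} (hρ : 0 < ρ) :
    ∃ η > 0, ∃ q : ℂ, ∃ r : ℝ, 0 ≤ r ∧ q ∉ closedBall (0 : ℂ) r ∧ K ⊆ closedBall 0 r ∧
      q ∉ cthickening η K ∧ ∀ z ∉ thickening ρ K, JoinedIn (cthickening η K)ᶜ q z := by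
  obtain ⟨r, hr⟩ := hK.isBounded.subset_closedBall 0
  -- The margin `1` keeps thickenings of radius at most `1` inside the ball.
  set R := max r 0 + 1 with hR
  have hR0 : 0 ≤ R := by positivity
  have hfar : ∀ η ≤ 1, (closedBall (0 : ℂ) R)ᶜ ⊆ (cthickening η K)ᶜ := by
    intro η hη
    rw [Set.compl_subset_compl]
    refine (cthickening_mono hη K).trans ((cthickening_subset_of_subset 1 hr).trans ?_)
    rcases le_or_gt 0 r with h | h
    · rw [cthickening_closedBall zero_le_one h, hR, max_eq_left h, add_comm]
    · rw [closedBall_eq_empty.2 h]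
      simp
  obtain ⟨q, hq⟩ := (isConnected_compl_closedBall (0 : ℂ) R).nonempty
  have hKc : IsPathConnected Kᶜ := by
    rw [← hK.isClosed.isOpen_compl.isConnected_iff_isPathConnected]
    refine ⟨⟨q, fun h => hfar 1 le_rfl hq (self_subset_cthickening K h)⟩, hc⟩
  set O : ℕ → Set ℂ := fun m => pathComponentIn (cthickening (1 / (m + 1 : ℝ)) K)ᶜ q with hO
  have hpos : ∀ m : ℕ, (0 : ℝ) < 1 / (m + 1) := fun m => Nat.one_div_pos_of_nat
  have hle : ∀ m : ℕ, (1 : ℝ) / (m + 1) ≤ 1 := fun m => by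
    rw [div_le_one (by positivity)]
    linarith [(Nat.cast_nonneg m : (0 : ℝ) ≤ m)]
  have hqO : ∀ m : ℕ, q ∈ (cthickening (1 / (m + 1 : ℝ)) K)ᶜ := fun m => hfar _ (hle m) hq
  have hmono : ∀ m m' : ℕ, m ≤ m' → O m ⊆ O m' := by
    intro m m' h
    refine pathComponentIn_mono (Set.compl_subset_compl.2 (cthickening_mono ?_ K))
    exact Nat.one_div_le_one_div h
  have hcomp : IsCompact ((thickening ρ K)ᶜ ∩ closedBall (0 : ℂ) R) :=
    (isCompact_closedBall _ _).inter_left isOpen_thickening.isClosed_compl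
  -- A path that avoids `K` has positive distance from it, so the increasing open sets `O m` cover
  -- the complement of `K`. Compactness selects one `m`; points outside the large ball are joined to
  -- `q` there.
  obtain ⟨m, hm⟩ := hcomp.elim_directed_cover O
    (fun m => isClosed_cthickening.isOpen_compl.pathComponentIn q) (by
      rintro z ⟨hz, -⟩
      have hzK : z ∈ Kᶜ := fun h => hz (self_subset_thickening hρ K h)
      have hqK : q ∈ Kᶜ := fun h => hqO 0 (self_subset_cthickening K h)
      obtain ⟨γ, hγ⟩ := hKc.joinedIn q hqK z hzK
      have hd : Disjoint (Set.range γ) K := by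
        rw [Set.disjoint_left]
        rintro _ ⟨s, rfl⟩
        exact hγ s
      obtain ⟨ε, hε, hd'⟩ := hd.exists_cthickenings (isCompact_range γ.continuous) hK.isClosed
      obtain ⟨m, hm⟩ := exists_nat_one_div_lt hε
      refine Set.mem_iUnion.2 ⟨m, γ, fun s hs => ?_⟩
      exact Set.disjoint_left.1 hd' (self_subset_cthickening _ (Set.mem_range_self s))
        (cthickening_mono hm.le K hs))
    (directed_of_isDirected_le hmono)
  refine ⟨_, hpos m, q, R, hR0, hq, hr.trans (closedBall_subset_closedBall (by
    rw [hR]; linarith [le_max_left r 0])), hqO m, fun z hz => ?_⟩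
  by_cases hzR : z ∈ closedBall (0 : ℂ) R
  · exact hm ⟨hz, hzR⟩
  · exact (((isClosed_closedBall.isOpen_compl.isConnected_iff_isPathConnected).1
      (isConnected_compl_closedBall (0 : ℂ) R)).joinedIn q hq z hzR).mono (hfar _ (hle m))

end PlaneTopology

/-! ### From perforated to punctured spheres -/

section Perforation

variable {n : ℕ} {δ : ℝ}

/-- The ray from `∞` to `q`, a segment in the coordinate `1 / x`, stays outside the ball that
contains `K`. -/
lemma joinedIn_infty_of_joinedIn {K : Set ℂ} {q z : ℂ} {r : ℝ} (hr : 0 ≤ r)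
    (hq : q ∉ closedBall (0 : ℂ) r) (hK : K ⊆ closedBall 0 r) (hz : JoinedIn Kᶜ q z) :
    JoinedIn {x : OnePoint ℂ | x ∉ ((↑) : ℂ → OnePoint ℂ) '' K} ∞ z := by
  have hqr : r < ‖q‖ := by simpa using hq
  have hq0 : q ≠ 0 := by
    rintro rfl
    simp at hqr
    linarith
  have h1 : JoinedIn {x : OnePoint ℂ | x ∉ ((↑) : ℂ → OnePoint ℂ) '' K} ∞ q := by
    refine JoinedIn.ofLine (f := fun s : ℝ => fromInvCoord (s * q⁻¹))
      (continuous_fromInvCoord.comp (by fun_prop)).continuousOn (by simp) ?_ ?_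
    · simp only [Complex.ofReal_one, one_mul]
      rw [fromInvCoord_of_ne_zero (inv_ne_zero hq0), inv_inv]
    · rintro _ ⟨s, ⟨hs0, hs1⟩, rfl⟩
      rcases hs0.eq_or_lt with rfl | hs0
      · simp
      · have hs : (s : ℂ) * q⁻¹ ≠ 0 := mul_ne_zero (by exact_mod_cast hs0.ne') (inv_ne_zero hq0)
        rintro ⟨w, hw, e⟩
        simp only [fromInvCoord_of_ne_zero hs] at e
        have hw' := hK hw
        rw [OnePoint.coe_injective e, mem_closedBall, dist_zero_right, mul_inv, inv_inv, norm_mul,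
          norm_inv, Complex.norm_real, Real.norm_of_nonneg hs0.le] at hw'
        have : 1 ≤ s⁻¹ := (one_le_inv₀ hs0).2 hs1
        nlinarith [norm_nonneg q]
  refine h1.trans ((hz.map OnePoint.continuous_coe).mono ?_)
  rintro _ ⟨w, hw, rfl⟩ ⟨w', hw', e⟩
  exact hw (OnePoint.coe_injective e ▸ hw')

lemma dist_le_of_mem_gridFace {f : ℤ × ℤ} {z w : ℂ} (hz : z ∈ gridFace δ f)
    (hw : w ∈ gridFace δ f) : dist z w ≤ 2 * δ := by
  obtain ⟨⟨h1, h2⟩, h3, h4⟩ := hz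
  obtain ⟨⟨h1', h2'⟩, h3', h4'⟩ := hw
  rw [dist_eq_norm]
  have := Complex.norm_le_abs_re_add_abs_im (z - w)
  rw [Complex.sub_re, Complex.sub_im] at this
  have e1 : |z.re - w.re| ≤ δ := abs_le.2 ⟨by linarith, by linarith⟩
  have e2 : |z.im - w.im| ≤ δ := abs_le.2 ⟨by linarith, by linarith⟩
  linarith

/-- Two faces with a common edge, both in a given set. -/
def GridStep (A : Set (ℤ × ℤ)) (f f' : ℤ × ℤ) : Prop :=
  (∃ e : GridEdge, (e.side = f ∧ e.1 = f') ∨ (e.1 = f ∧ e.side = f')) ∧ f ∈ A ∧ f' ∈ A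

open Relation in
lemma reflTransGen_gridStep {A : Set (ℤ × ℤ)} {i j i' j' : ℤ} (h1 : (i, j) ∈ A) (h2 : (i', j) ∈ A)
    (h3 : (i', j') ∈ A) (hi : i ≤ i' + 1) (hi' : i' ≤ i + 1) (hj : j ≤ j' + 1) (hj' : j' ≤ j + 1) :
    ReflTransGen (GridStep A) (i, j) (i', j') := by
  have e1 : ReflTransGen (GridStep A) (i, j) (i', j) := by
    obtain rfl | rfl | rfl : i' = i ∨ i' = i - 1 ∨ i' = i + 1 := by omega
    · exact .refl
    · exact .single ⟨⟨((i, j), false), Or.inr ⟨rfl, rfl⟩⟩, h1, h2⟩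
    · exact .single ⟨⟨((i + 1, j), false), Or.inl ⟨by simp [GridEdge.side], rfl⟩⟩, h1, h2⟩
  have e2 : ReflTransGen (GridStep A) (i', j) (i', j') := by
    obtain rfl | rfl | rfl : j' = j ∨ j' = j - 1 ∨ j' = j + 1 := by omega
    · exact .refl
    · exact .single ⟨⟨((i', j), true), Or.inr ⟨rfl, rfl⟩⟩, h2, h3⟩
    · exact .single ⟨⟨((i', j + 1), true), Or.inl ⟨by simp [GridEdge.side], rfl⟩⟩, h2, h3⟩
  exact e1.trans e2

lemma floor_le_floor_add_one {x y : ℝ} (h : x < y + 1) : ⌊x⌋ ≤ ⌊y⌋ + 1 := by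
  have h1 := Int.floor_le x
  have h2 := Int.lt_floor_add_one y
  have : ((⌊x⌋ : ℤ) : ℝ) < ((⌊y⌋ + 2 : ℤ) : ℝ) := by push_cast; linarith
  have := Int.cast_lt.1 this
  omega

open Relation in
/-- The faces along a path are connected with each other by faces near the path. -/
lemma reflTransGen_faceOf (hδ : 0 < δ) {A : Set (ℤ × ℤ)} {q z : ℂ} (γ : Path q z)
    (hA : ∀ s f w, w ∈ gridFace δ f → dist w (γ s) ≤ δ → f ∈ A) :
    ReflTransGen (GridStep A) (faceOf δ q) (faceOf δ z) := by
  have key := unitInterval_induction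
    (Q := fun a b => ReflTransGen (GridStep A) (faceOf δ (γ a)) (faceOf δ (γ b)))
    (fun s => ?_) fun a b c h1 h2 => h1.trans h2
  · rwa [γ.source, γ.target] at key
  · refine ⟨γ ⁻¹' ball (γ s) (δ / 2),
      γ.continuous.continuousAt.preimage_mem_nhds (ball_mem_nhds _ (half_pos hδ)), ?_⟩
    intro a b hab h
    have hd : dist (γ a) (γ b) < δ := by
      have h1 := mem_ball.1 (h (Set.left_mem_Icc.2 hab))
      have h2 := mem_ball'.1 (h (Set.right_mem_Icc.2 hab))
      linarith [dist_triangle (γ a) (γ s) (γ b)]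
    rw [dist_eq_norm] at hd
    have hre := abs_lt.1 ((Complex.abs_re_le_norm (γ a - γ b)).trans_lt hd)
    have him := abs_lt.1 ((Complex.abs_im_le_norm (γ a - γ b)).trans_lt hd)
    rw [Complex.sub_re] at hre
    rw [Complex.sub_im] at him
    have ha := mem_gridFace_faceOf hδ (γ a)
    have hb := mem_gridFace_faceOf hδ (γ b)
    have hfl : ∀ {x y : ℝ}, x - y < δ → ⌊x / δ⌋ ≤ ⌊y / δ⌋ + 1 := fun {x y} h =>
      floor_le_floor_add_one (by rw [div_lt_iff₀ hδ, add_mul, div_mul_cancel₀ _ hδ.ne']; linarith)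
    -- The face indices of points at distance less than `δ` differ by at most one. A diagonal step
    -- passes through a third face, which is near the path because it contains the point with the
    -- real part of `γ b` and the imaginary part of `γ a`.
    refine reflTransGen_gridStep (hA a _ _ ha (by simpa using hδ.le))
      (hA a _ ⟨(γ b).re, (γ a).im⟩ ⟨hb.1, ha.2⟩ ?_) (hA b _ _ hb (by simpa using hδ.le))
      (hfl (by linarith)) (hfl (by linarith)) (hfl (by linarith)) (hfl (by linarith))
    rw [dist_eq_norm]
    refine (Complex.norm_le_abs_re_add_abs_im _).trans ?_
    simp only [Complex.sub_re, Complex.sub_im, sub_self, abs_zero, add_zero]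
    exact abs_le.2 ⟨by linarith, by linarith⟩

lemma finite_of_isBounded (hδ : 0 < δ) {B : Set ℂ} (hB : Bornology.IsBounded B) :
    {f | gridCenter δ f ∈ B}.Finite := by
  obtain ⟨M, hM⟩ := hB.subset_closedBall 0
  have key : ∀ (i : ℤ), |((i : ℝ) + 1 / 2) * δ| ≤ M → i ∈ Set.Icc (-⌈M / δ⌉ - 1) ⌈M / δ⌉ := by
    intro i hi
    rw [abs_mul, abs_of_pos hδ, ← le_div_iff₀ hδ] at hi
    have h1 := abs_le.1 hi
    have h2 := Int.le_ceil (M / δ)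
    constructor
    · have : ((-⌈M / δ⌉ - 1 : ℤ) : ℝ) ≤ i := by push_cast; linarith
      exact_mod_cast this
    · have : (i : ℝ) ≤ ⌈M / δ⌉ := by linarith
      exact_mod_cast this
  refine ((Set.finite_Icc (-⌈M / δ⌉ - 1) ⌈M / δ⌉).prod
    (Set.finite_Icc (-⌈M / δ⌉ - 1) ⌈M / δ⌉)).subset fun f hf => ?_
  have h := hM hf
  rw [mem_closedBall, dist_zero_right] at h
  exact ⟨key _ ((Complex.abs_re_le_norm _).trans h), key _ ((Complex.abs_im_le_norm _).trans h)⟩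

open Relation in
/-- Let `K j` be disjoint compact subsets of the plane that do not separate the plane. Arbitrarily
close to given inner points there are points `s j` of `K j` such that each relation between paths
from `∞` in the sphere without these points that relates the paths avoiding the `K j` is total. -/
theorem PathRel.exists_total {K : Fin n → Set ℂ} (hK : ∀ j, IsCompact (K j))
    (hdisj : ∀ i j, i ≠ j → Disjoint (K i) (K j)) (hc : ∀ j, IsPreconnected (K j)ᶜ)
    {t₀ : Fin n → ℂ} (ht₀ : ∀ j, t₀ j ∈ interior (K j)) {U : Set (Fin n → ℂ)} (hU : U ∈ 𝓝 t₀) :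
    ∃ s ∈ U, (∀ j, s j ∈ K j) ∧
      ∀ R : PathRel (⟨∞, infty_mem_puncturedSphere s⟩ : puncturedSphere s),
        (∀ x (α β : Path (⟨∞, infty_mem_puncturedSphere s⟩ : puncturedSphere s) x),
          (∀ u j, (α u : OnePoint ℂ) ∉ ((↑) : ℂ → OnePoint ℂ) '' K j) →
          (∀ u j, (β u : OnePoint ℂ) ∉ ((↑) : ℂ → OnePoint ℂ) '' K j) →
          R.r (.mk α) (.mk β)) →
        ∀ ⦃x : puncturedSphere s⦄
          (b c : Path.Homotopic.Quotient ⟨∞, infty_mem_puncturedSphere s⟩ x), R.r b c := by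
  obtain ⟨ρ, hρ, hρd⟩ : ∃ ρ > 0, ∀ i j, i ≠ j →
      Disjoint (thickening (2 * ρ) (K i)) (thickening (2 * ρ) (K j)) := by
    have h : ∀ᶠ ρ : ℝ in 𝓝[>] 0, ∀ i j, i ≠ j →
        Disjoint (thickening (2 * ρ) (K i)) (thickening (2 * ρ) (K j)) := by
      rw [eventually_all]
      intro i
      rw [eventually_all]
      intro j
      by_cases hij : i = j
      · exact Eventually.of_forall fun _ h => absurd hij h
      · obtain ⟨d, hd, h⟩ := (hdisj i j hij).exists_thickenings (hK i) (hK j).isClosed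
        filter_upwards [Ioo_mem_nhdsGT (half_pos hd)] with ρ hρ _
        exact h.mono (thickening_mono (by linarith [hρ.2]) _)
          (thickening_mono (by linarith [hρ.2]) _)
    obtain ⟨ρ, h, hρ⟩ := (h.and self_mem_nhdsWithin).exists
    exact ⟨ρ, hρ, h⟩
  set KK := ⋃ j, K j with hKK
  obtain ⟨η, hη, q, r, hr, hqr, hKr, hqη, hjoin⟩ := exists_joinedIn_compl_cthickening
    (isCompact_iUnion hK) (isPreconnected_compl_iUnion (fun j => (hK j).isClosed) hdisj hc) hρ
  obtain ⟨ε, hε, hball⟩ : ∃ ε > 0, ball t₀ ε ⊆ U ∩ {s | ∀ j, s j ∈ K j} := by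
    refine Metric.mem_nhds_iff.1 (inter_mem hU ?_)
    exact eventually_all.2 fun j =>
      (continuous_apply j).continuousAt.eventually (mem_interior_iff_mem_nhds.1 (ht₀ j))
  -- Faces have diameter at most `2 δ`. So a face within `δ` of a point off the `η`-thickening
  -- misses the `K_j`, a face whose centre is `ρ`-close to `K_j` lies in its `2 ρ`-thickening, and a
  -- corner of the face of `t₀ j` is `ε`-close to `t₀ j`.
  obtain ⟨δ, hδ, hδ1, hδ2, hδ3⟩ : ∃ δ > 0, 4 * δ < η ∧ 4 * δ < ρ ∧ 4 * δ < ε := by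
    refine ⟨min (min η ρ) ε / 8, by positivity, ?_, ?_, ?_⟩
    · have := (min_le_left (min η ρ) ε).trans (min_le_left η ρ)
      linarith
    · have := (min_le_left (min η ρ) ε).trans (min_le_right η ρ)
      linarith
    · have := min_le_right (min η ρ) ε
      linarith
  set v : Fin n → ℤ × ℤ := fun j => faceOf δ (t₀ j) with hv
  have hs : (fun j => gridVertex δ (v j)) ∈ ball t₀ ε := by
    rw [mem_ball, dist_pi_lt_iff hε]
    intro j
    refine (dist_le_of_mem_gridFace (f := v j) ?_ (mem_gridFace_faceOf hδ (t₀ j))).trans_lt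
      (by linarith)
    rw [gridVertex_mem_gridFace hδ]
    omega
  obtain ⟨hsU, hsK⟩ := hball hs
  refine ⟨_, hsU, hsK, fun R hR x b c => ?_⟩
  set A : Set (ℤ × ℤ) := {f | ∀ z ∈ gridFace δ f, z ∉ KK} with hA
  have hnear : ∀ z ∉ cthickening η KK, ∀ f w, w ∈ gridFace δ f → dist w z ≤ δ → f ∈ A := by
    intro z hz f w hw hwz k hk hkK
    refine hz (mem_cthickening_of_dist_le z k η KK hkK ?_)
    have h1 := dist_le_of_mem_gridFace hw hk
    rw [dist_comm] at hwz
    linarith [dist_triangle z w k]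
  -- The faces that can be reached from the face of `q` through faces missing all `K_j`, crossing
  -- one edge at a time.
  set C : Set (ℤ × ℤ) := {f | ReflTransGen (GridStep A) (faceOf δ q) f} with hCdef
  have hCA : ∀ f ∈ C, f ∈ A := by
    intro f hf
    rcases ReflTransGen.cases_tail hf with h | ⟨f', -, h⟩
    · rw [h]
      exact hnear q hqη _ q (mem_gridFace_faceOf hδ q) (by simpa using hδ.le)
    · exact h.2.2
  have hfar : ∀ z ∉ thickening ρ KK, faceOf δ z ∈ C := by
    intro z hz
    obtain ⟨γ, hγ⟩ := hjoin z hz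
    exact reflTransGen_faceOf hδ γ fun s f w hw hd => hnear _ (hγ s) f w hw hd
  have hcen : ∀ f, faceOf δ (gridCenter δ f) = f := by
    intro f
    have key : ∀ i : ℤ, ⌊((i : ℝ) + 1 / 2) * δ / δ⌋ = i := by
      intro i
      rw [mul_div_cancel_right₀ _ hδ.ne', Int.floor_eq_iff]
      constructor <;> linarith
    exact Prod.ext (key f.1) (key f.2)
  have hnotC : ∀ f ∉ C, gridCenter δ f ∈ thickening ρ KK := by
    intro f hf
    by_contra h
    have := hfar _ h
    rw [hcen] at this
    exact hf this
  have hcmem : ∀ f, gridCenter δ f ∈ gridFace δ f := fun f => by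
    have := mem_gridFace_faceOf hδ (gridCenter δ f)
    rwa [hcen] at this
  refine R.total_of_grid hδ (C := C) ?_ ?_ (P := {x | x ∉ ((↑) : ℂ → OnePoint ℂ) '' KK}) (by simp)
    ?_ ?_ ?_ (fun p => {j | gridVertex δ p ∈ thickening (2 * ρ) (K j)}) ?_ ?_ b c
  · refine (finite_of_isBounded hδ ((isCompact_iUnion hK).isBounded.thickening (δ := ρ))).subset ?_
    exact fun f hf => hnotC f hf
  · intro w hw
    have key : ∀ f ∈ C, w f = w (faceOf δ q) := by
      intro f hf
      induction hf with
      | refl => rfl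
      | @tail f f' h1 h2 ih =>
        have hfC : f ∈ C := h1
        have hfC' : f' ∈ C := h1.tail h2
        rw [← ih]
        obtain ⟨⟨e, ⟨rfl, rfl⟩ | ⟨rfl, rfl⟩⟩, -⟩ := h2
        · exact hw e hfC hfC'
        · exact (hw e hfC' hfC).symm
    exact fun f hf f' hf' => (key f hf).trans (key f' hf').symm
  · rintro f hf z hz ⟨z', hz', e⟩
    rw [OnePoint.coe_injective e] at hz'
    exact hCA f hf z hz hz'
  · intro f hf
    have hq : JoinedIn KKᶜ q (gridCenter δ f) := by
      have ho : IsOpen KKᶜ := (isCompact_iUnion hK).isClosed.isOpen_compl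
      have hqK : q ∈ KKᶜ := fun h => hqr (hKr h)
      exact (ho.isConnected_iff_isPathConnected.1 ⟨⟨q, hqK⟩, isPreconnected_compl_iUnion
        (fun j => (hK j).isClosed) hdisj hc⟩).joinedIn q hqK _ (hCA f hf _ (hcmem f))
    obtain ⟨γ, hγ⟩ := joinedIn_infty_of_joinedIn hr hqr hKr hq
    have hγ' : ∀ s, γ s ∈ puncturedSphere fun j => gridVertex δ (v j) := fun s j h =>
      hγ s ⟨_, Set.mem_iUnion.2 ⟨j, hsK j⟩, h.symm⟩
    exact ⟨pathIn γ hγ' _ _, hγ⟩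
  · refine fun x α β hα hβ => hR x α β (fun u j h => hα u ?_) fun u j h => hβ u ?_
    · exact Set.image_mono (Set.subset_iUnion K j) h
    · exact Set.image_mono (Set.subset_iUnion K j) h
  -- The centre of a face outside `C` is `ρ`-close to some `K_j`. The label of each corner is then
  -- exactly `{j}`, because the `2 ρ`-thickenings are disjoint.
  · have key : ∀ f ∉ C, ∃ j, ∀ p, gridVertex δ p ∈ gridFace δ f →
        {j | gridVertex δ p ∈ thickening (2 * ρ) (K j)} = {j} := by
      intro f hf
      have h := hnotC f hf
      rw [hKK, thickening_iUnion] at h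
      obtain ⟨j, hj⟩ := Set.mem_iUnion.1 h
      obtain ⟨k, hk, hd⟩ := mem_thickening_iff.1 hj
      refine ⟨j, fun p hp => ?_⟩
      have hpj : gridVertex δ p ∈ thickening (2 * ρ) (K j) := by
        refine mem_thickening_iff.2 ⟨k, hk, ?_⟩
        have := dist_le_of_mem_gridFace hp (hcmem f)
        linarith [dist_triangle (gridVertex δ p) (gridCenter δ f) k]
      ext i
      refine ⟨fun hi => ?_, fun hi => by rw [Set.mem_singleton_iff.1 hi]; exact hpj⟩
      by_contra hij
      exact Set.disjoint_left.1 (hρd i j hij) hi hpj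
    intro f hf p p' hp hp'
    obtain ⟨j, hj⟩ := key f hf
    exact (hj p hp).trans (hj p' hp').symm
  · intro j j' h
    have h1 : j ∈ {i | gridVertex δ (v j) ∈ thickening (2 * ρ) (K i)} :=
      self_subset_thickening (by linarith) _ (hsK j)
    have h2 : j' ∈ {i | gridVertex δ (v j') ∈ thickening (2 * ρ) (K i)} :=
      self_subset_thickening (by linarith) _ (hsK j')
    rw [h] at h1
    by_cases hij : j = j'
    · rw [hij]
    · exact absurd h2 (Set.disjoint_left.1 (hρd j j' hij) h1)

end Perforation

/-! ### Continuation along paths in the sphere for varying singular points -/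

section Continuation

variable {k n : ℕ}

lemma source_mem {x y : OnePoint ℂ} {α : Path x y} {S : Set (OnePoint ℂ)} (h : ∀ s, α s ∈ S) :
    x ∈ S := by
  simpa using h 0

lemma target_mem {x y : OnePoint ℂ} {α : Path x y} {S : Set (OnePoint ℂ)} (h : ∀ s, α s ∈ S) :
    y ∈ S := by
  simpa using h 1

open Classical in
/-- Parallel transport of the solutions of a Fuchsian system along a path in the sphere. It is
meaningful if the path avoids the singular points and `∞` is not singular. -/
noncomputable def continuation (t : Fin n → ℂ) (A : Fin n → Matrix (Fin k) (Fin k) ℂ)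
    {x y : OnePoint ℂ} (α : Path x y) : Matrix (Fin k) (Fin k) ℂ :=
  if h : (∑ j, A j = 0) ∧ ∀ s, α s ∈ puncturedSphere t then
    transport h.1 (.mk (pathIn α h.2 (source_mem h.2) (target_mem h.2)))
  else 0

variable {t : Fin n → ℂ} {A : Fin n → Matrix (Fin k) (Fin k) ℂ}

lemma continuation_eq (hA : ∑ j, A j = 0) {x y : OnePoint ℂ} {α : Path x y}
    (h : ∀ s, α s ∈ puncturedSphere t) (hx : x ∈ puncturedSphere t) (hy : y ∈ puncturedSphere t) :
    continuation t A α = transport hA (.mk (pathIn α h hx hy)) :=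
  dif_pos ⟨hA, h⟩

lemma continuation_cast {x y x' y' : OnePoint ℂ} (α : Path x y) (hx : x' = x) (hy : y' = y) :
    continuation t A (α.cast hx hy) = continuation t A α := by
  subst hx hy
  rfl

lemma continuation_refl (hA : ∑ j, A j = 0) {x : OnePoint ℂ} (hx : x ∈ puncturedSphere t) :
    continuation t A (Path.refl x) = 1 := by
  rw [continuation_eq hA (fun _ => hx) hx hx]
  exact transport_refl hA _

lemma continuation_trans (hA : ∑ j, A j = 0) {x y z : OnePoint ℂ} {α : Path x y} {β : Path y z}
    (hα : ∀ s, α s ∈ puncturedSphere t) (hβ : ∀ s, β s ∈ puncturedSphere t) :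
    continuation t A (α.trans β) = continuation t A β * continuation t A α := by
  rw [continuation_eq hA hα (source_mem hα) (target_mem hα),
    continuation_eq hA hβ (source_mem hβ) (target_mem hβ),
    continuation_eq hA (path_trans_mem hα hβ) (source_mem hα) (target_mem hβ), ← transport_trans,
    ← Path.Homotopic.Quotient.mk_trans]
  congr 2
  ext s
  simp only [pathIn, Path.trans_apply, Path.coe_mk', ContinuousMap.coe_mk]
  split_ifs <;> rfl

lemma continuation_subpath (hA : ∑ j, A j = 0) {x y : OnePoint ℂ} {α : Path x y}
    (hα : ∀ s, α s ∈ puncturedSphere t) (a b c : I) :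
    continuation t A (α.subpath a c) =
      continuation t A (α.subpath b c) * continuation t A (α.subpath a b) := by
  have h : ∀ a b s, α.subpath a b s ∈ puncturedSphere t := fun a b s => hα _
  rw [continuation_eq hA (h a c) (hα a) (hα c), continuation_eq hA (h b c) (hα b) (hα c),
    continuation_eq hA (h a b) (hα a) (hα b)]
  exact transport_subpath hA (pathIn α hα (source_mem hα) (target_mem hα)) a b c

lemma continuation_mul_symm (hA : ∑ j, A j = 0) {x y : OnePoint ℂ} {α : Path x y}
    (hα : ∀ s, α s ∈ puncturedSphere t) : continuation t A α * continuation t A α.symm = 1 := by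
  have hα' : ∀ s, α.symm s ∈ puncturedSphere t := fun s => hα _
  rw [← continuation_trans hA hα' hα,
    continuation_eq hA (path_trans_mem hα' hα) (target_mem hα) (target_mem hα)]
  have e : pathIn (α.symm.trans α) (path_trans_mem hα' hα) (target_mem hα) (target_mem hα) =
      (pathIn α hα (source_mem hα) (target_mem hα)).symm.trans
        (pathIn α hα (source_mem hα) (target_mem hα)) := by
    ext s
    simp only [pathIn, Path.trans_apply, Path.coe_mk', ContinuousMap.coe_mk]
    split_ifs <;> rfl
  rw [e, Path.Homotopic.Quotient.mk_trans, Path.Homotopic.Quotient.mk_symm,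
    Path.Homotopic.Quotient.symm_trans, transport_refl]

lemma isUnit_continuation (hA : ∑ j, A j = 0) {x y : OnePoint ℂ} {α : Path x y}
    (hα : ∀ s, α s ∈ puncturedSphere t) : IsUnit (continuation t A α) := by
  rw [continuation_eq hA hα (source_mem hα) (target_mem hα)]
  exact isUnit_transport hA _

lemma eventually_forall_mem_puncturedSphere {L : Set (OnePoint ℂ)} (hL : IsCompact L)
    (h : L ⊆ puncturedSphere t) : ∀ᶠ s in 𝓝 t, ∀ x ∈ L, x ∈ puncturedSphere s := by
  refine hL.eventually_forall_of_forall_eventually fun x hx => ?_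
  have ho : IsOpen {p : (Fin n → ℂ) × OnePoint ℂ | p.2 ∈ puncturedSphere p.1} := by
    have : {p : (Fin n → ℂ) × OnePoint ℂ | p.2 ∈ puncturedSphere p.1} =
        ⋂ j, {p | p.2 = (p.1 j : OnePoint ℂ)}ᶜ := by
      ext p
      simp [puncturedSphere]
    rw [this]
    refine isOpen_iInter_of_finite fun j => (isClosed_eq continuous_snd ?_).isOpen_compl
    exact OnePoint.continuous_coe.comp ((continuous_apply j).comp continuous_fst)
  exact ho.mem_nhds (h hx)

lemma eventually_path_mem {x y : OnePoint ℂ} {α : Path x y}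
    (hα : ∀ s, α s ∈ puncturedSphere t) : ∀ᶠ s in 𝓝 t, ∀ u, α u ∈ puncturedSphere s := by
  filter_upwards [eventually_forall_mem_puncturedSphere (isCompact_range α.continuous)
    (by rintro _ ⟨u, rfl⟩; exact hα u)] with s hs u
  exact hs _ (Set.mem_range_self u)

/-- Homotopic paths have the same continuation for all nearby singular points. -/
lemma eventually_continuation_eq {x y : puncturedSphere t} {α β : Path x y}
    (h : Path.Homotopic.Quotient.mk α = .mk β) :
    ∀ᶠ s in 𝓝 t, ∀ B : Fin n → Matrix (Fin k) (Fin k) ℂ, ∑ j, B j = 0 →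
      continuation s B (α.map continuous_subtype_val) =
        continuation s B (β.map continuous_subtype_val) := by
  obtain ⟨H⟩ := Path.Homotopic.Quotient.eq.1 h
  -- The image of the homotopy is compact, so it avoids the singular points for all nearby
  -- parameters and remains a homotopy there.
  have hc : Continuous fun p : I × I => (H p : OnePoint ℂ) :=
    continuous_subtype_val.comp H.continuous
  filter_upwards [eventually_forall_mem_puncturedSphere (isCompact_range hc)
    (by rintro _ ⟨p, rfl⟩; exact (H p).2)] with s hs B hB
  have hs' : ∀ p : I × I, (H p : OnePoint ℂ) ∈ puncturedSphere s := fun p =>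
    hs _ (Set.mem_range_self p)
  have hα : ∀ u, (α.map continuous_subtype_val) u ∈ puncturedSphere s := fun u => by
    have := hs' (0, u)
    rwa [H.apply_zero] at this
  have hβ : ∀ u, (β.map continuous_subtype_val) u ∈ puncturedSphere s := fun u => by
    have := hs' (1, u)
    rwa [H.apply_one] at this
  rw [continuation_eq hB hα (source_mem hα) (target_mem hα),
    continuation_eq hB hβ (source_mem hβ) (target_mem hβ)]
  congr 1
  refine Path.Homotopic.Quotient.eq.2 ⟨⟨⟨⟨fun p => ⟨H p, hs' p⟩, hc.subtype_mk _⟩, fun u => ?_,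
    fun u => ?_⟩, fun u v hv => ?_⟩⟩
  · have e : (H (0, u) : OnePoint ℂ) = α u := congrArg Subtype.val (H.apply_zero u)
    exact Subtype.ext e
  · have e : (H (1, u) : OnePoint ℂ) = β u := congrArg Subtype.val (H.apply_one u)
    exact Subtype.ext e
  · have e : (H (u, v) : OnePoint ℂ) = α v := congrArg Subtype.val (H.prop' u v hv)
    exact Subtype.ext e

lemma valueAlong_eq {Q : Fin n → (Fin n → ℂ) → Matrix (Fin k) (Fin k) ℂ} (hQ : ∑ j, Q j t = 0)
    {x : OnePoint ℂ} (α : Path ∞ x) : valueAlong Q α t = continuation t (fun j => Q j t) α := by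
  by_cases h : ∀ s, α s ∈ puncturedSphere t
  · rw [valueAlong, dif_pos h, normalizedSolution_eq hQ,
      continuation_eq hQ h (source_mem h) (target_mem h)]
    rfl
  · rw [valueAlong, dif_neg h, continuation, dif_neg fun h' => h h'.2]

end Continuation

/-! ### Analytic dependence on the parameter and logarithmic derivatives -/

section Family

variable {k n : ℕ} {t : ℂ → Fin n → ℂ} {A : ℂ → Fin n → Matrix (Fin k) (Fin k) ℂ} {l : ℂ}

lemma IsParametricSolution.continuation_eq {U : Set (OnePoint ℂ)} {N : Set ℂ}
    {Φ : OnePoint ℂ → ℂ → Matrix (Fin k) (Fin k) ℂ} (h : IsParametricSolution t A l U N Φ)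
    {μ : ℂ} (hμ : μ ∈ N) (hA : ∑ j, A μ j = 0) {x y : OnePoint ℂ} {β : Path x y}
    (hβ : ∀ s, β s ∈ U) :
    continuation (t μ) (A μ) β = Φ y μ * Ring.inverse (Φ x μ) := by
  have hβ' : ∀ s, β s ∈ puncturedSphere (t μ) := fun s => h.subset μ hμ (hβ s)
  rw [Fuchsian.continuation_eq hA hβ' (source_mem hβ') (target_mem hβ')]
  exact transport_eq_of_isLocalSolution hA h.isOpen (h.isLocalSolution μ hμ) (h.isUnit μ hμ) _ hβ

lemma analyticAt_ringInverse {f : ℂ → Matrix (Fin k) (Fin k) ℂ} (hf : AnalyticAt ℂ f l)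
    (hu : IsUnit (f l)) : AnalyticAt ℂ (fun μ => Ring.inverse (f μ)) l := by
  obtain ⟨u, hu⟩ := hu
  have h1 : AnalyticAt ℂ (Ring.inverse : Matrix (Fin k) (Fin k) ℂ → _) (f l) :=
    hu ▸ analyticAt_inverse u
  exact h1.comp hf

lemma eventually_path_mem_family (ht : ∀ j, AnalyticAt ℂ (fun μ => t μ j) l) {x y : OnePoint ℂ}
    {α : Path x y} (hα : ∀ s, α s ∈ puncturedSphere (t l)) :
    ∀ᶠ μ in 𝓝 l, ∀ s, α s ∈ puncturedSphere (t μ) :=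
  (tendsto_pi_nhds.2 fun j => (ht j).continuousAt).eventually (eventually_path_mem hα)

/-- Continuation along a fixed path depends analytically on the parameters. -/
theorem analyticAt_continuation (ht : ∀ j, AnalyticAt ℂ (fun μ => t μ j) l)
    (hA : ∀ j, AnalyticAt ℂ (fun μ => A μ j) l) (hsum : ∀ᶠ μ in 𝓝 l, ∑ j, A μ j = 0)
    {x y : OnePoint ℂ} {α : Path x y} (hα : ∀ s, α s ∈ puncturedSphere (t l)) :
    AnalyticAt ℂ (fun μ => continuation (t μ) (A μ) α) l := by
  -- On a short piece the continuation is a quotient of two values of a parametric fundamental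
  -- solution; the continuation along the path is a product of such quotients.
  have key := unitInterval_induction
    (Q := fun a b => AnalyticAt ℂ (fun μ => continuation (t μ) (A μ) (α.subpath a b)) l)
    (fun s => ?_) fun a b c h1 h2 => ?_
  · simpa only [Path.subpath_zero_one, continuation_cast] using key
  · obtain ⟨U, N, Φ, hs, h⟩ := exists_isParametricSolution ht hA hsum (hα s)
    refine ⟨α ⁻¹' U, α.continuous.continuousAt.preimage_mem_nhds (h.isOpen.mem_nhds hs),
      fun a b hab hU => ?_⟩
    have hβ : ∀ u, α.subpath a b u ∈ U := fun u => by
      obtain ⟨v, hv, e⟩ := α.subpath_mem_image hab u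
      rw [← e]
      exact hU hv
    have hl := mem_of_mem_nhds h.mem_nhds
    have h1 := (h.analyticAt l hl _ (target_mem hβ)).mul (analyticAt_ringInverse
      (h.analyticAt l hl _ (source_mem hβ)) (h.isUnit l hl _ (source_mem hβ)))
    refine h1.congr ?_
    filter_upwards [h.mem_nhds, hsum] with μ hμ hμA
    exact (h.continuation_eq hμ hμA hβ).symm
  · refine (h2.mul h1).congr ?_
    filter_upwards [eventually_path_mem_family ht hα, hsum] with μ hμ hμA
    exact (continuation_subpath hμA hμ a b c).symm

lemma isPathConnected_puncturedSphere (s : Fin n → ℂ) : IsPathConnected (puncturedSphere s) := by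
  refine ⟨∞, infty_mem_puncturedSphere s, ?_⟩
  intro x hx
  have hc : IsPathConnected (Set.range s)ᶜ :=
    (Set.finite_range s).countable.isPathConnected_compl_of_one_lt_rank
      (by rw [Complex.rank_real_complex]; exact Nat.one_lt_ofNat)
  obtain ⟨r, hr⟩ := (Set.finite_range s).isBounded.subset_closedBall 0
  obtain ⟨q, hq⟩ := (isConnected_compl_closedBall 0 (max r 0)).nonempty
  have hr' : Set.range s ⊆ closedBall 0 (max r 0) :=
    hr.trans (closedBall_subset_closedBall (le_max_left _ _))
  induction x using OnePoint.rec with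
  | infty => exact JoinedIn.refl (infty_mem_puncturedSphere s)
  | coe z =>
    refine (joinedIn_infty_of_joinedIn (le_max_right r 0) hq hr'
      (hc.joinedIn q (fun h => hq (hr' h)) z ?_)).mono fun x hx j h => ?_
    · rintro ⟨j, rfl⟩
      exact hx j rfl
    · exact hx ⟨s j, Set.mem_range_self j, h.symm⟩

/-- The logarithmic derivative of the continuation with respect to the parameter. -/
noncomputable def logDerivContinuation (t : ℂ → Fin n → ℂ)
    (A : ℂ → Fin n → Matrix (Fin k) (Fin k) ℂ) (l : ℂ) {x y : OnePoint ℂ} (α : Path x y) :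
    Matrix (Fin k) (Fin k) ℂ :=
  deriv (fun μ => continuation (t μ) (A μ) α) l * Ring.inverse (continuation (t l) (A l) α)

/-- A right factor that does not depend on the parameter cancels in `(Y C)' (Y C)⁻¹`. -/
lemma logDerivContinuation_eq_of_eventually_mul (ht : ∀ j, AnalyticAt ℂ (fun μ => t μ j) l)
    (hA : ∀ j, AnalyticAt ℂ (fun μ => A μ j) l) (hsum : ∀ᶠ μ in 𝓝 l, ∑ j, A μ j = 0)
    {x y : OnePoint ℂ} {α β : Path x y} (hα : ∀ s, α s ∈ puncturedSphere (t l))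
    (hβ : ∀ s, β s ∈ puncturedSphere (t l)) {C : Matrix (Fin k) (Fin k) ℂ}
    (h : ∀ᶠ μ in 𝓝 l, continuation (t μ) (A μ) α = continuation (t μ) (A μ) β * C) :
    logDerivContinuation t A l α = logDerivContinuation t A l β := by
  have hAl := hsum.self_of_nhds
  have hl := h.self_of_nhds
  have huα := isUnit_continuation hAl hα
  have huβ := isUnit_continuation hAl hβ
  have hC : IsUnit C := by
    have : C = Ring.inverse (continuation (t l) (A l) β) * continuation (t l) (A l) α := by
      rw [hl, Ring.inverse_mul_cancel_left _ _ huβ]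
    rw [this]
    exact huβ.ringInverse.mul huα
  have hd := (analyticAt_continuation ht hA hsum hβ).differentiableAt.hasDerivAt.mul_const C
  have hd' : deriv (fun μ => continuation (t μ) (A μ) α) l =
      deriv (fun μ => continuation (t μ) (A μ) β) l * C :=
    (hd.congr_of_eventuallyEq h).deriv
  rw [logDerivContinuation, logDerivContinuation, hd', hl, ringInverse_mul huβ hC, mul_assoc,
    Ring.mul_inverse_cancel_left _ _ hC]

lemma hasDerivAt_continuation (ht : ∀ j, AnalyticAt ℂ (fun μ => t μ j) l)
    (hA : ∀ j, AnalyticAt ℂ (fun μ => A μ j) l) (hsum : ∀ᶠ μ in 𝓝 l, ∑ j, A μ j = 0)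
    {x y : OnePoint ℂ} {α : Path x y} (hα : ∀ s, α s ∈ puncturedSphere (t l)) :
    HasDerivAt (fun μ => continuation (t μ) (A μ) α)
      (logDerivContinuation t A l α * continuation (t l) (A l) α) l := by
  rw [logDerivContinuation, Ring.inverse_mul_cancel_right _ _
    (isUnit_continuation hsum.self_of_nhds hα)]
  exact (analyticAt_continuation ht hA hsum hα).differentiableAt.hasDerivAt

/-- If the logarithmic derivative with respect to the parameter does not depend on the path, then it
is a holomorphic function on the punctured sphere. -/
theorem exists_holomorphicOnSphere_logDeriv (ht : ∀ j, AnalyticAt ℂ (fun μ => t μ j) l)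
    (hA : ∀ j, AnalyticAt ℂ (fun μ => A μ j) l) (hsum : ∀ᶠ μ in 𝓝 l, ∑ j, A μ j = 0)
    (h : ∀ (x : OnePoint ℂ) (α β : Path ∞ x), (∀ s, α s ∈ puncturedSphere (t l)) →
      (∀ s, β s ∈ puncturedSphere (t l)) →
      logDerivContinuation t A l α = logDerivContinuation t A l β) :
    ∃ T : OnePoint ℂ → Matrix (Fin k) (Fin k) ℂ, HolomorphicOnSphere T (puncturedSphere (t l)) ∧
      ∀ (x : OnePoint ℂ) (α : Path ∞ x), (∀ s, α s ∈ puncturedSphere (t l)) →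
        T x = logDerivContinuation t A l α := by
  classical
  have hAl := hsum.self_of_nhds
  obtain ⟨T, hT⟩ : ∃ T : OnePoint ℂ → Matrix (Fin k) (Fin k) ℂ, ∀ (x : OnePoint ℂ) (α : Path ∞ x),
      (∀ s, α s ∈ puncturedSphere (t l)) → T x = logDerivContinuation t A l α := by
    refine ⟨fun x => if hx : ∃ α : Path ∞ x, ∀ s, α s ∈ puncturedSphere (t l) then
      logDerivContinuation t A l hx.choose else 0, fun x α hα => ?_⟩
    have hx : ∃ α : Path ∞ x, ∀ s, α s ∈ puncturedSphere (t l) := ⟨α, hα⟩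
    exact (dif_pos hx).trans (h x _ α hx.choose_spec hα)
  have loc : ∀ x ∈ puncturedSphere (t l), ∃ (U : Set (OnePoint ℂ))
      (F : OnePoint ℂ → Matrix (Fin k) (Fin k) ℂ), IsOpen U ∧ x ∈ U ∧ HolomorphicOnSphere F U ∧
      ∀ y ∈ U, T y = F y := by
    intro x hx
    obtain ⟨U, N, Φ, hxU, hΦ⟩ := exists_isParametricSolution ht hA hsum hx
    obtain ⟨α, hα⟩ := (isPathConnected_puncturedSphere (t l)).joinedIn ∞
      (infty_mem_puncturedSphere _) x hx
    have hl := mem_of_mem_nhds hΦ.mem_nhds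
    -- Continuation along `α` and then inside `U` to `y` is `Φ y μ * c μ`, with `c` free of `y`. The
    -- product rule expresses the logarithmic derivative through functions holomorphic in `y`.
    set c : ℂ → Matrix (Fin k) (Fin k) ℂ := fun μ =>
      Ring.inverse (Φ x μ) * continuation (t μ) (A μ) α with hc
    have hcd : AnalyticAt ℂ c l :=
      (analyticAt_ringInverse (hΦ.analyticAt l hl x hxU) (hΦ.isUnit l hl x hxU)).mul
        (analyticAt_continuation ht hA hsum hα)
    have hcu : IsUnit (c l) :=
      (hΦ.isUnit l hl x hxU).ringInverse.mul (isUnit_continuation hAl hα)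
    refine ⟨U, fun y => (deriv (Φ y) l * c l + Φ y l * deriv c l) *
      (Ring.inverse (c l) * Ring.inverse (Φ y l)), hΦ.isOpen, hxU, ⟨fun z hz => ?_, fun hz => ?_⟩,
      fun y hy => ?_⟩
    · have h1 := hΦ.holomorphic_deriv.1 z hz
      have h2 := (hΦ.isLocalSolution l hl).1.1 z hz
      exact ((h1.mul_const _).add (h2.mul_const _)).mul
        ((differentiableAt_inverse_comp h2 (hΦ.isUnit l hl _ hz)).const_mul _)
    · have h1 := hΦ.holomorphic_deriv.2 hz
      have h2 := (hΦ.isLocalSolution l hl).1.2 hz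
      exact ((h1.mul_const _).add (h2.mul_const _)).mul
        ((differentiableAt_inverse_comp h2
          (by simpa using hΦ.isUnit l hl _ hz)).const_mul _)
    · obtain ⟨β, hβ⟩ := hΦ.isPathConnected.joinedIn x hxU y hy
      have hβ' : ∀ s, β s ∈ puncturedSphere (t l) := fun s => hΦ.subset l hl (hβ s)
      have he : ∀ᶠ μ in 𝓝 l, continuation (t μ) (A μ) (α.trans β) = Φ y μ * c μ := by
        filter_upwards [eventually_path_mem_family ht hα, eventually_path_mem_family ht hβ',
          hΦ.mem_nhds, hsum] with μ h1 h2 h3 h4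
        rw [continuation_trans h4 h1 h2, hΦ.continuation_eq h3 h4 hβ, hc, mul_assoc]
      have hd := (hΦ.analyticAt l hl y hy).differentiableAt.hasDerivAt.mul
        hcd.differentiableAt.hasDerivAt
      have hd' : deriv (fun μ => continuation (t μ) (A μ) (α.trans β)) l =
          deriv (Φ y) l * c l + Φ y l * deriv c l := (hd.congr_of_eventuallyEq he).deriv
      rw [hT y (α.trans β) (path_trans_mem hα hβ'), logDerivContinuation, hd', he.self_of_nhds,
        ringInverse_mul (hΦ.isUnit l hl y hy) hcu]
  refine ⟨T, ⟨fun z hz => ?_, fun hz => ?_⟩, hT⟩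
  · obtain ⟨U, F, hU, hzU, hF, hTF⟩ := loc z hz
    refine (hF.1 z hzU).congr_of_eventuallyEq ?_
    filter_upwards [OnePoint.continuous_coe.continuousAt.preimage_mem_nhds (hU.mem_nhds hzU)]
      with y hy
    exact hTF y hy
  · obtain ⟨U, F, hU, hzU, hF, hTF⟩ := loc ∞ hz
    refine (hF.2 hzU).congr_of_eventuallyEq ?_
    have hmem : U ∈ 𝓝 (fromInvCoord 0) := by
      rw [fromInvCoord_zero]
      exact hU.mem_nhds hzU
    filter_upwards [continuous_fromInvCoord.continuousAt.preimage_mem_nhds hmem] with y hy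
    exact hTF _ hy

end Family

/-- The coordinates are changed one at a time, which does not leave the product; the induction is
over the set of coordinates in which the points may differ. -/
lemma eq_of_hasDerivAt_update_zero {n : ℕ} {E : Type*} [NormedAddCommGroup E] [NormedSpace ℂ E]
    {f : (Fin n → ℂ) → E} {W : Fin n → Set ℂ} (hW : ∀ j, IsOpen (W j))
    (hWc : ∀ j, IsPreconnected (W j))
    (hf : ∀ t ∈ Set.univ.pi W, ∀ j, HasDerivAt (fun τ => f (Function.update t j τ)) 0 (t j))
    {t' t'' : Fin n → ℂ} (ht' : t' ∈ Set.univ.pi W) (ht'' : t'' ∈ Set.univ.pi W) : f t' = f t'' := by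
  classical
  have key : ∀ (s : Finset (Fin n)) (t : Fin n → ℂ), t ∈ Set.univ.pi W → (∀ j ∉ s, t j = t'' j) →
      f t = f t'' := by
    intro s
    induction s using Finset.induction_on with
    | empty =>
      intro t _ h
      rw [funext fun j => h j (Finset.notMem_empty j)]
    | insert j s hj ih =>
      intro t ht h
      have hup : ∀ τ ∈ W j, Function.update t j τ ∈ Set.univ.pi W := by
        intro τ hτ i _
        by_cases hij : i = j
        · subst hij
          simpa using hτ
        · rw [Function.update_of_ne hij]
          exact ht i trivial
      have hd : ∀ τ ∈ W j, HasDerivAt (fun τ => f (Function.update t j τ)) 0 τ := by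
        intro τ hτ
        have := hf _ (hup τ hτ) j
        simpa using this
      have h1 := (hW j).is_const_of_deriv_eq_zero (hWc j)
        (fun τ hτ => (hd τ hτ).differentiableAt.differentiableWithinAt)
        (fun τ hτ => (hd τ hτ).deriv) (ht j trivial) (ht'' j trivial)
      simp only [Function.update_eq_self] at h1
      rw [h1]
      refine ih _ (hup _ (ht'' j trivial)) fun i hi => ?_
      by_cases hij : i = j
      · subst hij
        simp
      · rw [Function.update_of_ne hij]
        exact h i (by simp [hij, hi])
  exact key Finset.univ t' ht' fun j hj => absurd (Finset.mem_univ j) hj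

/-! ### The two implications -/

section Deformation

variable {n k : ℕ} {D : Set (Fin n → ℂ)} {Q : Fin n → (Fin n → ℂ) → Matrix (Fin k) (Fin k) ℂ}

lemma analyticAt_comp_of_differentiable (hD : IsOpen D) (hQ : ∀ j, DifferentiableOn ℂ (Q j) D)
    {f : ℂ → Fin n → ℂ} (hf : Differentiable ℂ f) {l : ℂ} (hl : f l ∈ D) (j : Fin n) :
    AnalyticAt ℂ (fun μ => Q j (f μ)) l := by
  have h1 : DifferentiableOn ℂ (fun μ => Q j (f μ)) (f ⁻¹' D) :=
    (hQ j).comp hf.differentiableOn fun _ h => h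
  exact h1.analyticAt ((hD.preimage hf.continuous).mem_nhds hl)

lemma analyticAt_coord {f : ℂ → Fin n → ℂ} (hf : Differentiable ℂ f) (l : ℂ) (j : Fin n) :
    AnalyticAt ℂ (fun μ => f μ j) l :=
  (differentiable_pi.1 hf j).analyticAt l

lemma eventually_sum_eq_zero (hD : IsOpen D) (hsum : ∀ t ∈ D, ∑ j, Q j t = 0)
    {f : ℂ → Fin n → ℂ} (hf : Differentiable ℂ f) {l : ℂ} (hl : f l ∈ D) :
    ∀ᶠ μ in 𝓝 l, ∑ j, Q j (f μ) = 0 := by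
  filter_upwards [(hD.preimage hf.continuous).mem_nhds hl] with μ hμ
  exact hsum _ hμ

lemma differentiable_update (t : Fin n → ℂ) (j : Fin n) :
    Differentiable ℂ fun τ : ℂ => Function.update t j τ := by
  rw [differentiable_pi]
  intro i
  by_cases h : i = j
  · subst h
    simp only [Function.update_self]
    exact differentiable_id
  · simp [Function.update_of_ne h]

lemma isMonodromyMatrix_loopClass_iff {t : Fin n → ℂ} (hQt : ∑ j, Q j t = 0)
    {γ : Path (∞ : OnePoint ℂ) ∞} (hγ : ∀ s, γ s ∈ puncturedSphere t)
    {M : Matrix (Fin k) (Fin k) ℂ} :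
    IsMonodromyMatrix (normalizedSolution t fun j => Q j t) (loopClass t γ hγ) M ↔
      M = continuation t (fun j => Q j t) γ := by
  rw [isMonodromyMatrix_iff hQt, continuation_eq hQt hγ (source_mem hγ) (target_mem hγ)]
  rfl

/-- At `∞` along the constant path `Y` is identically `1`, so `T j ∞ t = 0`. Single-valuedness of
`T` carries this to the end of every loop, so the monodromy has zero partial derivatives on a
polydisc. -/
theorem isIsomonodromic_of_satisfiesAuxiliarySystem (hD : IsOpen D)
    (hsum : ∀ t ∈ D, ∑ j, Q j t = 0) (h : SatisfiesAuxiliarySystem D Q) : IsIsomonodromic D Q := by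
  obtain ⟨T, -, -, hT⟩ := h
  have hval : ∀ t ∈ D, valueAlong Q (Path.refl ∞) t = 1 := fun t ht => by
    rw [valueAlong_eq (hsum t ht),
      continuation_refl (A := fun j => Q j t) (hsum t ht) (infty_mem_puncturedSphere t)]
  have hT0 : ∀ t ∈ D, ∀ j, T j ∞ t = 0 := by
    intro t ht j
    have h1 := hT t ht ∞ (Path.refl ∞) (fun _ => infty_mem_puncturedSphere t) j
    rw [hval t ht, mul_one] at h1
    have hl : Function.update t j (t j) ∈ D := by rwa [Function.update_eq_self]
    refine h1.unique ((hasDerivAt_const (t j) (1 : Matrix (Fin k) (Fin k) ℂ)).congr_of_eventuallyEq ?_)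
    filter_upwards [(hD.preimage (differentiable_update t j).continuous).mem_nhds hl] with τ hτ
    exact hval _ hτ
  intro t₀ ht₀
  obtain ⟨r, hr, hrD⟩ := Metric.nhds_basis_closedBall.mem_iff.1 (hD.mem_nhds ht₀)
  have hpi : Set.univ.pi (fun j => ball (t₀ j) r) = ball t₀ r := (ball_pi t₀ hr).symm
  have hcl : closure (Set.univ.pi fun j => ball (t₀ j) r) ⊆ closedBall t₀ r := by
    rw [hpi]
    exact closure_ball_subset_closedBall
  refine ⟨fun j => ball (t₀ j) r, ⟨fun j => mem_ball_self hr, fun j => isOpen_ball, fun j => ?_,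
    fun j => ?_⟩, (isCompact_closedBall t₀ r).of_isClosed_subset isClosed_closure hcl,
    hcl.trans hrD, fun γ hγ t' t'' ht' ht'' => ?_⟩
  · have := (convex_ball (t₀ j) r).contractibleSpace ⟨t₀ j, mem_ball_self hr⟩
    exact (inferInstance : SimplyConnectedSpace (ball (t₀ j) r))
  · rw [closure_ball _ hr.ne']
    exact isConnected_compl_closedBall (t₀ j) r
  · have hWD : Set.univ.pi (fun j => ball (t₀ j) r) ⊆ D := subset_closure.trans (hcl.trans hrD)
    have hconst : valueAlong Q γ t' = valueAlong Q γ t'' := by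
      refine eq_of_hasDerivAt_update_zero (f := valueAlong Q γ) (W := fun j => ball (t₀ j) r)
        (fun j => isOpen_ball) (fun j => (convex_ball _ _).isPreconnected) (fun t ht j => ?_) ht' ht''
      have h1 := hT t (hWD ht) ∞ γ (fun s => perforatedSphere_subset ht (hγ s)) j
      rwa [hT0 t (hWD ht), zero_mul] at h1
    refine ⟨valueAlong Q γ t', ?_, ?_⟩
    · rw [isMonodromyMatrix_loopClass_iff (hsum t' (hWD ht')), valueAlong_eq (hsum t' (hWD ht'))]
    · rw [hconst, isMonodromyMatrix_loopClass_iff (hsum t'' (hWD ht'')),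
        valueAlong_eq (hsum t'' (hWD ht''))]

/-- The continuations along the paths in a punctured sphere from `∞` agree near the parameter `s` up
to a constant factor. -/
noncomputable def continuationRel (hD : IsOpen D) (hsum : ∀ t ∈ D, ∑ j, Q j t = 0) {s : Fin n → ℂ}
    (hs : s ∈ D) :
    PathRel (⟨∞, infty_mem_puncturedSphere s⟩ : puncturedSphere s) where
  -- For `u ≠ s` continuation is defined along paths and not on classes in the sphere punctured at
  -- `s`. Two representatives of a class agree only for `u` near `s`, hence the germs.
  r x a b := ∀ α β : Path (⟨∞, infty_mem_puncturedSphere s⟩ : puncturedSphere s) x,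
    .mk α = a → .mk β = b → ∃ C : Matrix (Fin k) (Fin k) ℂ, IsUnit C ∧ ∀ᶠ u in 𝓝 s,
      continuation u (fun j => Q j u) (α.map continuous_subtype_val) =
        continuation u (fun j => Q j u) (β.map continuous_subtype_val) * C
  equiv x := by
    refine ⟨fun a α β hα hβ => ⟨1, isUnit_one, ?_⟩, fun {a b} h α β hα hβ => ?_,
      fun {a b c} h1 h2 α β hα hβ => ?_⟩
    · filter_upwards [eventually_continuation_eq (k := k) (hα.trans hβ.symm), hD.mem_nhds hs]
        with u hu huD
      rw [mul_one, hu _ (hsum u huD)]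
    · obtain ⟨C, hC, h'⟩ := h β α hβ hα
      refine ⟨Ring.inverse C, hC.ringInverse, h'.mono fun u hu => ?_⟩
      rw [hu, Ring.mul_inverse_cancel_right _ _ hC]
    · obtain ⟨γ, hγ⟩ := Path.Homotopic.Quotient.mk_surjective b
      obtain ⟨C, hC, h1'⟩ := h1 α γ hα hγ
      obtain ⟨C', hC', h2'⟩ := h2 γ β hγ hβ
      refine ⟨C' * C, hC'.mul hC, (h1'.and h2').mono fun u hu => ?_⟩
      rw [hu.1, hu.2, mul_assoc]
  comp x y a b h c α β hα hβ := by
    obtain ⟨α₀, hα₀⟩ := Path.Homotopic.Quotient.mk_surjective a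
    obtain ⟨β₀, hβ₀⟩ := Path.Homotopic.Quotient.mk_surjective b
    obtain ⟨κ, hκ⟩ := Path.Homotopic.Quotient.mk_surjective c
    obtain ⟨C, hC, h'⟩ := h α₀ β₀ hα₀ hβ₀
    refine ⟨C, hC, ?_⟩
    have e1 : Path.Homotopic.Quotient.mk α = .mk (α₀.trans κ) := by
      rw [hα, Path.Homotopic.Quotient.mk_trans, hα₀, hκ]
    have e2 : Path.Homotopic.Quotient.mk β = .mk (β₀.trans κ) := by
      rw [hβ, Path.Homotopic.Quotient.mk_trans, hβ₀, hκ]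
    have hmem : ∀ {p q : puncturedSphere s} (γ : Path p q), ∀ᶠ u in 𝓝 s,
        ∀ v, (γ.map continuous_subtype_val) v ∈ puncturedSphere u := fun γ =>
      eventually_path_mem fun v => (γ v).2
    filter_upwards [eventually_continuation_eq (k := k) e1, eventually_continuation_eq (k := k) e2,
      hD.mem_nhds hs, h', hmem α₀, hmem β₀, hmem κ] with u h1 h2 huD h3 h4 h5 h6
    rw [h1 _ (hsum u huD), h2 _ (hsum u huD), Path.map_trans, Path.map_trans,
      continuation_trans (hsum u huD) h4 h6, continuation_trans (hsum u huD) h5 h6, h3, mul_assoc]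

/-- In an isomonodromic family the monodromy of each loop is locally constant. -/
theorem IsIsomonodromic.exists_eventually_continuation_eq (h : IsIsomonodromic D Q) (hD : IsOpen D)
    (hDinj : ∀ t ∈ D, Function.Injective t) (hQ : ∀ j, DifferentiableOn ℂ (Q j) D)
    (hsum : ∀ t ∈ D, ∑ j, Q j t = 0) {t : Fin n → ℂ} (ht : t ∈ D) {γ : Path (∞ : OnePoint ℂ) ∞}
    (hγ : ∀ s, γ s ∈ puncturedSphere t) :
    ∃ M : Matrix (Fin k) (Fin k) ℂ, ∀ᶠ u in 𝓝 t, continuation u (fun j => Q j u) γ = M := by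
  classical
  obtain ⟨W, hW, hWc, hWD, hM⟩ := h t ht
  have htW : t ∈ Set.univ.pi W := fun j _ => hW.mem j
  rw [closure_pi_set] at hWc hWD
  have htK : t ∈ Set.univ.pi fun j => closure (W j) := fun j _ => subset_closure (hW.mem j)
  have hup : ∀ u ∈ Set.univ.pi (fun j => closure (W j)), ∀ j, ∀ z ∈ closure (W j),
      Function.update u j z ∈ Set.univ.pi fun j => closure (W j) := by
    intro u hu j z hz i _
    by_cases hij : i = j
    · subst hij
      simpa using hz
    · rw [Function.update_of_ne hij]
      exact hu i trivial
  have hK : ∀ j, IsCompact (closure (W j)) := by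
    intro j
    refine (hWc.image (continuous_apply j)).of_isClosed_subset isClosed_closure fun z hz => ?_
    exact ⟨_, hup t htK j z hz, Function.update_self ..⟩
  -- A common point `z` could be taken as both the coordinate `i` and the coordinate `j` of a point
  -- of `D`, against injectivity.
  have hdisj : ∀ i j, i ≠ j → Disjoint (closure (W i)) (closure (W j)) := by
    intro i j hij
    rw [Set.disjoint_left]
    intro z hz hz'
    have h1 := hDinj _ (hWD (hup _ (hup t htK i z hz) j z hz'))
    refine hij (h1 ?_)
    rw [Function.update_of_ne hij, Function.update_self, Function.update_self]
  have hWopen : IsOpen (Set.univ.pi W) := isOpen_set_pi Set.finite_univ fun j _ => hW.isOpen j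
  have hWsub : Set.univ.pi W ⊆ D :=
    (Set.pi_mono fun j _ => subset_closure).trans hWD
  obtain ⟨ε, hε, hball⟩ := Metric.mem_nhds_iff.1
    (inter_mem (eventually_path_mem hγ) (hWopen.mem_nhds htW))
  obtain ⟨s, hs, -, hR⟩ := PathRel.exists_total hK hdisj
    (fun j => (hW.isConnected_compl j).isPreconnected)
    (fun j => interior_mono subset_closure ((hW.isOpen j).interior_eq.symm ▸ hW.mem j))
    (ball_mem_nhds t hε)
  have hsW := (hball hs).2
  have hsγ := (hball hs).1
  -- For paths avoiding all `closure (W j)` the loop `α β⁻¹` has the same monodromy for all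
  -- parameters in `𝓦`, and this matrix is the constant factor.
  have htot := hR (continuationRel hD hsum (hWsub hsW)) fun x α β hα hβ α' β' hα' hβ' => by
    have hαP : ∀ u, (α.map continuous_subtype_val) u ∈ perforatedSphere W := hα
    have hβP' : ∀ u, (β.map continuous_subtype_val) u ∈ perforatedSphere W := hβ
    have hβP : ∀ u, (β.map continuous_subtype_val).symm u ∈ perforatedSphere W := fun u => hβ _
    have hloop := path_trans_mem hαP hβP
    set δ := (α.map continuous_subtype_val).trans (β.map continuous_subtype_val).symm with hδ
    have hsub : ∀ {u} (hu : u ∈ Set.univ.pi W) {x y : OnePoint ℂ} {κ : Path x y},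
        (∀ v, κ v ∈ perforatedSphere W) → ∀ v, κ v ∈ puncturedSphere u :=
      fun hu _ _ _ hκ v => perforatedSphere_subset hu (hκ v)
    refine ⟨continuation s (fun j => Q j s) δ,
      isUnit_continuation (A := fun j => Q j s) (hsum s (hWsub hsW)) (hsub hsW hloop), ?_⟩
    filter_upwards [hWopen.mem_nhds hsW,
      eventually_continuation_eq (k := k) hα', eventually_continuation_eq (k := k) hβ']
      with u hu h1 h2
    have hQu := hsum u (hWsub hu)
    obtain ⟨M, hM1, hM2⟩ := hM δ hloop s u hsW hu
    rw [isMonodromyMatrix_loopClass_iff (hsum s (hWsub hsW))] at hM1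
    rw [isMonodromyMatrix_loopClass_iff hQu] at hM2
    rw [h1 _ hQu, h2 _ hQu, ← hM1, hM2, hδ,
      continuation_trans (A := fun j => Q j u) hQu (hsub hu hαP) (hsub hu hβP), ← mul_assoc,
      continuation_mul_symm (A := fun j => Q j u) hQu (hsub hu hβP'), one_mul]
  -- Comparison of `γ` with the constant path shows that its monodromy is constant near `s`.
  obtain ⟨C, -, hC⟩ := htot (.mk (pathIn γ hsγ _ _)) (.refl _) (pathIn γ hsγ _ _) (.refl _) rfl rfl
  have hC' : ∀ᶠ u in 𝓝 s, continuation u (fun j => Q j u) γ = C := by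
    filter_upwards [hC, hWopen.mem_nhds hsW] with u hu huW
    have e : continuation u (fun j => Q j u) (Path.refl (∞ : OnePoint ℂ)) = 1 :=
      continuation_refl (hsum u (hWsub huW)) (infty_mem_puncturedSphere u)
    have hu' : continuation u (fun j => Q j u) γ =
        continuation u (fun j => Q j u) (Path.refl (∞ : OnePoint ℂ)) * C := hu
    rw [hu', e, one_mul]
  refine ⟨C, ?_⟩
  filter_upwards [ball_mem_nhds t hε] with u hu
  -- On the complex line through `s` and `u` the continuation along `γ` is analytic over a convex
  -- set of parameters, so the identity theorem carries the constant from `s` to `u`.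
  set f : ℂ → Fin n → ℂ := fun μ => s + μ • (u - s) with hf
  have hfd : Differentiable ℂ f := by fun_prop
  have hO : Convex ℝ (f ⁻¹' ball t ε) := by
    intro μ hμ ν hν a b ha hb hab
    have := (convex_ball t ε) hμ hν ha hb hab
    have e : f (a • μ + b • ν) = a • f μ + b • f ν := by
      obtain rfl : b = 1 - a := by linarith
      ext i
      simp [hf]
      ring
    rw [Set.mem_preimage, e]
    exact this
  have han : AnalyticOnNhd ℂ (fun μ => continuation (f μ) (fun j => Q j (f μ)) γ)
      (f ⁻¹' ball t ε) := by
    intro μ hμ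
    have hμD : f μ ∈ D := hWsub (hball hμ).2
    exact analyticAt_continuation (t := f) (A := fun μ j => Q j (f μ)) (analyticAt_coord hfd μ)
      (analyticAt_comp_of_differentiable hD hQ hfd hμD) (eventually_sum_eq_zero hD hsum hfd hμD)
      (hball hμ).1
  have h0 : f 0 = s := by simp [hf]
  have h1 : f 1 = u := by simp [hf]
  have heq := han.eqOn_of_preconnected_of_eventuallyEq
    (g := fun _ => C) (fun _ _ => analyticAt_const) hO.isPreconnected (z₀ := 0)
    (by rw [Set.mem_preimage, h0]; exact hs)
    ((h0.symm ▸ hfd.continuous.continuousAt : Tendsto f (𝓝 0) (𝓝 s)).eventually hC')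
  have := heq (show (1 : ℂ) ∈ f ⁻¹' ball t ε by rw [Set.mem_preimage, h1]; exact hu)
  simpa only [h1] using this

/-- Two paths `α`, `β` to `x` differ by the loop `α β⁻¹`, whose monodromy is locally constant in
`t`. Hence the logarithmic derivative in `t_j` does not depend on the path and can serve as `T j`.
-/
theorem IsIsomonodromic.satisfiesAuxiliarySystem (h : IsIsomonodromic D Q) (hD : IsOpen D)
    (hDinj : ∀ t ∈ D, Function.Injective t) (hQ : ∀ j, DifferentiableOn ℂ (Q j) D)
    (hsum : ∀ t ∈ D, ∑ j, Q j t = 0) : SatisfiesAuxiliarySystem D Q := by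
  have key : ∀ (j : Fin n) (t : Fin n → ℂ), ∃ T : OnePoint ℂ → Matrix (Fin k) (Fin k) ℂ, t ∈ D →
      HolomorphicOnSphere T (puncturedSphere t) ∧
      ∀ (x : OnePoint ℂ) (α : Path ∞ x), (∀ s, α s ∈ puncturedSphere t) →
        HasDerivAt (fun τ : ℂ => valueAlong Q α (Function.update t j τ))
          (T x * valueAlong Q α t) (t j) := by
    intro j t
    by_cases ht : t ∈ D
    swap
    · exact ⟨0, fun h => absurd h ht⟩
    set f : ℂ → Fin n → ℂ := fun τ => Function.update t j τ with hf
    have hfd : Differentiable ℂ f := differentiable_update t j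
    have hft : f (t j) = t := Function.update_eq_self j t
    have hfD : f (t j) ∈ D := by rwa [hft]
    have h1 := analyticAt_coord hfd (t j)
    have h2 := analyticAt_comp_of_differentiable hD hQ hfd hfD
    have h3 := eventually_sum_eq_zero hD hsum hfd hfD
    obtain ⟨T, hT1, hT2⟩ := exists_holomorphicOnSphere_logDeriv h1 h2 h3 fun x α β hα hβ => by
      have hβ' : ∀ s, β.symm s ∈ puncturedSphere (f (t j)) := fun s => hβ _
      have hloop := path_trans_mem hα hβ'
      obtain ⟨M, hM⟩ := h.exists_eventually_continuation_eq hD hDinj hQ hsum ht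
        (γ := α.trans β.symm) (by rwa [hft] at hloop)
      refine logDerivContinuation_eq_of_eventually_mul h1 h2 h3 hα hβ (C := M) ?_
      have hcont : Tendsto f (𝓝 (t j)) (𝓝 t) := by
        have := hfd.continuous.continuousAt (x := t j)
        rwa [ContinuousAt, hft] at this
      filter_upwards [hcont.eventually hM, h3, eventually_path_mem_family h1 hα,
        eventually_path_mem_family h1 hβ, eventually_path_mem_family h1 hβ'] with μ e1 e2 e3 e4 e5
      rw [← e1, continuation_trans (A := fun j => Q j (f μ)) e2 e3 e5, ← mul_assoc,
        continuation_mul_symm (A := fun j => Q j (f μ)) e2 e4, one_mul]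
    refine ⟨T, fun _ => ⟨by rwa [hft] at hT1, fun x α hα => ?_⟩⟩
    have hα' : ∀ s, α s ∈ puncturedSphere (f (t j)) := by rwa [hft]
    have h4 := hasDerivAt_continuation h1 h2 h3 hα'
    rw [← hT2 x α hα'] at h4
    rw [valueAlong_eq (hsum t ht)]
    simp only [hft] at h4
    refine h4.congr_of_eventuallyEq ?_
    filter_upwards [h3] with μ hμ
    exact valueAlong_eq hμ α
  choose T hT using key
  refine ⟨fun j x t => T j t x, fun t ht j => (hT j t ht).1,
    fun t ht => solvesFuchsian_normalizedSolution (hsum t ht),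
    fun t ht x α hα j => (hT j t ht).2 x α hα⟩

end Deformation

end Fuchsian

theorem proposition3p1 {n k : ℕ} (D : Set (Fin n → ℂ)) (hD : IsOpen D) (hDc : IsConnected D)
    (hDinj : ∀ t ∈ D, Function.Injective t)
    (Q : Fin n → (Fin n → ℂ) → Matrix (Fin k) (Fin k) ℂ)
    (hQ : ∀ j, DifferentiableOn ℂ (Q j) D)
    (hsum : ∀ t ∈ D, ∑ j, Q j t = 0) :
    Fuchsian.IsIsomonodromic D Q ↔ Fuchsian.SatisfiesAuxiliarySystem D Q :=
  ⟨fun h => h.satisfiesAuxiliarySystem hD hDinj hQ hsum,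
    Fuchsian.isIsomonodromic_of_satisfiesAuxiliarySystem hD hsum⟩
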